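/- **Setting.** Fix $p,r\in\mathbb N$ and an exosystem $x_r(k+1)=A_rx_r(k)$, $y_r(k)=C_rx_r(k)\in\mathbb R^p$, $x_r(k)\in\mathbb R^r$, such that all eigenvalues of $A_r$ lie on the unit circle and $(C_r,A_r)$ is observable. Let $(M_j)_{j\in J}$ be a family of agent models $M_j=(A_j,B_j,E_j,C_j,G_j,C_j^m,S_j)$ (real matrices, of dimensions that may depend on $j$, with $p$ outputs), such that for every $j$: * $(A_j,B_j)$ is stabilizable; * with $\mathcal A_j=\begin{pmatrix}A_j&-E_j\\0&S_j\end{pmatrix}$, the pairs $\big(\begin{pmatrix}C_j&-G_j\end{pmatrix},\mathcal A_j\big)$ and $\big(\begin{pmatrix}C_j^m&0\end{pmatrix},\mathcal A_j\big)$ are detectable; * $(C_j,A_j,B_j)$ is right-invertible, and none of its invariant zeros of modulus $\ge1$ is an eigenvalue of $S_j$. Assume that the orders of the infinite zeros of $(C_j,A_j,B_j)$, $j\in J$, are bounded (automatic if $J$ is finite). A *network* consists of $N\in\mathbb N$ nodes, weights $a_{ij}\ge0$ with $a_{ii}=0$ (there is an edge from $j$ to $i$ iff $a_{ij}>0$),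 numbers $\bar d_i\ge\sum_ja_{ij}$, and a root set $\mathscr C\subseteq\{1,\dots,N\}$ such that every node is reachable by a directed path from a node of $\mathscr C$. Put $\iota_i=1$ for $i\in\mathscr C$, $\iota_i=0$ otherwise, and $g_i=\iota_i/(2+\bar d_i)$. Node $i$ carries an agent with a model of the family (written $A_i$, etc.): $$x_i(k+1)=A_ix_i(k)+B_iu_i(k)+E_i\omega_i(k),\quad \omega_i(k+1)=S_i\omega_i(k),\quad y_i=C_ix_i+G_i\omega_i,\quad z_i=C_i^mx_i .$$ Agent $i$ knows $z_i$ and, when the agents exchange protocol variables $\eta_i$, $$\tilde\zeta_i=\tfrac1{2+\bar d_i}\Big(\sum_ja_{ij}(y_i-y_j)+\iota_i(y_i-y_r)\Big),\qquad \hat\zeta_i=\tfrac1{2+\bar d_i}\sum_ja_{ij}(\eta_i-\eta_j).$$ **Claim 1 (solvability).** There are $s\in\mathbb N$ and, for each $j\in J$, a linear protocol with constant matrices, depending on the models and the exosystem but not on the network, $$x_c(k+1)=(A_c+g\,L_c)x_c(k)+B_c\tilde\zeta(k)+C_c\hat\zeta(k)+D_cz(k),\quad u(k)=E_cx_c(k)+F_c\tilde\zeta(k)+G_c\hat\zeta(k)+H_cz(k),$$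 with $\eta=M_cx_c\in\mathbb R^s$ and $g=g_i$ at node $i$, such that for every network with any $N$, every assignment of models to nodes, and all initial conditions of agents, protocols, disturbances and exosystem, $y_i(k)-y_r(k)\to0$ as $k\to\infty$ for all $i$. **Claim 2 (explicit protocol).** Let $n_q\ge1$ be an integer that is at least the orders of all infinite zeros of all $(C_j,A_j,B_j)$ and at least all observability indices of $(C_r,A_r)$. (a) There is a *target model* $(C_h,A_h,B_h)$ with $p$ inputs and $p$ outputs: it is invertible, of uniform rank $n_q$, has no invariant zeros, the characteristic polynomial of $A_h$ is that of $A_r$ times a power of the variable, and every output $y_r$ of the exosystem equals $C_hA_h^kx_{h0}$ for some $x_{h0}$. Fix any target model. (b) There are $H,K$ such that $A_h-HC_h$ and $A_h-B_hK$ are Schur stable. (c) For every $j$ such that $S_j$ has no eigenvalue of modulus $<1$, there are three pre-compensators for $M_j$ as follows (index $j$ omitted). * I: $q^+=A_qq+B_qu^q$, $u=C_qq+D_qu^q$ with $A_q$ Schur stable and $u^q\in\mathbb R^p$. The cascade with the agent, $\tilde A_q=\begin{pmatrix}A&BC_q\\0&A_q\end{pmatrix}$, $\tilde B_q=\begin{pmatrix}BD_q\\B_q\end{pmatrix}$,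 $\tilde E_q=\begin{pmatrix}E\\0\end{pmatrix}$, $\tilde C_q=\begin{pmatrix}C&0\end{pmatrix}$, $\tilde C_q^m=\begin{pmatrix}C^m&0\end{pmatrix}$, is invertible; $(\tilde A_q,\tilde B_q)$ is stabilizable; $(\tilde C_q,\tilde A_q)$ and $(\tilde C_q^m,\tilde A_q)$ are detectable; the infinite zero structure is that of $(C,A,B)$; the invariant zeros are those of $(C,A,B)$ and possibly others in the open unit disc. * II: $\mathsf p^+=S\mathsf p+B_pv$, $u^q=\Gamma \mathsf p+D_pv$, $v\in\mathbb R^p$, invertible and of minimum phase, with $\Pi S=\tilde A_q\Pi+\tilde B_q\Gamma+\tilde E_q$ and $\tilde C_q\Pi+G=0$ for some matrix $\Pi$. * III: $\xi^+=\mathsf A\xi+\mathsf B\bar z+\mathsf E\check u$, $v=\mathsf C\xi+\mathsf D\check u+\mathsf F\bar z$, which almost homogenizes the system $\bar x^+=\tilde A\bar x+\tilde Bv$, $y=\tilde C\bar x$, $\bar z=\tilde C^m\bar x$, where $\tilde A=\begin{pmatrix}\tilde A_q&\tilde B_q\Gamma\\0&S\end{pmatrix}$, $\tilde B=\begin{pmatrix}\tilde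 B_qD_p\\B_p\end{pmatrix}$, $\tilde C=\begin{pmatrix}\tilde C_q&0\end{pmatrix}$, $\tilde C^m=\begin{pmatrix}\tilde C_q^m&-\tilde C_q^m\Pi\end{pmatrix}$: there are a Schur stable $A_s$ and a $C_s$ such that for every trajectory of the cascade, with any input $\check u$, there are $\check x,\sigma$ with $\check x^+=A_h\check x+B_h(\check u+C_s\sigma)$, $\sigma^+=A_s\sigma$, $y=C_h\check x$. (d) For any $H,K$ as in (b), any network, any assignment of models, and any pre-compensators as in (c) for the agents, the combination of I, II and III (with $\bar z_i=z_i-\tilde C_{q,i}^m\Pi_i\mathsf p_i$) and the scalable protocol $$\begin{aligned}\hat x_i^+&=A_h\hat x_i-B_hK\hat\zeta_i+H(\tilde\zeta_i-C_h\hat x_i)-g_iB_hK\chi_i,\\ \chi_i^+&=A_h\chi_i+B_h\check u_i+A_h(\hat x_i-\hat\zeta_i-g_i\chi_i),\qquad \check u_i=-K\chi_i,\quad \eta_i=\chi_i,\end{aligned}$$ achieves $y_i(k)-y_r(k)\to0$ for all $i$ and all initial conditions of agents, protocols, disturbances and exosystem. -/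

import Mathlib

open Matrix Filter Topology

noncomputable section

namespace MAS

/-! ### Linear discrete-time systems `x⁺ = A x + B u`, `y = C x + D u` -/

/-- The complex spectrum (set of eigenvalues) of a real square matrix. -/
def eigenvalues {α : Type*} [Fintype α] [DecidableEq α] (A : Matrix α α ℝ) : Set ℂ :=
  spectrum ℂ (A.map (algebraMap ℝ ℂ))

/-- Schur stability: all eigenvalues lie in the open unit disc. -/
def IsSchur {α : Type*} [Fintype α] [DecidableEq α] (A : Matrix α α ℝ) : Prop :=
  ∀ s ∈ eigenvalues A, ‖s‖ < 1

/-- `(A, B)` is stabilizable: some state feedback makes it Schur stable. -/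
def Stabilizable {α β : Type*} [Fintype α] [DecidableEq α] [Fintype β]
    (A : Matrix α α ℝ) (B : Matrix α β ℝ) : Prop :=
  ∃ F : Matrix β α ℝ, IsSchur (A + B * F)

/-- `(C, A)` is detectable: some output injection makes it Schur stable. -/
def Detectable {α γ : Type*} [Fintype α] [DecidableEq α] [Fintype γ]
    (C : Matrix γ α ℝ) (A : Matrix α α ℝ) : Prop :=
  ∃ L : Matrix α γ ℝ, IsSchur (A + L * C)

/-- `(C, A)` is observable: only the zero initial state gives the zero output. -/
def Observable {α γ : Type*} [Fintype α] [DecidableEq α]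
    (C : Matrix γ α ℝ) (A : Matrix α α ℝ) : Prop :=
  ∀ x : α → ℝ, (∀ k : ℕ, (C * A ^ k) *ᵥ x = 0) → x = 0

/-- The observability index of `(C, A)`, which is the largest of its observability indices: the
least `n` for which the stacked matrix with the blocks `C, C A, …, C A ^ (n - 1)` has a trivial
kernel. -/
def observabilityIndex {α γ : Type*} [Fintype α] [DecidableEq α]
    (C : Matrix γ α ℝ) (A : Matrix α α ℝ) : ℕ :=
  sInf {n : ℕ | ∀ x : α → ℝ, (∀ k < n, (C * A ^ k) *ᵥ x = 0) → x = 0}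

/-- The transfer function matrix `C (z I - A)⁻¹ B + D`. -/
def transfer {α β γ : Type*} [Fintype α] [DecidableEq α]
    (A : Matrix α α ℝ) (B : Matrix α β ℝ) (C : Matrix γ α ℝ) (D : Matrix γ β ℝ) :
    Matrix γ β (RatFunc ℝ) :=
  C.map RatFunc.C * ((RatFunc.X : RatFunc ℝ) • (1 : Matrix α α (RatFunc ℝ))
    - A.map RatFunc.C)⁻¹ * B.map RatFunc.C + D.map RatFunc.C

/-- Right-invertibility: the transfer function matrix has a rational right inverse. -/
def RightInvertible {α β γ : Type*} [Fintype α] [DecidableEq α] [Fintype β] [DecidableEq γ]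
    (A : Matrix α α ℝ) (B : Matrix α β ℝ) (C : Matrix γ α ℝ) (D : Matrix γ β ℝ) : Prop :=
  ∃ R : Matrix β γ (RatFunc ℝ), transfer A B C D * R = 1

/-- Left-invertibility: the transfer function matrix has a rational left inverse. -/
def LeftInvertible {α β γ : Type*} [Fintype α] [DecidableEq α] [Fintype γ] [DecidableEq β]
    (A : Matrix α α ℝ) (B : Matrix α β ℝ) (C : Matrix γ α ℝ) (D : Matrix γ β ℝ) : Prop :=
  ∃ L : Matrix β γ (RatFunc ℝ), L * transfer A B C D = 1

/-- Invertibility: both left- and right-invertible. -/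
def Invertible {α β γ : Type*} [Fintype α] [DecidableEq α] [Fintype β] [DecidableEq β]
    [Fintype γ] [DecidableEq γ]
    (A : Matrix α α ℝ) (B : Matrix α β ℝ) (C : Matrix γ α ℝ) (D : Matrix γ β ℝ) : Prop :=
  LeftInvertible A B C D ∧ RightInvertible A B C D

/-- The Rosenbrock system matrix at the point `s`. -/
def rosenbrock {α β γ : Type*} [DecidableEq α]
    (A : Matrix α α ℝ) (B : Matrix α β ℝ) (C : Matrix γ α ℝ) (D : Matrix γ β ℝ) (s : ℂ) :
    Matrix (α ⊕ γ) (α ⊕ β) ℂ :=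
  fromBlocks (s • (1 : Matrix α α ℂ) - A.map (algebraMap ℝ ℂ)) (-(B.map (algebraMap ℝ ℂ)))
    (C.map (algebraMap ℝ ℂ)) (D.map (algebraMap ℝ ℂ))

/-- Invariant zeros: the points where the system matrix has less than its normal (i.e. maximal)
rank. -/
def IsInvariantZero {α β γ : Type*} [Fintype α] [DecidableEq α] [Fintype β]
    (A : Matrix α α ℝ) (B : Matrix α β ℝ) (C : Matrix γ α ℝ) (D : Matrix γ β ℝ) (s : ℂ) : Prop :=
  ∃ t : ℂ, (rosenbrock A B C D s).rank < (rosenbrock A B C D t).rank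

/-- Minimum phase (discrete time): no invariant zero on or outside the unit circle. -/
def MinimumPhase {α β γ : Type*} [Fintype α] [DecidableEq α] [Fintype β]
    (A : Matrix α α ℝ) (B : Matrix α β ℝ) (C : Matrix γ α ℝ) (D : Matrix γ β ℝ) : Prop :=
  ∀ s : ℂ, IsInvariantZero A B C D s → ‖s‖ < 1

/-- A matrix of proper rational functions. -/
def IsProper {α β : Type*} (U : Matrix α β (RatFunc ℝ)) : Prop :=
  ∀ i j, (U i j).intDegree ≤ 0

/-- A square rational matrix that is proper and has a proper inverse. -/
def IsBiproper {α : Type*} [Fintype α] [DecidableEq α] (U : Matrix α α (RatFunc ℝ)) : Prop :=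
  IsProper U ∧ ∃ V : Matrix α α (RatFunc ℝ), IsProper V ∧ U * V = 1

/-- The rectangular diagonal matrix with the entries `z ^ (-q₀), z ^ (-q₁), …`, followed by
zeros. -/
def infinityForm (p m : ℕ) (q : List ℕ) : Matrix (Fin p) (Fin m) (RatFunc ℝ) :=
  Matrix.of fun i j =>
    if (i : ℕ) = (j : ℕ) then (q[(i : ℕ)]?).elim 0 (fun a => ((RatFunc.X : RatFunc ℝ) ^ a)⁻¹) else 0

/-- `q` lists (in some order) the orders of the infinite zeros of `(C, A, B)`: the transfer function
matrix has the Smith-McMillan form `diag (z ^ (-q₀), z ^ (-q₁), …)` at infinity. -/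
def IsInfiniteZeroStructure {α : Type*} [Fintype α] [DecidableEq α] {p m : ℕ}
    (A : Matrix α α ℝ) (B : Matrix α (Fin m) ℝ) (C : Matrix (Fin p) α ℝ) (q : List ℕ) : Prop :=
  q.length ≤ p ∧ q.length ≤ m ∧
    ∃ (U : Matrix (Fin p) (Fin p) (RatFunc ℝ)) (V : Matrix (Fin m) (Fin m) (RatFunc ℝ)),
      IsBiproper U ∧ IsBiproper V ∧ transfer A B C 0 = U * infinityForm p m q * V

/-- The set of the orders of the infinite zeros of `(C, A, B)`. -/
def infiniteZeroOrders {α : Type*} [Fintype α] [DecidableEq α] {p m : ℕ}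
    (A : Matrix α α ℝ) (B : Matrix α (Fin m) ℝ) (C : Matrix (Fin p) α ℝ) : Set ℕ :=
  {a | ∃ q, IsInfiniteZeroStructure A B C q ∧ a ∈ q}

/-- The square system `(C, A, B)` is of uniform rank `ρ ≥ 1`: its first nonzero Markov parameter is
`C A ^ (ρ - 1) B`, and that one is invertible. -/
def UniformRank {α γ : Type*} [Fintype α] [DecidableEq α] [Fintype γ] [DecidableEq γ]
    (A : Matrix α α ℝ) (B : Matrix α γ ℝ) (C : Matrix γ α ℝ) (ρ : ℕ) : Prop :=
  1 ≤ ρ ∧ (∀ k, k + 1 < ρ → C * A ^ k * B = 0) ∧ IsUnit (C * A ^ (ρ - 1) * B)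

/-! ### Agents -/

/-- The model of an introspective agent with `p` outputs,
`x⁺ = A x + B u + E ω`, `y = C x + G ω`, `z = Cm x`, with disturbance generator `ω⁺ = S ω`. -/
structure AgentModel (p : ℕ) where
  n : ℕ
  m : ℕ
  d : ℕ
  l : ℕ
  A : Matrix (Fin n) (Fin n) ℝ
  B : Matrix (Fin n) (Fin m) ℝ
  E : Matrix (Fin n) (Fin d) ℝ
  C : Matrix (Fin p) (Fin n) ℝ
  G : Matrix (Fin p) (Fin d) ℝ
  Cm : Matrix (Fin l) (Fin n) ℝ
  S : Matrix (Fin d) (Fin d) ℝ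

/-- The dynamics of the agent together with its disturbance. -/
structure AgentModel.Dynamics {p : ℕ} (M : AgentModel p) (x : ℕ → Fin M.n → ℝ)
    (w : ℕ → Fin M.d → ℝ) (u : ℕ → Fin M.m → ℝ) : Prop where
  state : ∀ k, x (k + 1) = M.A *ᵥ x k + M.B *ᵥ u k + M.E *ᵥ w k
  disturbance : ∀ k, w (k + 1) = M.S *ᵥ w k

/-- The output `y = C x + G ω`. -/
def AgentModel.output {p : ℕ} (M : AgentModel p) (x : ℕ → Fin M.n → ℝ)
    (w : ℕ → Fin M.d → ℝ) (k : ℕ) : Fin p → ℝ :=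
  M.C *ᵥ x k + M.G *ᵥ w k

/-- The local measurement `z = Cm x`. -/
def AgentModel.measurement {p : ℕ} (M : AgentModel p) (x : ℕ → Fin M.n → ℝ) (k : ℕ) :
    Fin M.l → ℝ :=
  M.Cm *ᵥ x k

/-- The standing assumptions on an agent model. -/
structure AgentModel.Admissible {p : ℕ} (M : AgentModel p) : Prop where
  stabilizable : Stabilizable M.A M.B
  detectable_output : Detectable (fromCols M.C (-M.G)) (fromBlocks M.A (-M.E) 0 M.S)
  rightInvertible : RightInvertible M.A M.B M.C 0
  detectable_measurement :
    Detectable (fromCols M.Cm (0 : Matrix (Fin M.l) (Fin M.d) ℝ)) (fromBlocks M.A (-M.E) 0 M.S)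
  zeros : ∀ s : ℂ, 1 ≤ ‖s‖ → IsInvariantZero M.A M.B M.C 0 s → s ∉ eigenvalues M.S

/-! ### The network -/

/-- A weighted directed graph on `N` nodes without self-loops (`a i j > 0` means that there is an
edge from `j` to `i`), an upper bound `dbar i` of the weighted in-degree of each node, and a set of
nodes (the root set) which have access to the output of the exosystem. -/
structure Network (N : ℕ) where
  a : Matrix (Fin N) (Fin N) ℝ
  a_nonneg : ∀ i j, 0 ≤ a i j
  a_diag : ∀ i, a i i = 0
  dbar : Fin N → ℝ
  inDegree_le : ∀ i, ∑ j, a i j ≤ dbar i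
  roots : Finset (Fin N)

/-- Every node can be reached by a directed path that starts in the root set. -/
def Network.Rooted {N : ℕ} (G : Network N) : Prop :=
  ∀ i, ∃ c ∈ G.roots, Relation.ReflTransGen (fun j i => 0 < G.a i j) c i

/-- The indicator of the root set. -/
def Network.iota {N : ℕ} (G : Network N) (i : Fin N) : ℝ :=
  if i ∈ G.roots then 1 else 0

/-- The relative output information available to agent `i`. -/
def Network.zetaTilde {N p : ℕ} (G : Network N) (y : Fin N → ℕ → Fin p → ℝ)
    (yr : ℕ → Fin p → ℝ) (i : Fin N) (k : ℕ) : Fin p → ℝ :=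
  (1 / (2 + G.dbar i)) • (∑ j, G.a i j • (y i k - y j k) + G.iota i • (y i k - yr k))

/-- The localized exchange of protocol variables available to agent `i`. -/
def Network.zetaHat {N s : ℕ} (G : Network N) (c : Fin N → ℕ → Fin s → ℝ)
    (i : Fin N) (k : ℕ) : Fin s → ℝ :=
  (1 / (2 + G.dbar i)) • ∑ j, G.a i j • (c i k - c j k)

/-- The local gain `ι_i / (2 + dbar i)`. -/
def Network.gain {N : ℕ} (G : Network N) (i : Fin N) : ℝ :=
  G.iota i / (2 + G.dbar i)

/-! ### The scalable regulated output synchronization problem -/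

/-- A linear dynamic protocol for an agent with model `M`. It exchanges the `s`-dimensional variable
`Mc x_c`. The state matrix is `Ac + g • Lc`, where `g` is the local gain of the agent. -/
structure Protocol {p : ℕ} (M : AgentModel p) (s : ℕ) where
  nc : ℕ
  Ac : Matrix (Fin nc) (Fin nc) ℝ
  Lc : Matrix (Fin nc) (Fin nc) ℝ
  Bc : Matrix (Fin nc) (Fin p) ℝ
  Cc : Matrix (Fin nc) (Fin s) ℝ
  Dc : Matrix (Fin nc) (Fin M.l) ℝ
  Ec : Matrix (Fin M.m) (Fin nc) ℝ
  Fc : Matrix (Fin M.m) (Fin p) ℝ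
  Gc : Matrix (Fin M.m) (Fin s) ℝ
  Hc : Matrix (Fin M.m) (Fin M.l) ℝ
  Mc : Matrix (Fin s) (Fin nc) ℝ

/-- The closed loop of the agents, the exosystem and the protocols over a network. -/
structure IsClosedLoop {p r N s : ℕ} (Ar : Matrix (Fin r) (Fin r) ℝ) (Cr : Matrix (Fin p) (Fin r) ℝ)
    (M : Fin N → AgentModel p) (P : ∀ i, Protocol (M i) s) (G : Network N)
    (xr : ℕ → Fin r → ℝ)
    (x : ∀ i, ℕ → Fin (M i).n → ℝ) (w : ∀ i, ℕ → Fin (M i).d → ℝ) (u : ∀ i, ℕ → Fin (M i).m → ℝ)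
    (xc : ∀ i, ℕ → Fin (P i).nc → ℝ) : Prop where
  reference : ∀ k, xr (k + 1) = Ar *ᵥ xr k
  agent : ∀ i, (M i).Dynamics (x i) (w i) (u i)
  protocol : ∀ i k, xc i (k + 1) = ((P i).Ac + G.gain i • (P i).Lc) *ᵥ xc i k
    + (P i).Bc *ᵥ G.zetaTilde (fun j => (M j).output (x j) (w j)) (fun t => Cr *ᵥ xr t) i k
    + (P i).Cc *ᵥ G.zetaHat (fun j t => (P j).Mc *ᵥ xc j t) i k
    + (P i).Dc *ᵥ (M i).measurement (x i) k
  control : ∀ i k, u i k = (P i).Ec *ᵥ xc i k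
    + (P i).Fc *ᵥ G.zetaTilde (fun j => (M j).output (x j) (w j)) (fun t => Cr *ᵥ xr t) i k
    + (P i).Gc *ᵥ G.zetaHat (fun j t => (P j).Mc *ᵥ xc j t) i k
    + (P i).Hc *ᵥ (M i).measurement (x i) k

/-- Solvability of scalable regulated output synchronization for agents with models from the family
`M`: one protocol for each model, chosen before the network is known, achieves `y_i - y_r → 0` for
all numbers of agents, all assignments of models to nodes, all root sets and rooted graphs, and all
initial conditions of agents, protocols, disturbances and reference. -/
def ScalableRegulatedSynchronizationSolvable {p r : ℕ} {J : Type*}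
    (Ar : Matrix (Fin r) (Fin r) ℝ) (Cr : Matrix (Fin p) (Fin r) ℝ)
    (M : J → AgentModel p) : Prop :=
  ∃ (s : ℕ) (P : ∀ j, Protocol (M j) s),
    ∀ (N : ℕ) (G : Network N), G.Rooted → ∀ (g : Fin N → J)
      (xr : ℕ → Fin r → ℝ)
      (x : ∀ i, ℕ → Fin (M (g i)).n → ℝ) (w : ∀ i, ℕ → Fin (M (g i)).d → ℝ)
      (u : ∀ i, ℕ → Fin (M (g i)).m → ℝ) (xc : ∀ i, ℕ → Fin (P (g i)).nc → ℝ),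
      IsClosedLoop Ar Cr (fun i => M (g i)) (fun i => P (g i)) G xr x w u xc →
      ∀ i, Tendsto (fun k => (M (g i)).output (x i) (w i) k - Cr *ᵥ xr k) atTop (𝓝 0)

/-! ### Design of the explicit protocol -/

/-- A target model `(C_h, A_h, B_h)` with `p` inputs and `p` outputs. -/
structure TargetModel (p : ℕ) where
  h : ℕ
  A : Matrix (Fin h) (Fin h) ℝ
  B : Matrix (Fin h) (Fin p) ℝ
  C : Matrix (Fin p) (Fin h) ℝ

/-- The target model remodels the exosystem `(C_r, A_r)`: it generates all its outputs, is
invertible, of uniform rank `nq`, has no invariant zeros, and its eigenvalues are those of `A_r` and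
additional zeros. -/
structure TargetModel.Remodels {p r : ℕ} (T : TargetModel p) (Ar : Matrix (Fin r) (Fin r) ℝ)
    (Cr : Matrix (Fin p) (Fin r) ℝ) (nq : ℕ) : Prop where
  outputs : ∀ xr0 : Fin r → ℝ, ∃ xh0 : Fin T.h → ℝ,
    ∀ k : ℕ, T.C *ᵥ (T.A ^ k *ᵥ xh0) = Cr *ᵥ (Ar ^ k *ᵥ xr0)
  invertible : Invertible T.A T.B T.C 0
  uniformRank : UniformRank T.A T.B T.C nq
  no_zeros : ∀ s, ¬ IsInvariantZero T.A T.B T.C 0 s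
  charpoly : ∃ e : ℕ, T.A.charpoly = Ar.charpoly * Polynomial.X ^ e

/-- The data of the three pre-compensators for an agent:
I: `q⁺ = Aq q + Bq uq`, `u = Cq q + Dq uq`;
II: `p⁺ = S p + Bp v`, `uq = Γ p + Dp v`, together with the matrix `Π`;
III: `ξ⁺ = Ah ξ + Bh z̄ + Eh ǔ`, `v = Ch ξ + Dh ǔ + Fh z̄`. -/
structure PreCompensators {p : ℕ} (M : AgentModel p) where
  nq : ℕ
  Aq : Matrix (Fin nq) (Fin nq) ℝ
  Bq : Matrix (Fin nq) (Fin p) ℝ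
  Cq : Matrix (Fin M.m) (Fin nq) ℝ
  Dq : Matrix (Fin M.m) (Fin p) ℝ
  Pi : Matrix (Fin M.n ⊕ Fin nq) (Fin M.d) ℝ
  Gam : Matrix (Fin p) (Fin M.d) ℝ
  Bp : Matrix (Fin M.d) (Fin p) ℝ
  Dp : Matrix (Fin p) (Fin p) ℝ
  nh : ℕ
  Ah : Matrix (Fin nh) (Fin nh) ℝ
  Bh : Matrix (Fin nh) (Fin M.l) ℝ
  Eh : Matrix (Fin nh) (Fin p) ℝ
  Ch : Matrix (Fin p) (Fin nh) ℝ
  Dh : Matrix (Fin p) (Fin p) ℝ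
  Fh : Matrix (Fin p) (Fin M.l) ℝ

namespace PreCompensators

variable {p : ℕ} {M : AgentModel p} (D : PreCompensators M)

/-- State matrix of the cascade of pre-compensator I and the agent. -/
def cascA : Matrix (Fin M.n ⊕ Fin D.nq) (Fin M.n ⊕ Fin D.nq) ℝ :=
  fromBlocks M.A (M.B * D.Cq) 0 D.Aq

/-- Input matrix of the cascade of pre-compensator I and the agent. -/
def cascB : Matrix (Fin M.n ⊕ Fin D.nq) (Fin p) ℝ :=
  fromRows (M.B * D.Dq) D.Bq

/-- Disturbance matrix of the cascade of pre-compensator I and the agent. -/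
def cascE : Matrix (Fin M.n ⊕ Fin D.nq) (Fin M.d) ℝ :=
  fromRows M.E 0

/-- Output matrix of the cascade of pre-compensator I and the agent. -/
def cascC : Matrix (Fin p) (Fin M.n ⊕ Fin D.nq) ℝ :=
  fromCols M.C 0

/-- Measurement matrix of the cascade of pre-compensator I and the agent. -/
def cascCm : Matrix (Fin M.l) (Fin M.n ⊕ Fin D.nq) ℝ :=
  fromCols M.Cm 0

/-- State matrix of the cascade of pre-compensators I and II and the agent. -/
def fullA : Matrix ((Fin M.n ⊕ Fin D.nq) ⊕ Fin M.d) ((Fin M.n ⊕ Fin D.nq) ⊕ Fin M.d) ℝ :=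
  fromBlocks D.cascA (D.cascB * D.Gam) 0 M.S

/-- Input matrix of the cascade of pre-compensators I and II and the agent. -/
def fullB : Matrix ((Fin M.n ⊕ Fin D.nq) ⊕ Fin M.d) (Fin p) ℝ :=
  fromRows (D.cascB * D.Dp) D.Bp

/-- Output matrix of the cascade of pre-compensators I and II and the agent. -/
def fullC : Matrix (Fin p) ((Fin M.n ⊕ Fin D.nq) ⊕ Fin M.d) ℝ :=
  fromCols D.cascC 0

/-- Matrix of the new measurement `z̄ = z - C̃ᵐ Π p`. -/
def fullCm : Matrix (Fin M.l) ((Fin M.n ⊕ Fin D.nq) ⊕ Fin M.d) ℝ :=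
  fromCols D.cascCm (-(D.cascCm * D.Pi))

/-- Requirements on pre-compensator I: it is asymptotically stable, and it makes the agent
invertible without destroying stabilizability and detectability or changing the infinite zero
structure, and adding invariant zeros in the open unit disc only. -/
structure Step1 : Prop where
  schur : IsSchur D.Aq
  invertible : Invertible D.cascA D.cascB D.cascC 0
  stabilizable : Stabilizable D.cascA D.cascB
  detectable : Detectable D.cascC D.cascA
  detectable_measurement : Detectable D.cascCm D.cascA
  infinite_zeros : ∃ q, IsInfiniteZeroStructure M.A M.B M.C q ∧
    IsInfiniteZeroStructure D.cascA D.cascB D.cascC q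
  keeps_zeros : ∀ s, IsInvariantZero M.A M.B M.C 0 s →
    IsInvariantZero D.cascA D.cascB D.cascC 0 s
  new_zeros : ∀ s, IsInvariantZero D.cascA D.cascB D.cascC 0 s →
    IsInvariantZero M.A M.B M.C 0 s ∨ ‖s‖ < 1

/-- Requirements on pre-compensator II: the regulation equations hold, and the pre-compensator is
invertible and of minimum phase. -/
structure Step2 : Prop where
  regulation_state : D.Pi * M.S = D.cascA * D.Pi + D.cascB * D.Gam + D.cascE
  regulation_output : D.cascC * D.Pi + M.G = 0
  invertible : Invertible M.S D.Bp D.Gam D.Dp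
  minimumPhase : MinimumPhase M.S D.Bp D.Gam D.Dp

/-- Requirement on pre-compensator III: it almost homogenizes the compensated agent
`x̄⁺ = Ã x̄ + B̃ v`, `y = C̃ x̄`, `z̄ = C̃ᵐ x̄` to the target model, i.e. every trajectory of the cascade
is a trajectory of `x̌⁺ = A_h x̌ + B_h (ǔ + φ)`, `y = C_h x̌`, where `φ = C_s σ`, `σ⁺ = A_s σ` and
`A_s` is Schur stable. -/
def Step4 (T : TargetModel p) : Prop :=
  ∃ (ns : ℕ) (As : Matrix (Fin ns) (Fin ns) ℝ) (Cs : Matrix (Fin p) (Fin ns) ℝ), IsSchur As ∧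
    ∀ (xb : ℕ → ((Fin M.n ⊕ Fin D.nq) ⊕ Fin M.d) → ℝ) (xi : ℕ → Fin D.nh → ℝ)
      (v uc : ℕ → Fin p → ℝ),
      (∀ k, xb (k + 1) = D.fullA *ᵥ xb k + D.fullB *ᵥ v k) →
      (∀ k, xi (k + 1) = D.Ah *ᵥ xi k + D.Bh *ᵥ (D.fullCm *ᵥ xb k) + D.Eh *ᵥ uc k) →
      (∀ k, v k = D.Ch *ᵥ xi k + D.Dh *ᵥ uc k + D.Fh *ᵥ (D.fullCm *ᵥ xb k)) →
      ∃ (xch : ℕ → Fin T.h → ℝ) (sig : ℕ → Fin ns → ℝ),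
        (∀ k, xch (k + 1) = T.A *ᵥ xch k + T.B *ᵥ (uc k + Cs *ᵥ sig k)) ∧
        (∀ k, sig (k + 1) = As *ᵥ sig k) ∧
        (∀ k, D.fullC *ᵥ xb k = T.C *ᵥ xch k)

/-- The three pre-compensators meet all requirements of the design for the target model `T`. -/
structure IsDesign (T : TargetModel p) : Prop where
  step1 : D.Step1
  step2 : D.Step2
  step4 : D.Step4 T

/-- The signal `z̄ = z - C̃ᵐ Π p`. -/
def zbar (z : Fin M.l → ℝ) (pp : Fin M.d → ℝ) : Fin M.l → ℝ :=
  z - (D.cascCm * D.Pi) *ᵥ pp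

/-- The output `v` of pre-compensator III. -/
def v (z : Fin M.l → ℝ) (pp : Fin M.d → ℝ) (xi : Fin D.nh → ℝ) (uc : Fin p → ℝ) : Fin p → ℝ :=
  D.Ch *ᵥ xi + D.Dh *ᵥ uc + D.Fh *ᵥ D.zbar z pp

/-- The output `uq` of pre-compensator II. -/
def uq (z : Fin M.l → ℝ) (pp : Fin M.d → ℝ) (xi : Fin D.nh → ℝ) (uc : Fin p → ℝ) : Fin p → ℝ :=
  D.Gam *ᵥ pp + D.Dp *ᵥ D.v z pp xi uc

end PreCompensators

/-- The gains of the observer-based protocol: `A_h - H C_h` and `A_h - B_h K` are Schur stable. -/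
structure TargetModel.IsGainPair {p : ℕ} (T : TargetModel p) (H : Matrix (Fin T.h) (Fin p) ℝ)
    (K : Matrix (Fin p) (Fin T.h) ℝ) : Prop where
  observer : IsSchur (T.A - H * T.C)
  feedback : IsSchur (T.A - T.B * K)

/-- The closed loop of the agents, the exosystem and the explicit protocol: the three
pre-compensators (states `q`, `pp`, `xi`), and the observer-based protocol (states `xhat`, `chi`),
whose output is `ǔ = -K χ`, over a network. -/
structure IsExplicitClosedLoop {p r N : ℕ} (Ar : Matrix (Fin r) (Fin r) ℝ)
    (Cr : Matrix (Fin p) (Fin r) ℝ) (M : Fin N → AgentModel p) (T : TargetModel p)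
    (H : Matrix (Fin T.h) (Fin p) ℝ) (K : Matrix (Fin p) (Fin T.h) ℝ)
    (D : ∀ i, PreCompensators (M i)) (G : Network N)
    (xr : ℕ → Fin r → ℝ)
    (x : ∀ i, ℕ → Fin (M i).n → ℝ) (w : ∀ i, ℕ → Fin (M i).d → ℝ) (u : ∀ i, ℕ → Fin (M i).m → ℝ)
    (q : ∀ i, ℕ → Fin (D i).nq → ℝ) (pp : ∀ i, ℕ → Fin (M i).d → ℝ)
    (xi : ∀ i, ℕ → Fin (D i).nh → ℝ) (xhat chi : Fin N → ℕ → Fin T.h → ℝ) : Prop where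
  reference : ∀ k, xr (k + 1) = Ar *ᵥ xr k
  agent : ∀ i, (M i).Dynamics (x i) (w i) (u i)
  preI : ∀ i k, q i (k + 1) = (D i).Aq *ᵥ q i k
    + (D i).Bq *ᵥ (D i).uq ((M i).measurement (x i) k) (pp i k) (xi i k) (-(K *ᵥ chi i k))
  preII : ∀ i k, pp i (k + 1) = (M i).S *ᵥ pp i k
    + (D i).Bp *ᵥ (D i).v ((M i).measurement (x i) k) (pp i k) (xi i k) (-(K *ᵥ chi i k))
  preIII : ∀ i k, xi i (k + 1) = (D i).Ah *ᵥ xi i k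
    + (D i).Bh *ᵥ (D i).zbar ((M i).measurement (x i) k) (pp i k)
    + (D i).Eh *ᵥ (-(K *ᵥ chi i k))
  observer : ∀ i k, xhat i (k + 1) = T.A *ᵥ xhat i k
    - (T.B * K) *ᵥ G.zetaHat chi i k
    + H *ᵥ (G.zetaTilde (fun j => (M j).output (x j) (w j)) (fun t => Cr *ᵥ xr t) i k
        - T.C *ᵥ xhat i k)
    - G.gain i • ((T.B * K) *ᵥ chi i k)
  exchange : ∀ i k, chi i (k + 1) = T.A *ᵥ chi i k + T.B *ᵥ (-(K *ᵥ chi i k))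
    + T.A *ᵥ (xhat i k - G.zetaHat chi i k - G.gain i • chi i k)
  control : ∀ i k, u i k = (D i).Cq *ᵥ q i k
    + (D i).Dq *ᵥ (D i).uq ((M i).measurement (x i) k) (pp i k) (xi i k) (-(K *ᵥ chi i k))

end MAS

end

noncomputable section

namespace MAS

/-! ### Spectra, Schur stability and decaying trajectories -/

-- The pre-compensators turn every agent, whatever its model, into the target model driven by its
-- new input plus a decaying term. Copies of the target model are then synchronized by an
-- observer-based protocol whose gains do not depend on the network.
--
-- Network part (`tendsto_target_sub_reference`). Division by 2 + d̄_i turns the Laplacian with root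
-- gains into I − D with D = `Network.weight` nonnegative. The row sums of D are 1 − g_i, less than
-- 1 at the roots, so rootedness makes D Schur stable (`Network.isSchur_weight`). With e = x − x_r,
-- the closed loop is triangular up to decaying terms: the error of x̂ as an estimate of (I − D)e
-- evolves with A_h − H C_h, the difference e − χ with D ⊗ A_h, and e itself with A_h − B_h K. All
-- three are Schur stable; for D ⊗ A_h this uses that the eigenvalues of A_h lie in the closed unit
-- disc.
--
-- Agent part. Pre-compensator I (`AgentModel.Admissible.exists_first`) comes from the Smith form,
-- over polynomials in λ = 1/z, of the numerator N of the transfer matrix: there are polynomial W, Ξ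
-- with N W = P diag(a) and N W Ξ = N. A polynomial in 1/z is a finite impulse response, so W has a
-- stable realization; N W Ξ = N prevents new zeros on or outside the unit circle, and the orders of
-- the a_i at λ = 0 are the infinite zero orders. Pre-compensator II
-- (`PreCompensators.Step1.exists_second`) is a copy of the disturbance generator; the regulator
-- equations provide coordinates in which the disturbance disappears. Pre-compensator III
-- (`exists_homogenizer`) uses that n_q bounds the infinite zero orders: some proper Q satisfies T Q
-- = z^(-n_q) I for the transfer matrix T, and truncating the expansion of Q at infinity yields a
-- finite impulse response that makes the system of uniform rank n_q. The first n_q output samples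
-- then define a map to the target state, and a static feedback on an observer state matches the
-- next sample up to the decaying estimation error.
--
-- The target model (`exists_targetModel`) is a shift register of n_q output samples, with a
-- feedback that after n_q steps makes every window an exosystem window. That feedback and the
-- stabilizing ones of the Hautus test come from one lemma on flags of subspaces,
-- `exists_linearMap_mapsTo_flag`.
--
-- Solvability without restriction on the S_j follows by moving the decaying disturbance modes into
-- the agent state (`exists_stable_splitting`, `AgentModel.augment`), since the explicit design
-- needs S_j without eigenvalues in the open unit disc.

notation "cx(" A ")" => Matrix.map A (algebraMap ℝ ℂ)

section Spectrum

variable {α β γ : Type*} [Fintype α] [DecidableEq α] [Fintype β] [Fintype γ]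

theorem mem_eigenvalues_iff_det {A : Matrix α α ℝ} {s : ℂ} :
    s ∈ eigenvalues A ↔ (s • (1 : Matrix α α ℂ) - cx(A)).det = 0 := by
  rw [eigenvalues, spectrum.mem_iff, Matrix.isUnit_iff_isUnit_det, isUnit_iff_ne_zero, not_not,
    Algebra.algebraMap_eq_smul_one]

theorem mem_eigenvalues_iff_mulVec {A : Matrix α α ℝ} {s : ℂ} :
    s ∈ eigenvalues A ↔ ∃ v : α → ℂ, v ≠ 0 ∧ cx(A) *ᵥ v = s • v := by
  rw [mem_eigenvalues_iff_det, ← Matrix.exists_mulVec_eq_zero_iff]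
  simp only [Matrix.sub_mulVec, Matrix.smul_mulVec, Matrix.one_mulVec, sub_eq_zero, eq_comm]

theorem mem_eigenvalues_iff_vecMul {A : Matrix α α ℝ} {s : ℂ} :
    s ∈ eigenvalues A ↔ ∃ v : α → ℂ, v ≠ 0 ∧ v ᵥ* cx(A) = s • v := by
  rw [mem_eigenvalues_iff_det, ← Matrix.exists_vecMul_eq_zero_iff]
  simp only [Matrix.vecMul_sub, Matrix.vecMul_smul, Matrix.vecMul_one, sub_eq_zero, eq_comm]

theorem IsSchur.transpose {A : Matrix α α ℝ} (h : IsSchur A) : IsSchur Aᵀ := by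
  intro s hs
  apply h
  rw [mem_eigenvalues_iff_det] at hs ⊢
  rw [← Matrix.det_transpose]
  simpa [Matrix.transpose_sub, Matrix.transpose_smul, Matrix.transpose_map] using hs

theorem exists_mulVec_of_notMem_eigenvalues {A : Matrix α α ℝ} {s : ℂ} (h : s ∉ eigenvalues A)
    (b : α → ℂ) : ∃ x : α → ℂ, s • x - cx(A) *ᵥ x = b := by
  rw [mem_eigenvalues_iff_det] at h
  refine ⟨(s • (1 : Matrix α α ℂ) - cx(A))⁻¹ *ᵥ b, ?_⟩
  have : (s • (1 : Matrix α α ℂ) - cx(A)) *ᵥ ((s • (1 : Matrix α α ℂ) - cx(A))⁻¹ *ᵥ b) = b := by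
    rw [Matrix.mulVec_mulVec, Matrix.mul_nonsing_inv _ (isUnit_iff_ne_zero.2 h), Matrix.one_mulVec]
  rwa [Matrix.sub_mulVec, Matrix.smul_mulVec, Matrix.one_mulVec] at this

theorem IsSchur.eq_zero_of_mulVec {A : Matrix α α ℝ} (h : IsSchur A) {s : ℂ} (hs : 1 ≤ ‖s‖)
    {v : α → ℂ} (hv : cx(A) *ᵥ v = s • v) : v = 0 := by
  by_contra h0
  exact absurd (h s (mem_eigenvalues_iff_mulVec.2 ⟨v, h0, hv⟩)) (not_lt.2 hs)

theorem IsSchur.eq_zero_of_vecMul {A : Matrix α α ℝ} (h : IsSchur A) {s : ℂ} (hs : 1 ≤ ‖s‖)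
    {v : α → ℂ} (hv : v ᵥ* cx(A) = s • v) : v = 0 := by
  by_contra h0
  exact absurd (h s (mem_eigenvalues_iff_vecMul.2 ⟨v, h0, hv⟩)) (not_lt.2 hs)

theorem eigenvalues_submatrix {α' : Type*} [Fintype α'] [DecidableEq α'] (A : Matrix α α ℝ)
    (e : α' ≃ α) : eigenvalues (A.submatrix e e) = eigenvalues A := by
  ext s
  rw [mem_eigenvalues_iff_det, mem_eigenvalues_iff_det, ← Matrix.det_submatrix_equiv_self e]
  congr! 2
  ext i j
  simp [Matrix.one_apply]

theorem IsSchur.submatrix {α' : Type*} [Fintype α'] [DecidableEq α'] {A : Matrix α α ℝ}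
    (h : IsSchur A) (e : α' ≃ α) : IsSchur (A.submatrix e e) := by
  intro s hs
  rw [eigenvalues_submatrix] at hs
  exact h s hs

end Spectrum

/-! ### Powers of Schur stable matrices and stable recursions with decaying input -/

section Decay

variable {α : Type*} [Fintype α] [DecidableEq α]

attribute [local instance] Matrix.linftyOpNormedRing Matrix.linftyOpNormedAlgebra

/-- Gelfand's formula: the spectral radius is below some r < 1, so eventually ‖A ^ k‖ ≤ r ^ k. -/
theorem tendsto_complex_pow_zero {A : Matrix α α ℂ} (h : ∀ s ∈ spectrum ℂ A, ‖s‖ < 1) :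
    Tendsto (fun k => ‖A ^ k‖) atTop (𝓝 0) := by
  cases isEmpty_or_nonempty α
  · have : (fun k => ‖A ^ k‖) = fun _ => 0 := by
      funext k
      rw [Subsingleton.elim (A ^ k) 0, norm_zero]
    rw [this]
    exact tendsto_const_nhds
  have h1 : spectralRadius ℂ A < ((1 : NNReal) : ENNReal) :=
    spectrum.spectralRadius_lt_of_forall_lt A (fun z hz => h z hz)
  obtain ⟨r, hr1, hr2⟩ := ENNReal.lt_iff_exists_nnreal_btwn.1 h1
  have h2 := (spectrum.pow_nnnorm_pow_one_div_tendsto_nhds_spectralRadius A).eventually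
    (gt_mem_nhds hr1)
  have hr3 : (r : ℝ) < 1 := by exact_mod_cast hr2
  have h3 : Tendsto (fun k : ℕ => (r : ℝ) ^ k) atTop (𝓝 0) :=
    tendsto_pow_atTop_nhds_zero_of_lt_one r.2 hr3
  refine squeeze_zero' (Eventually.of_forall fun k => norm_nonneg _) ?_ h3
  filter_upwards [h2, eventually_gt_atTop 0] with k hk hk0
  have hk1 : (‖A ^ k‖₊ : ENNReal) ≤ (r : ENNReal) ^ k := by
    have := ENNReal.rpow_le_rpow hk.le (Nat.cast_nonneg (α := ℝ) k)
    rwa [← ENNReal.rpow_mul, one_div, inv_mul_cancel₀ (by positivity), ENNReal.rpow_one,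
      ENNReal.rpow_natCast] at this
  exact_mod_cast hk1

theorem IsSchur.tendsto_pow {A : Matrix α α ℝ} (h : IsSchur A) :
    Tendsto (fun k => A ^ k) atTop (𝓝 0) := by
  have h1 := tendsto_complex_pow_zero (A := cx(A)) h
  refine tendsto_pi_nhds.2 fun i => tendsto_pi_nhds.2 fun j => ?_
  refine squeeze_zero_norm (fun k => ?_) h1
  have h2 : cx(A) ^ k = cx(A ^ k) := by
    rw [← RingHom.mapMatrix_apply, ← map_pow, RingHom.mapMatrix_apply]
  have h3 := Matrix.linfty_opNorm_mulVec (cx(A) ^ k) (Pi.single j (1 : ℂ))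
  have h4 : ‖(Pi.single j (1 : ℂ) : α → ℂ)‖ = 1 := by simp [Pi.norm_single]
  rw [h4, mul_one] at h3
  refine le_trans ?_ h3
  refine le_trans ?_ (norm_le_pi_norm _ i)
  rw [h2, Matrix.mulVec_single_one]
  simp [Matrix.col_apply]

/-- On an eigenvector the powers act as s ^ k, which cannot tend to zero when ‖s‖ ≥ 1. This converse
makes decay of powers an alternative to spectral computations, notably for Kronecker products. -/
theorem IsSchur.of_tendsto_pow {A : Matrix α α ℝ} (h : Tendsto (fun k => A ^ k) atTop (𝓝 0)) :
    IsSchur A := by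
  intro s hs
  obtain ⟨v, hv0, hv⟩ := mem_eigenvalues_iff_mulVec.1 hs
  have h1 : ∀ k, cx(A ^ k) *ᵥ v = s ^ k • v := by
    intro k
    induction k with
    | zero => simp [Matrix.map_one]
    | succ k ih =>
      rw [pow_succ, Matrix.map_mul, ← Matrix.mulVec_mulVec, hv, Matrix.mulVec_smul, ih, smul_smul,
        pow_succ, mul_comm]
  have h2 : Tendsto (fun k => cx(A ^ k) *ᵥ v) atTop (𝓝 (cx((0 : Matrix α α ℝ)) *ᵥ v)) := by
    have hc : Continuous fun B : Matrix α α ℝ => cx(B) *ᵥ v := by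
      have : Continuous fun B : Matrix α α ℝ => cx(B) :=
        continuous_id.matrix_map Complex.continuous_ofReal
      fun_prop
    exact (hc.tendsto 0).comp h
  obtain ⟨i, hi⟩ := Function.ne_iff.1 hv0
  have h3 := tendsto_pi_nhds.1 h2 i
  simp only [h1] at h3
  have h4 : (cx((0 : Matrix α α ℝ)) *ᵥ v) i = 0 := by
    rw [Matrix.map_zero _ (map_zero _), Matrix.zero_mulVec, Pi.zero_apply]
  rw [h4] at h3
  by_contra hcon
  push Not at hcon
  have h5 : ∀ k, ‖v i‖ ≤ ‖(s ^ k • v) i‖ := by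
    intro k
    rw [Pi.smul_apply, smul_eq_mul, norm_mul, norm_pow]
    exact le_mul_of_one_le_left (norm_nonneg _) (one_le_pow₀ hcon)
  have h6 := ge_of_tendsto' h3.norm h5
  rw [norm_zero] at h6
  exact hi (norm_le_zero_iff.1 h6)

/-- Once δ is below (1 - r) ε / 2, the excess of `a` over ε / 2 contracts by the factor r. -/
theorem tendsto_zero_of_le_mul_add {a δ : ℕ → ℝ} {r : ℝ} (ha : ∀ k, 0 ≤ a k) (hr0 : 0 ≤ r)
    (hr1 : r < 1) (hδ : Tendsto δ atTop (𝓝 0)) (h : ∀ k, a (k + 1) ≤ r * a k + δ k) :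
    Tendsto a atTop (𝓝 0) := by
  rw [Metric.tendsto_atTop]
  intro ε hε
  have hε' : 0 < (1 - r) * (ε / 2) := mul_pos (by linarith) (by linarith)
  obtain ⟨K, hK⟩ := eventually_atTop.1 (hδ.eventually (gt_mem_nhds hε'))
  have h1 : ∀ n, a (K + n) - ε / 2 ≤ r ^ n * a K := by
    intro n
    induction n with
    | zero => simp; linarith
    | succ n ih =>
      have := h (K + n)
      have h2 := hK (K + n) (by omega)
      rw [← add_assoc, pow_succ]
      nlinarith [mul_le_mul_of_nonneg_left ih hr0]
  have h2 : Tendsto (fun n => r ^ n * a K) atTop (𝓝 0) := by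
    simpa using (tendsto_pow_atTop_nhds_zero_of_lt_one hr0 hr1).mul_const (a K)
  obtain ⟨n₀, hn₀⟩ := eventually_atTop.1 (h2.eventually (gt_mem_nhds (half_pos hε)))
  refine ⟨K + n₀, fun k hk => ?_⟩
  have h3 := h1 (k - K)
  have h4 := hn₀ (k - K) (by omega)
  rw [show K + (k - K) = k by omega] at h3
  rw [Real.dist_eq, sub_zero, abs_of_nonneg (ha k)]
  linarith

/-- If ‖A ^ m‖ < 1/2 and r ^ m ≥ 1/2, then A contracts the weighted norm V y = ∑_{i<m} r ^ (-i) ‖A ^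
i y‖ by the factor r: applying A shifts the sum, and the new last term is dominated by the first one
that drops out. The scalar comparison then applies to V. -/
theorem tendsto_zero_of_tendsto_pow {A : Matrix α α ℝ}
    (h : Tendsto (fun k => A ^ k) atTop (𝓝 0)) {x d : ℕ → α → ℝ}
    (hx : ∀ k, x (k + 1) = A *ᵥ x k + d k) (hd : Tendsto d atTop (𝓝 0)) :
    Tendsto x atTop (𝓝 0) := by
  have h1 : ∀ᶠ k in atTop, ‖A ^ k‖ < 1 / 2 := by
    have := h.norm
    rw [norm_zero] at this
    exact this.eventually (gt_mem_nhds (by norm_num))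
  obtain ⟨m, hm, hm0⟩ := (h1.and (eventually_gt_atTop 0)).exists
  have hmR : (1 : ℝ) ≤ m := by exact_mod_cast hm0
  -- For this r < 1 Bernoulli's inequality gives r ^ m ≥ 1/2.
  set r : ℝ := 1 - 1 / (2 * m) with hr
  have hr2 : 1 / (2 * (m : ℝ)) ≤ 1 / 2 := by
    apply one_div_le_one_div_of_le <;> linarith
  have hr3 : 0 < 1 / (2 * (m : ℝ)) := by positivity
  have hr0 : 0 < r := by linarith
  have hr1 : r < 1 := by linarith
  have hrm : 1 / 2 ≤ r ^ m := by
    have := one_add_mul_le_pow (a := -(1 / (2 * (m : ℝ)))) (by linarith) m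
    have h2 : (1 : ℝ) + m * (-(1 / (2 * (m : ℝ)))) = 1 / 2 := by field_simp; norm_num
    rw [h2] at this
    rwa [hr, sub_eq_add_neg]
  let V : (α → ℝ) → ℝ := fun y => ∑ i ∈ Finset.range m, (r⁻¹) ^ i * ‖(A ^ i) *ᵥ y‖
  have hV0 : ∀ y, 0 ≤ V y := fun y => Finset.sum_nonneg fun i _ => by positivity
  have hVadd : ∀ y z, V (y + z) ≤ V y + V z := by
    intro y z
    rw [← Finset.sum_add_distrib]
    refine Finset.sum_le_sum fun i _ => ?_
    rw [← mul_add, Matrix.mulVec_add]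
    exact mul_le_mul_of_nonneg_left (norm_add_le _ _) (by positivity)
  have hVA : ∀ y, V (A *ᵥ y) ≤ r * V y := by
    intro y
    have e1 : V (A *ᵥ y) = r * ∑ i ∈ Finset.range m, (r⁻¹) ^ (i + 1) * ‖(A ^ (i + 1)) *ᵥ y‖ := by
      simp only [V]
      rw [Finset.mul_sum]
      refine Finset.sum_congr rfl fun i _ => ?_
      rw [Matrix.mulVec_mulVec, ← pow_succ, pow_succ r⁻¹]
      field_simp
    rw [e1]
    refine mul_le_mul_of_nonneg_left ?_ hr0.le
    have e2 := Finset.sum_range_succ (fun i => (r⁻¹) ^ i * ‖(A ^ i) *ᵥ y‖) m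
    have e3 := Finset.sum_range_succ' (fun i => (r⁻¹) ^ i * ‖(A ^ i) *ᵥ y‖) m
    have e4 : (r⁻¹) ^ m * ‖(A ^ m) *ᵥ y‖ ≤ (r⁻¹) ^ 0 * ‖(A ^ 0) *ᵥ y‖ := by
      rw [pow_zero, pow_zero, one_mul, Matrix.one_mulVec]
      have e5 : ‖(A ^ m) *ᵥ y‖ ≤ 1 / 2 * ‖y‖ :=
        (Matrix.linfty_opNorm_mulVec _ _).trans
          (mul_le_mul_of_nonneg_right hm.le (norm_nonneg _))
      rw [inv_pow, inv_mul_le_iff₀ (by positivity)]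
      exact e5.trans (mul_le_mul_of_nonneg_right hrm (norm_nonneg _))
    linarith
  have hVd : Tendsto (fun k => V (d k)) atTop (𝓝 0) := by
    have hc : Continuous V := by
      refine continuous_finsetSum _ fun i _ => ?_
      refine continuous_const.mul (Continuous.norm ?_)
      fun_prop
    have h0 : V 0 = 0 := by simp [V]
    have := (hc.tendsto 0).comp hd
    rwa [h0] at this
  have hVx : Tendsto (fun k => V (x k)) atTop (𝓝 0) := by
    refine tendsto_zero_of_le_mul_add (fun k => hV0 _) hr0.le hr1 hVd fun k => ?_
    rw [hx]
    exact (hVadd _ _).trans (by linarith [hVA (x k)])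
  refine squeeze_zero_norm (fun k => ?_) hVx
  have h2 : ‖x k‖ = (r⁻¹) ^ 0 * ‖(A ^ 0) *ᵥ x k‖ := by simp
  rw [h2]
  exact Finset.single_le_sum (s := Finset.range m)
    (f := fun i => (r⁻¹) ^ i * ‖(A ^ i) *ᵥ x k‖) (fun i _ => by positivity)
    (Finset.mem_range.2 hm0)

theorem IsSchur.tendsto_zero {A : Matrix α α ℝ} (h : IsSchur A) {x d : ℕ → α → ℝ}
    (hx : ∀ k, x (k + 1) = A *ᵥ x k + d k) (hd : Tendsto d atTop (𝓝 0)) :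
    Tendsto x atTop (𝓝 0) :=
  tendsto_zero_of_tendsto_pow h.tendsto_pow hx hd

theorem IsSchur.tendsto_zero_of_autonomous {A : Matrix α α ℝ} (h : IsSchur A) {x : ℕ → α → ℝ}
    (hx : ∀ k, x (k + 1) = A *ᵥ x k) : Tendsto x atTop (𝓝 0) :=
  h.tendsto_zero (d := fun _ => 0) (fun k => by rw [hx, add_zero]) tendsto_const_nhds

omit [DecidableEq α] in
theorem tendsto_mulVec_zero {β : Type*} (B : Matrix β α ℝ) {x : ℕ → α → ℝ}
    (hx : Tendsto x atTop (𝓝 0)) : Tendsto (fun k => B *ᵥ x k) atTop (𝓝 0) := by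
  have hc : Continuous fun y : α → ℝ => B *ᵥ y := by fun_prop
  have := (hc.tendsto 0).comp hx
  rwa [Matrix.mulVec_zero] at this

theorem IsSchur.of_pow_eq_zero {A : Matrix α α ℝ} {n : ℕ} (h : A ^ n = 0) : IsSchur A :=
  IsSchur.of_tendsto_pow <| tendsto_const_nhds.congr' <| by
    filter_upwards [eventually_ge_atTop n] with k hk
    rw [show k = n + (k - n) by omega, pow_add, h, zero_mul]

end Decay

/-! ### Stabilizability and detectability by the Popov–Belevitch–Hautus test -/

/-- If every state of level t + 1 of an increasing chain can be steered into level t by some input,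
a single linear feedback does this on all levels at once, extending a prescribed feedback on the
bottom level. The feedback is built level by level: it is kept on the level reached and continued on
a complement by a linear choice of steering inputs. -/
theorem exists_linearMap_mapsTo_flag {V U : Type*} [AddCommGroup V] [Module ℝ V] [AddCommGroup U]
    [Module ℝ U] (f : V →ₗ[ℝ] V) (g : U →ₗ[ℝ] V) (X : ℕ → Submodule ℝ V)
    (hX : ∀ t, X t ≤ X (t + 1)) (F₀ : V →ₗ[ℝ] U) (h₀ : ∀ x ∈ X 0, f x + g (F₀ x) ∈ X 0)
    (hs : ∀ t, ∀ x ∈ X (t + 1), ∃ u, f x + g u ∈ X t) (T : ℕ) :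
    ∃ F : V →ₗ[ℝ] U, (∀ x ∈ X 0, F x = F₀ x) ∧
      ∀ t < T, ∀ x ∈ X (t + 1), f x + g (F x) ∈ X t := by
  have hmono : Monotone X := monotone_nat_of_le_succ hX
  induction T with
  | zero => exact ⟨F₀, fun _ _ => rfl, fun t ht => absurd ht (Nat.not_lt_zero t)⟩
  | succ T ih =>
    obtain ⟨F, hF0, hF⟩ := ih
    obtain ⟨π, hπ⟩ := (X T).subtype.exists_leftInverse_of_injective (X T).ker_subtype
    have hπ' : ∀ x (hx : x ∈ X T), (π x : V) = x := fun x hx => by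
      have := LinearMap.congr_fun hπ ⟨x, hx⟩
      exact congrArg Subtype.val this
    -- All pairs of a state and an input that lead into X T. A linear section of its first
    -- projection, extended to the whole space, is a linear choice of input.
    let S : Submodule ℝ (V × U) := (X T).comap (f.coprod g)
    let φ : S →ₗ[ℝ] V := (LinearMap.fst ℝ V U) ∘ₗ S.subtype
    obtain ⟨r, hr⟩ := φ.rangeRestrict.exists_rightInverse_of_surjective φ.range_rangeRestrict
    obtain ⟨s, hsx⟩ := LinearMap.exists_extend ((LinearMap.snd ℝ V U) ∘ₗ S.subtype ∘ₗ r)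
    have hs' : ∀ x ∈ X (T + 1), f x + g (s x) ∈ X T := by
      intro x hx
      obtain ⟨u, hu⟩ := hs T x hx
      have hxr : x ∈ LinearMap.range φ := ⟨⟨(x, u), hu⟩, rfl⟩
      have h1 : s x = (r ⟨x, hxr⟩ : V × U).2 := LinearMap.congr_fun hsx ⟨x, hxr⟩
      have h2 : (r ⟨x, hxr⟩ : V × U).1 = x :=
        congrArg Subtype.val (LinearMap.congr_fun hr ⟨x, hxr⟩)
      have h3 : f (r ⟨x, hxr⟩ : V × U).1 + g (r ⟨x, hxr⟩ : V × U).2 ∈ X T := (r ⟨x, hxr⟩).2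
      rw [h2, ← h1] at h3
      exact h3
    let P : V →ₗ[ℝ] V := (X T).subtype ∘ₗ π
    have hP : ∀ x, P x ∈ X T := fun x => (π x).2
    have hP' : ∀ x ∈ X T, P x = x := fun x hx => hπ' x hx
    -- P projects onto X T. The old feedback acts on the component P x and the new choice on x - P
    -- x, which still lies in X (T + 1).
    refine ⟨F ∘ₗ P + s ∘ₗ (LinearMap.id - P), fun x hx => ?_, fun t ht x hx => ?_⟩
    · have := hP' x (hmono (Nat.zero_le T) hx)
      simp [this, hF0 x hx]
    · rcases Nat.lt_succ_iff_lt_or_eq.1 ht with h | rfl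
      · have := hP' x (hmono (by omega : t + 1 ≤ T) hx)
        simpa [this] using hF t h x hx
      · have e : f x + g ((F ∘ₗ P + s ∘ₗ (LinearMap.id - P) : V →ₗ[ℝ] U) x)
            = (f (P x) + g (F (P x))) + (f (x - P x) + g (s (x - P x))) := by
          simp only [LinearMap.add_apply, LinearMap.comp_apply, LinearMap.sub_apply,
            LinearMap.id_apply, map_add, map_sub]
          abel
        rw [e]
        refine add_mem ?_ (hs' _ (sub_mem hx (hX t (hP x))))
        cases t with
        | zero => rw [hF0 _ (hP x)]; exact h₀ _ (hP x)
        | succ t => exact hX t (hF t (Nat.lt_succ_self t) _ (hP x))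

section Hautus

variable {α β : Type*} [Fintype α] [DecidableEq α] [Fintype β]

/-- The states that are reachable from the origin in `t` steps. -/
def reachableIn (A : Matrix α α ℝ) (B : Matrix α β ℝ) : ℕ → Submodule ℝ (α → ℝ)
  | 0 => ⊥
  | t + 1 => reachableIn A B t ⊔ (LinearMap.range B.mulVecLin).map (A ^ t).mulVecLin

theorem pow_mulVec_mem_reachableIn (A : Matrix α α ℝ) (B : Matrix α β ℝ) {i t : ℕ} (h : i < t)
    (u : β → ℝ) : (A ^ i) *ᵥ (B *ᵥ u) ∈ reachableIn A B t := by
  induction t with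
  | zero => exact absurd h (Nat.not_lt_zero i)
  | succ t ih =>
    rcases Nat.lt_succ_iff_lt_or_eq.1 h with h | rfl
    · exact Submodule.mem_sup_left (ih h)
    · exact Submodule.mem_sup_right ⟨B *ᵥ u, ⟨u, rfl⟩, rfl⟩

theorem mulVec_mem_reachableIn_succ (A : Matrix α α ℝ) (B : Matrix α β ℝ) (t : ℕ) :
    ∀ x ∈ reachableIn A B t, A *ᵥ x ∈ reachableIn A B (t + 1) := by
  induction t with
  | zero =>
    intro x hx
    rw [(Submodule.mem_bot ℝ).1 hx, Matrix.mulVec_zero]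
    exact zero_mem _
  | succ t ih =>
    intro x hx
    obtain ⟨y, hy, z, ⟨_, ⟨u, rfl⟩, rfl⟩, rfl⟩ := Submodule.mem_sup.1 hx
    rw [Matrix.mulVec_add]
    refine add_mem (Submodule.mem_sup_left (ih y hy)) ?_
    simp only [Matrix.mulVecLin_apply]
    rw [Matrix.mulVec_mulVec _ A, ← pow_succ']
    exact pow_mulVec_mem_reachableIn A B (Nat.lt_succ_self _) u

/-- Cayley–Hamilton expresses the power of exponent dim by the lower ones. -/
theorem pow_card_mulVec_mem_reachableIn (A : Matrix α α ℝ) (B : Matrix α β ℝ) (u : β → ℝ) :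
    (A ^ Fintype.card α) *ᵥ (B *ᵥ u) ∈ reachableIn A B (Fintype.card α) := by
  cases isEmpty_or_nonempty α
  · rw [Subsingleton.elim ((A ^ Fintype.card α) *ᵥ (B *ᵥ u)) 0]
    exact zero_mem _
  have h := A.aeval_self_charpoly
  rw [Polynomial.aeval_eq_sum_range, A.charpoly_natDegree_eq_dim, Finset.sum_range_succ] at h
  have hc : A.charpoly.coeff (Fintype.card α) = 1 := by
    rw [← A.charpoly_natDegree_eq_dim]
    exact A.charpoly_monic
  rw [hc, one_smul] at h
  rw [← neg_eq_of_add_eq_zero_right h, Matrix.neg_mulVec, Matrix.sum_mulVec]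
  refine neg_mem (sum_mem fun i hi => ?_)
  rw [Matrix.smul_mulVec]
  exact Submodule.smul_mem _ _ (pow_mulVec_mem_reachableIn A B (Finset.mem_range.1 hi) u)

/-- A deadbeat feedback: it drives to the origin every state that can be brought there in dim steps,
and by Cayley–Hamilton the range of B consists of such states. This replaces pole placement. -/
theorem exists_pow_mul_eq_zero (A : Matrix α α ℝ) (B : Matrix α β ℝ) :
    ∃ F : Matrix β α ℝ, (A + B * F) ^ Fintype.card α * B = 0 := by
  classical
  -- The states that some input sequence steers to the origin in t steps.
  let X : ℕ → Submodule ℝ (α → ℝ) := fun t => (reachableIn A B t).comap (A ^ t).mulVecLin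
  obtain ⟨F, -, hF⟩ := exists_linearMap_mapsTo_flag A.mulVecLin B.mulVecLin X
    (fun t x hx => by
      change (A ^ (t + 1)) *ᵥ x ∈ reachableIn A B (t + 1)
      rw [pow_succ', ← Matrix.mulVec_mulVec]
      exact mulVec_mem_reachableIn_succ A B t _ hx)
    0
    (fun x hx => by
      have h0 : (A ^ 0) *ᵥ x = 0 := (Submodule.mem_bot ℝ).1 hx
      rw [pow_zero, Matrix.one_mulVec] at h0
      rw [h0]
      simp)
    (fun t x hx => by
      obtain ⟨y, hy, z, ⟨_, ⟨u, rfl⟩, rfl⟩, hyz⟩ := Submodule.mem_sup.1 hx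
      refine ⟨-u, ?_⟩
      change (A ^ t) *ᵥ (A *ᵥ x + B *ᵥ (-u)) ∈ reachableIn A B t
      have e : (A ^ t) *ᵥ (A *ᵥ x + B *ᵥ (-u)) = y := by
        rw [Matrix.mulVec_add, Matrix.mulVec_mulVec, ← pow_succ, Matrix.mulVec_neg,
          Matrix.mulVec_neg]
        have h2 : y + (A ^ t) *ᵥ (B *ᵥ u) = (A ^ (t + 1)) *ᵥ x := hyz
        rw [← h2]
        abel
      rwa [e])
    (Fintype.card α)
  refine ⟨LinearMap.toMatrix' F, ?_⟩
  have hG : ∀ t ≤ Fintype.card α, ∀ x ∈ X t,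
      ((A + B * LinearMap.toMatrix' F) ^ t) *ᵥ x = 0 := by
    intro t
    induction t with
    | zero =>
      intro _ x hx
      exact (Submodule.mem_bot ℝ).1 hx
    | succ t ih =>
      intro ht x hx
      have h1 := hF t (by omega) x hx
      rw [pow_succ, ← Matrix.mulVec_mulVec]
      apply ih (by omega)
      have e : (A + B * LinearMap.toMatrix' F) *ᵥ x = A.mulVecLin x + B.mulVecLin (F x) := by
        rw [Matrix.add_mulVec, ← Matrix.mulVec_mulVec, LinearMap.toMatrix'_mulVec]
        rfl
      rwa [e]
  refine Matrix.ext_of_mulVec_single fun i => ?_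
  rw [← Matrix.mulVec_mulVec, Matrix.zero_mulVec]
  exact hG _ le_rfl _ (pow_card_mulVec_mem_reachableIn A B _)

/-- With the deadbeat feedback, a left eigenvector w of A + B F at s satisfies s ^ dim • w B = w (A
+ B F) ^ dim B = 0. For s ≠ 0 this gives w B = 0, so w is a left eigenvector of A itself, excluded
by the test when ‖s‖ ≥ 1. -/
theorem stabilizable_of_hautus {A : Matrix α α ℝ} {B : Matrix α β ℝ}
    (h : ∀ s : ℂ, 1 ≤ ‖s‖ → ∀ w : α → ℂ, w ᵥ* cx(A) = s • w → w ᵥ* cx(B) = 0 → w = 0) :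
    Stabilizable A B := by
  obtain ⟨F, hF⟩ := exists_pow_mul_eq_zero A B
  refine ⟨F, fun s hs => ?_⟩
  obtain ⟨w, hw0, hw⟩ := mem_eigenvalues_iff_vecMul.1 hs
  by_contra hcon
  push Not at hcon
  have h1 : ∀ k : ℕ, w ᵥ* cx((A + B * F) ^ k) = s ^ k • w := by
    intro k
    induction k with
    | zero => simp [Matrix.map_one]
    | succ k ih =>
      rw [pow_succ, Matrix.map_mul, ← Matrix.vecMul_vecMul, ih, Matrix.smul_vecMul, hw, smul_smul,
        pow_succ]
  have h2 : w ᵥ* cx((A + B * F) ^ Fintype.card α * B) = 0 := by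
    rw [hF, Matrix.map_zero _ (map_zero _), Matrix.vecMul_zero]
  rw [Matrix.map_mul, ← Matrix.vecMul_vecMul, h1, Matrix.smul_vecMul] at h2
  have hs0 : s ≠ 0 := by
    rintro rfl
    norm_num at hcon
  have h3 : w ᵥ* cx(B) = 0 := (smul_eq_zero.1 h2).resolve_left (pow_ne_zero _ hs0)
  refine hw0 (h s hcon w ?_ h3)
  rw [Matrix.map_add _ (map_add _), Matrix.map_mul, Matrix.vecMul_add, ← Matrix.vecMul_vecMul, h3,
    Matrix.zero_vecMul, add_zero] at hw
  exact hw

theorem Stabilizable.hautus {A : Matrix α α ℝ} {B : Matrix α β ℝ} (h : Stabilizable A B) {s : ℂ}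
    (hs : 1 ≤ ‖s‖) {w : α → ℂ} (hw : w ᵥ* cx(A) = s • w) (hwB : w ᵥ* cx(B) = 0) : w = 0 := by
  obtain ⟨F, hF⟩ := h
  refine hF.eq_zero_of_vecMul hs ?_
  rw [Matrix.map_add _ (map_add _), Matrix.map_mul, Matrix.vecMul_add, ← Matrix.vecMul_vecMul, hwB,
    Matrix.zero_vecMul, add_zero, hw]

theorem detectable_of_hautus {A : Matrix α α ℝ} {C : Matrix β α ℝ}
    (h : ∀ s : ℂ, 1 ≤ ‖s‖ → ∀ v : α → ℂ, cx(A) *ᵥ v = s • v → cx(C) *ᵥ v = 0 → v = 0) :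
    Detectable C A := by
  obtain ⟨F, hF⟩ := stabilizable_of_hautus (A := Aᵀ) (B := Cᵀ) fun s hs w hw hwC =>
    h s hs w (by rwa [Matrix.transpose_map, Matrix.vecMul_transpose] at hw)
      (by rwa [Matrix.transpose_map, Matrix.vecMul_transpose] at hwC)
  refine ⟨Fᵀ, ?_⟩
  have := hF.transpose
  rwa [Matrix.transpose_add, Matrix.transpose_mul, Matrix.transpose_transpose,
    Matrix.transpose_transpose] at this

theorem Detectable.hautus {A : Matrix α α ℝ} {C : Matrix β α ℝ} (h : Detectable C A) {s : ℂ}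
    (hs : 1 ≤ ‖s‖) {v : α → ℂ} (hv : cx(A) *ᵥ v = s • v) (hvC : cx(C) *ᵥ v = 0) : v = 0 := by
  obtain ⟨L, hL⟩ := h
  refine hL.eq_zero_of_mulVec hs ?_
  rw [Matrix.map_add _ (map_add _), Matrix.map_mul, Matrix.add_mulVec, ← Matrix.mulVec_mulVec, hvC,
    Matrix.mulVec_zero, add_zero, hv]

end Hautus

/-! ### Rooted networks -/

section Network

open scoped Kronecker

variable {N : ℕ} (G : Network N)

/-- The substochastic matrix `I - L̄`, where `L̄` is the scaled Laplacian with the root gains. -/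
def Network.weight : Matrix (Fin N) (Fin N) ℝ :=
  Matrix.of fun i j => G.a i j / (2 + G.dbar i)
    + if i = j then 1 - (∑ l, G.a i l + G.iota i) / (2 + G.dbar i) else 0

theorem Network.dbar_nonneg (i : Fin N) : 0 ≤ G.dbar i :=
  (Finset.sum_nonneg fun j _ => G.a_nonneg i j).trans (G.inDegree_le i)

theorem Network.iota_nonneg (i : Fin N) : 0 ≤ G.iota i := by
  unfold Network.iota; split_ifs <;> norm_num

theorem Network.iota_le_one (i : Fin N) : G.iota i ≤ 1 := by
  unfold Network.iota; split_ifs <;> norm_num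

theorem Network.diag_nonneg (i : Fin N) :
    0 ≤ 1 - (∑ l, G.a i l + G.iota i) / (2 + G.dbar i) := by
  have h := G.dbar_nonneg i
  rw [sub_nonneg, div_le_one (by linarith)]
  linarith [G.inDegree_le i, G.iota_le_one i]

theorem Network.weight_nonneg (i j : Fin N) : 0 ≤ G.weight i j := by
  have h := G.dbar_nonneg i
  have h1 : 0 ≤ G.a i j / (2 + G.dbar i) := div_nonneg (G.a_nonneg i j) (by linarith)
  have h2 := G.diag_nonneg i
  simp only [Network.weight, Matrix.of_apply]
  split_ifs <;> linarith

theorem Network.weight_pos {i j : Fin N} (h : 0 < G.a i j) : 0 < G.weight i j := by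
  have h0 := G.dbar_nonneg i
  have h1 : 0 < G.a i j / (2 + G.dbar i) := div_pos h (by linarith)
  have h2 := G.diag_nonneg i
  simp only [Network.weight, Matrix.of_apply]
  split_ifs <;> linarith

theorem Network.sum_weight (i : Fin N) : ∑ j, G.weight i j = 1 - G.gain i := by
  simp only [Network.weight, Matrix.of_apply, Finset.sum_add_distrib, Finset.sum_ite_eq,
    Finset.mem_univ, if_true, ← Finset.sum_div, Network.gain]
  ring

theorem Network.gain_pos {i : Fin N} (hi : i ∈ G.roots) : 0 < G.gain i := by
  have h0 := G.dbar_nonneg i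
  unfold Network.gain Network.iota
  rw [if_pos hi]
  exact div_pos one_pos (by linarith)

theorem Network.gain_nonneg (i : Fin N) : 0 ≤ G.gain i :=
  div_nonneg (G.iota_nonneg i) (by linarith [G.dbar_nonneg i])

/-- A maximum principle. For an eigenvalue of modulus at least 1, a node where the eigenvector has
maximal modulus passes this property to all its in-neighbours, because the weights are nonnegative
with row sums 1 - g_i. Going backwards along a path one reaches a root, where g_i > 0 contradicts
maximality. -/
theorem Network.isSchur_weight (hG : G.Rooted) : IsSchur G.weight := by
  intro s hs
  obtain ⟨v, hv0, hv⟩ := mem_eigenvalues_iff_mulVec.1 hs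
  by_contra hcon
  push Not at hcon
  obtain ⟨i₀, hi₀⟩ := Function.ne_iff.1 hv0
  have : Nonempty (Fin N) := ⟨i₀⟩
  obtain ⟨m, hm⟩ := Finite.exists_max fun i => ‖v i‖
  have hle : ∀ i, ‖v i‖ ≤ ∑ j, G.weight i j * ‖v j‖ := by
    intro i
    have h1 : ∑ j, (G.weight i j : ℂ) * v j = s * v i := by
      have := congrFun hv i
      simpa [Matrix.mulVec, dotProduct] using this
    calc ‖v i‖ ≤ ‖s‖ * ‖v i‖ := le_mul_of_one_le_left (norm_nonneg _) hcon
      _ = ‖∑ j, (G.weight i j : ℂ) * v j‖ := by rw [h1, norm_mul]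
      _ ≤ ∑ j, ‖(G.weight i j : ℂ) * v j‖ := norm_sum_le _ _
      _ = ∑ j, G.weight i j * ‖v j‖ := by
        refine Finset.sum_congr rfl fun j _ => ?_
        rw [norm_mul, Complex.norm_real, Real.norm_of_nonneg (G.weight_nonneg i j)]
  have hmpos : 0 < ‖v m‖ := (norm_pos_iff.2 hi₀).trans_le (hm i₀)
  have hkey : ∀ i, ‖v i‖ = ‖v m‖ → G.gain i * ‖v m‖ +
      ∑ j, G.weight i j * (‖v m‖ - ‖v j‖) ≤ 0 := by
    intro i hi
    have h1 := hle i
    have h2 : ∑ j, G.weight i j * (‖v m‖ - ‖v j‖)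
        = (1 - G.gain i) * ‖v m‖ - ∑ j, G.weight i j * ‖v j‖ := by
      simp only [mul_sub, Finset.sum_sub_distrib, ← Finset.sum_mul, G.sum_weight]
    rw [h2]
    linarith
  have hterm : ∀ i j, 0 ≤ G.weight i j * (‖v m‖ - ‖v j‖) := fun i j =>
    mul_nonneg (G.weight_nonneg i j) (sub_nonneg.2 (hm j))
  have hback : ∀ i j, ‖v i‖ = ‖v m‖ → 0 < G.a i j → ‖v j‖ = ‖v m‖ := by
    intro i j hi hij
    have h1 := hkey i hi
    have h2 := Finset.single_le_sum (fun j _ => hterm i j) (Finset.mem_univ j)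
    have h3 := mul_nonneg (G.gain_nonneg i) hmpos.le
    have h4 : G.weight i j * (‖v m‖ - ‖v j‖) = 0 := le_antisymm (by linarith) (hterm i j)
    have h5 := (mul_eq_zero.1 h4).resolve_left (G.weight_pos hij).ne'
    linarith
  obtain ⟨c, hc, hpath⟩ := hG m
  have hcm : ‖v c‖ = ‖v m‖ := by
    clear hc
    induction hpath using Relation.ReflTransGen.head_induction_on with
    | refl => rfl
    | head h _ ih => exact hback _ _ (ih) h
  have h1 := hkey c hcm
  have h2 := Finset.sum_nonneg fun j (_ : j ∈ Finset.univ) => hterm c j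
  have h3 := mul_pos (G.gain_pos hc) hmpos
  linarith

/-- The scaled Laplacian plus the root gains is I - D. It is stated for an arbitrary module, so that
it serves the exchanged variables and the tracking errors alike. -/
theorem Network.smul_sum_sub_add_gain {E : Type*} [AddCommGroup E] [Module ℝ E] (c : Fin N → E)
    (i : Fin N) :
    (1 / (2 + G.dbar i)) • ∑ j, G.a i j • (c i - c j) + G.gain i • c i
      = c i - ∑ j, G.weight i j • c j := by
  simp only [Network.weight, Matrix.of_apply, smul_sub, Finset.sum_sub_distrib, add_smul,
    Finset.sum_add_distrib, ite_smul, zero_smul, Finset.sum_ite_eq, Finset.mem_univ, if_true,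
    ← Finset.sum_smul, Network.gain, div_eq_inv_mul, mul_smul, ← Finset.smul_sum]
  module

theorem eigenvalues_smul {α : Type*} [Fintype α] [DecidableEq α] {A : Matrix α α ℝ} {c : ℝ}
    (hc : c ≠ 0) {s : ℂ} (hs : s ∈ eigenvalues (c • A)) : (c : ℂ)⁻¹ * s ∈ eigenvalues A := by
  obtain ⟨v, hv0, hv⟩ := mem_eigenvalues_iff_mulVec.1 hs
  refine mem_eigenvalues_iff_mulVec.2 ⟨v, hv0, ?_⟩
  have h1 : cx(c • A) = (c : ℂ) • cx(A) := by
    ext i j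
    simp
  rw [h1, Matrix.smul_mulVec] at hv
  rw [mul_smul, ← hv, smul_smul, inv_mul_cancel₀ (Complex.ofReal_ne_zero.2 hc), one_smul]

theorem finite_eigenvalues {α : Type*} [Fintype α] [DecidableEq α] (A : Matrix α α ℝ) :
    (eigenvalues A).Finite := by
  have h : eigenvalues A = {s | cx(A).charpoly.IsRoot s} := by
    ext s
    exact Matrix.mem_spectrum_iff_isRoot_charpoly
  rw [h]
  exact Polynomial.finite_setOfPred_isRoot (Matrix.charpoly_monic _).ne_zero

theorem kronecker_pow {α β : Type*} [Fintype α] [DecidableEq α] [Fintype β] [DecidableEq β]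
    (D : Matrix α α ℝ) (A : Matrix β β ℝ) (k : ℕ) : (D ⊗ₖ A) ^ k = (D ^ k) ⊗ₖ (A ^ k) := by
  induction k with
  | zero => simp
  | succ k ih => rw [pow_succ, ih, ← Matrix.mul_kronecker_mul, ← pow_succ, ← pow_succ]

/-- Choose r < 1 above all moduli of eigenvalues of D. Then r⁻¹ D and r A are both Schur stable, and
(D ⊗ A) ^ k is the Kronecker product of their k-th powers, so its entries are products of sequences
that tend to zero. -/
theorem IsSchur.kronecker {α β : Type*} [Fintype α] [DecidableEq α] [Fintype β] [DecidableEq β]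
    {D : Matrix α α ℝ} {A : Matrix β β ℝ} (hD : IsSchur D) (hA : ∀ s ∈ eigenvalues A, ‖s‖ ≤ 1) :
    IsSchur (D ⊗ₖ A) := by
  obtain ⟨r, hr0, hr1, hr⟩ : ∃ r : ℝ, 0 < r ∧ r < 1 ∧ ∀ s ∈ eigenvalues D, ‖s‖ < r := by
    rcases (eigenvalues D).eq_empty_or_nonempty with h | h
    · exact ⟨1 / 2, by norm_num, by norm_num, by simp [h]⟩
    · obtain ⟨s₀, hs₀, hmax⟩ := (finite_eigenvalues D).exists_maximalFor (fun s : ℂ => ‖s‖) _ h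
      obtain ⟨r, h1, h2⟩ := exists_between (hD s₀ hs₀)
      refine ⟨r, (norm_nonneg _).trans_lt h1, h2, fun s hs => lt_of_le_of_lt ?_ h1⟩
      rcases le_total ‖s‖ ‖s₀‖ with h | h
      · exact h
      · exact hmax hs h
  have h1 : IsSchur (r⁻¹ • D) := by
    intro s hs
    have := hr _ (eigenvalues_smul (inv_ne_zero hr0.ne') hs)
    rw [norm_mul, norm_inv, Complex.norm_real, norm_inv, inv_inv, Real.norm_of_nonneg hr0.le]
      at this
    nlinarith
  have h2 : IsSchur (r • A) := by
    intro s hs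
    have := hA _ (eigenvalues_smul hr0.ne' hs)
    rw [norm_mul, norm_inv, Complex.norm_real, Real.norm_of_nonneg hr0.le,
      inv_mul_le_iff₀ hr0] at this
    linarith
  refine IsSchur.of_tendsto_pow ?_
  refine tendsto_pi_nhds.2 fun i => tendsto_pi_nhds.2 fun j => ?_
  have h3 := tendsto_pi_nhds.1 (tendsto_pi_nhds.1 h1.tendsto_pow i.1) j.1
  have h4 := tendsto_pi_nhds.1 (tendsto_pi_nhds.1 h2.tendsto_pow i.2) j.2
  have h5 := h3.mul h4
  simp only [Matrix.zero_apply, mul_zero] at h5 ⊢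
  refine h5.congr fun k => ?_
  rw [kronecker_pow, Matrix.kronecker_apply, smul_pow, smul_pow, Matrix.smul_apply,
    Matrix.smul_apply, smul_eq_mul, smul_eq_mul, inv_pow]
  field_simp

end Network

/-! ### Synchronization of copies of the target model -/

theorem Network.zetaHat_add_gain {N s : ℕ} (G : Network N) (c : Fin N → ℕ → Fin s → ℝ) (i : Fin N)
    (k : ℕ) : G.zetaHat c i k + G.gain i • c i k = c i k - ∑ j, G.weight i j • c j k :=
  G.smul_sum_sub_add_gain (fun j => c j k) i

theorem Network.zetaTilde_eq {N p h : ℕ} (G : Network N) (C : Matrix (Fin p) (Fin h) ℝ)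
    (x : Fin N → ℕ → Fin h → ℝ) (xr : ℕ → Fin h → ℝ) (i : Fin N) (k : ℕ) :
    G.zetaTilde (fun j t => C *ᵥ x j t) (fun t => C *ᵥ xr t) i k
      = C *ᵥ (x i k - xr k - ∑ j, G.weight i j • (x j k - xr k)) := by
  rw [← G.smul_sum_sub_add_gain (fun j => x j k - xr k) i]
  simp only [Network.zetaTilde, Network.gain, sub_sub_sub_cancel_right, Matrix.mulVec_add,
    Matrix.mulVec_smul, Matrix.mulVec_sub, Matrix.mulVec_sum, div_eq_inv_mul, mul_one, mul_smul,
    smul_add]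

/-- With e_i = x_i - x_r, three errors decay one after the other, each driven by the previous ones
and by φ. -/
theorem tendsto_target_sub_reference {p N : ℕ} (T : TargetModel p)
    (hA : ∀ s ∈ eigenvalues T.A, ‖s‖ ≤ 1) {H : Matrix (Fin T.h) (Fin p) ℝ}
    {K : Matrix (Fin p) (Fin T.h) ℝ} (hHK : T.IsGainPair H K) (G : Network N) (hG : G.Rooted)
    (x xhat chi : Fin N → ℕ → Fin T.h → ℝ) (xr : ℕ → Fin T.h → ℝ) (φ : Fin N → ℕ → Fin p → ℝ)
    (hφ : ∀ i, Tendsto (φ i) atTop (𝓝 0))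
    (hx : ∀ i k, x i (k + 1) = T.A *ᵥ x i k + T.B *ᵥ (-(K *ᵥ chi i k) + φ i k))
    (hxr : ∀ k, xr (k + 1) = T.A *ᵥ xr k)
    (hxhat : ∀ i k, xhat i (k + 1) = T.A *ᵥ xhat i k - (T.B * K) *ᵥ G.zetaHat chi i k
      + H *ᵥ (G.zetaTilde (fun j t => T.C *ᵥ x j t) (fun t => T.C *ᵥ xr t) i k
        - T.C *ᵥ xhat i k) - G.gain i • ((T.B * K) *ᵥ chi i k))
    (hchi : ∀ i k, chi i (k + 1) = T.A *ᵥ chi i k + T.B *ᵥ (-(K *ᵥ chi i k))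
      + T.A *ᵥ (xhat i k - G.zetaHat chi i k - G.gain i • chi i k)) (i : Fin N) :
    Tendsto (fun k => x i k - xr k) atTop (𝓝 0) := by
  have hBφ : ∀ i, Tendsto (fun k => T.B *ᵥ φ i k) atTop (𝓝 0) := fun i =>
    tendsto_mulVec_zero T.B (hφ i)
  -- The observer estimates (I - D) e. The inputs cancel because ζ̂ + g χ equals (I - D) χ, leaving
  -- the matrix A_h - H C_h.
  have h2 : ∀ i, Tendsto (fun k => (x i k - xr k - ∑ j, G.weight i j • (x j k - xr k))
      - xhat i k) atTop (𝓝 0) := by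
    intro i
    refine hHK.observer.tendsto_zero
      (d := fun k => T.B *ᵥ φ i k - ∑ j, G.weight i j • (T.B *ᵥ φ j k)) (fun k => ?_) ?_
    · have hz : G.zetaHat chi i k = chi i k - ∑ j, G.weight i j • chi j k - G.gain i • chi i k :=
        eq_sub_of_add_eq (G.zetaHat_add_gain chi i k)
      rw [hxhat, G.zetaTilde_eq, hz]
      simp only [hx, hxr, Matrix.mulVec_add, Matrix.mulVec_sub, Matrix.sub_mulVec,
        Matrix.mulVec_neg, ← Matrix.mulVec_mulVec, smul_sub, smul_add, smul_neg,
        Finset.sum_add_distrib, Finset.sum_sub_distrib, Matrix.mulVec_sum, Matrix.mulVec_smul,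
        Finset.sum_neg_distrib]
      abel
    · have : Tendsto (fun k => T.B *ᵥ φ i k - ∑ j, G.weight i j • (T.B *ᵥ φ j k)) atTop
          (𝓝 (0 - ∑ j, G.weight i j • (0 : Fin T.h → ℝ))) :=
        (hBφ i).sub (tendsto_finsetSum _ fun j _ => (hBφ j).const_smul _)
      simpa using this
  -- The inputs -B_h K χ also cancel in e - χ. Apart from decaying terms its node components are
  -- mixed by D and propagated by A_h, hence the Kronecker product on pairs (node, coordinate).
  have h1 : Tendsto (fun k (ia : Fin N × Fin T.h) => x ia.1 k ia.2 - xr k ia.2 - chi ia.1 k ia.2)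
      atTop (𝓝 0) := by
    refine ((G.isSchur_weight hG).kronecker hA).tendsto_zero
      (d := fun k ia => (T.A *ᵥ ((x ia.1 k - xr k - ∑ j, G.weight ia.1 j • (x j k - xr k))
        - xhat ia.1 k) + T.B *ᵥ φ ia.1 k) ia.2) (fun k => ?_) ?_
    · funext ia
      obtain ⟨i, a⟩ := ia
      have hz : G.zetaHat chi i k = chi i k - ∑ j, G.weight i j • chi j k - G.gain i • chi i k :=
        eq_sub_of_add_eq (G.zetaHat_add_gain chi i k)
      have e1 : x i (k + 1) - xr (k + 1) - chi i (k + 1)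
          = T.A *ᵥ (∑ j, G.weight i j • (x j k - xr k - chi j k))
            + (T.A *ᵥ ((x i k - xr k - ∑ j, G.weight i j • (x j k - xr k)) - xhat i k)
              + T.B *ᵥ φ i k) := by
        rw [hx, hxr, hchi, hz]
        simp only [Matrix.mulVec_add, Matrix.mulVec_sub, smul_sub, Finset.sum_sub_distrib,
          Matrix.mulVec_sum, Matrix.mulVec_smul]
        abel
      have e2 := congrFun e1 a
      simp only [Pi.sub_apply, Pi.add_apply] at e2 ⊢
      rw [e2]
      congr 1
      simp only [Matrix.mulVec, dotProduct, Matrix.kronecker_apply, Fintype.sum_prod_type,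
        Finset.sum_apply, Pi.smul_apply, Pi.sub_apply, smul_eq_mul, Finset.mul_sum]
      rw [Finset.sum_comm]
      refine Finset.sum_congr rfl fun j _ => Finset.sum_congr rfl fun b _ => ?_
      ring
    · refine tendsto_pi_nhds.2 fun ia => ?_
      have := (tendsto_mulVec_zero T.A (h2 ia.1)).add (hBφ ia.1)
      rw [add_zero] at this
      exact tendsto_pi_nhds.1 this ia.2
  have h1' : ∀ i, Tendsto (fun k => x i k - xr k - chi i k) atTop (𝓝 0) := fun i =>
    tendsto_pi_nhds.2 fun a => tendsto_pi_nhds.1 h1 (i, a)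
  -- Since χ approaches e, the input -K χ acts as the state feedback -K e.
  refine hHK.feedback.tendsto_zero
    (d := fun k => (T.B * K) *ᵥ (x i k - xr k - chi i k) + T.B *ᵥ φ i k) (fun k => ?_) ?_
  · rw [hx, hxr]
    simp only [Matrix.mulVec_add, Matrix.mulVec_sub, Matrix.sub_mulVec, Matrix.mulVec_neg,
      ← Matrix.mulVec_mulVec]
    abel
  · have := (tendsto_mulVec_zero (T.B * K) (h1' i)).add (hBφ i)
    rwa [add_zero] at this

/-! ### The explicit protocol achieves synchronization -/

theorem eigenvalues_norm_le_one {p r : ℕ} {T : TargetModel p} {Ar : Matrix (Fin r) (Fin r) ℝ}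
    (hAr : ∀ s ∈ eigenvalues Ar, ‖s‖ = 1)
    (hT : ∃ e : ℕ, T.A.charpoly = Ar.charpoly * Polynomial.X ^ e) :
    ∀ s ∈ eigenvalues T.A, ‖s‖ ≤ 1 := by
  intro s hs
  obtain ⟨e, he⟩ := hT
  have h1 : (cx(T.A)).charpoly.IsRoot s := Matrix.mem_spectrum_iff_isRoot_charpoly.1 hs
  rw [Matrix.charpoly_map, he, Polynomial.map_mul, ← Matrix.charpoly_map, Polynomial.map_pow,
    Polynomial.map_X, Polynomial.IsRoot, Polynomial.eval_mul, mul_eq_zero] at h1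
  rcases h1 with h1 | h1
  · exact (hAr s (Matrix.mem_spectrum_iff_isRoot_charpoly.2 h1)).le
  · rw [Polynomial.eval_pow, Polynomial.eval_X] at h1
    rw [eq_zero_of_pow_eq_zero h1, norm_zero]
    exact zero_le_one

/-- In coordinates relative to the regulator solution the disturbance drops out, and the homogenized
agents with the exosystem output form the synchronization problem for target models. -/
theorem explicit_protocol_synchronizes {p r N : ℕ} {Ar : Matrix (Fin r) (Fin r) ℝ}
    {Cr : Matrix (Fin p) (Fin r) ℝ} (hAr : ∀ s ∈ eigenvalues Ar, ‖s‖ = 1)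
    {M : Fin N → AgentModel p} {T : TargetModel p}
    (hcp : ∃ e : ℕ, T.A.charpoly = Ar.charpoly * Polynomial.X ^ e)
    (hout : ∀ xr0 : Fin r → ℝ, ∃ xh0 : Fin T.h → ℝ,
      ∀ k : ℕ, T.C *ᵥ (T.A ^ k *ᵥ xh0) = Cr *ᵥ (Ar ^ k *ᵥ xr0))
    {H : Matrix (Fin T.h) (Fin p) ℝ} {K : Matrix (Fin p) (Fin T.h) ℝ} (hHK : T.IsGainPair H K)
    (G : Network N) (hG : G.Rooted) (D : ∀ i, PreCompensators (M i))
    (hD2 : ∀ i, (D i).Step2) (hD4 : ∀ i, (D i).Step4 T)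
    {xr : ℕ → Fin r → ℝ} {x : ∀ i, ℕ → Fin (M i).n → ℝ} {w : ∀ i, ℕ → Fin (M i).d → ℝ}
    {u : ∀ i, ℕ → Fin (M i).m → ℝ} {q : ∀ i, ℕ → Fin (D i).nq → ℝ}
    {pp : ∀ i, ℕ → Fin (M i).d → ℝ} {xi : ∀ i, ℕ → Fin (D i).nh → ℝ}
    {xhat chi : Fin N → ℕ → Fin T.h → ℝ}
    (hcl : IsExplicitClosedLoop Ar Cr M T H K D G xr x w u q pp xi xhat chi) (i : Fin N) :
    Tendsto (fun k => (M i).output (x i) (w i) k - Cr *ᵥ xr k) atTop (𝓝 0) := by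
  -- The deviation of the cascade from the steady state Π w, and of the internal model from w. By
  -- the regulator equations it obeys the disturbance-free cascade, with outputs y and z̄.
  let xb : ∀ i, ℕ → ((Fin (M i).n ⊕ Fin (D i).nq) ⊕ Fin (M i).d) → ℝ := fun i k =>
    Sum.elim (Sum.elim (x i k) (q i k) - (D i).Pi *ᵥ w i k) (pp i k - w i k)
  let v : ∀ i, ℕ → Fin p → ℝ := fun i k =>
    (D i).v ((M i).measurement (x i) k) (pp i k) (xi i k) (-(K *ᵥ chi i k))
  have hzb : ∀ i k, (D i).zbar ((M i).measurement (x i) k) (pp i k) = (D i).fullCm *ᵥ xb i k := by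
    intro i k
    simp only [PreCompensators.zbar, PreCompensators.fullCm, AgentModel.measurement, xb,
      Matrix.fromCols_mulVec_sumElim, Matrix.mulVec_sub, Matrix.neg_mulVec,
      ← Matrix.mulVec_mulVec]
    have : (D i).cascCm *ᵥ Sum.elim (x i k) (q i k) = (M i).Cm *ᵥ x i k := by
      simp [PreCompensators.cascCm]
    rw [this]
    abel
  have hy : ∀ i k, (M i).output (x i) (w i) k = (D i).fullC *ᵥ xb i k := by
    intro i k
    simp only [PreCompensators.fullC, AgentModel.output, xb,
      Matrix.fromCols_mulVec_sumElim, Matrix.mulVec_sub, Matrix.zero_mulVec]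
    have h1 : (D i).cascC *ᵥ Sum.elim (x i k) (q i k) = (M i).C *ᵥ x i k := by
      simp [PreCompensators.cascC]
    have h2 : (D i).cascC * (D i).Pi = -(M i).G := eq_neg_of_add_eq_zero_left
      (hD2 i).regulation_output
    rw [h1, Matrix.mulVec_mulVec, h2, Matrix.neg_mulVec, sub_neg_eq_add, sub_zero, add_zero]
  have hxb : ∀ i k, xb i (k + 1) = (D i).fullA *ᵥ xb i k + (D i).fullB *ᵥ v i k := by
    intro i k
    have h1 : Sum.elim (x i (k + 1)) (q i (k + 1))
        = (D i).cascA *ᵥ Sum.elim (x i k) (q i k)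
          + (D i).cascB *ᵥ ((D i).Gam *ᵥ pp i k + (D i).Dp *ᵥ v i k) + (D i).cascE *ᵥ w i k := by
      rw [(hcl.agent i).state, hcl.preI, hcl.control]
      simp only [PreCompensators.cascA, PreCompensators.cascB, PreCompensators.cascE,
        Matrix.fromBlocks_mulVec, Matrix.fromRows_mulVec, Sum.elim_comp_inl, Sum.elim_comp_inr,
        PreCompensators.uq, v]
      funext j
      cases j with
      | inl j =>
        simp only [Sum.elim_inl, Pi.add_apply, Matrix.mulVec_add, ← Matrix.mulVec_mulVec]
        ring
      | inr j => simp
    have h2 : (D i).Pi *ᵥ w i (k + 1) = (D i).cascA *ᵥ ((D i).Pi *ᵥ w i k)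
        + (D i).cascB *ᵥ ((D i).Gam *ᵥ w i k) + (D i).cascE *ᵥ w i k := by
      rw [(hcl.agent i).disturbance, Matrix.mulVec_mulVec, (hD2 i).regulation_state]
      simp only [Matrix.add_mulVec, Matrix.mulVec_mulVec]
    have h3 : pp i (k + 1) - w i (k + 1) = (M i).S *ᵥ (pp i k - w i k) + (D i).Bp *ᵥ v i k := by
      rw [(hcl.agent i).disturbance, hcl.preII, Matrix.mulVec_sub]
      simp only [v]
      abel
    simp only [xb, h1, h2, h3, PreCompensators.fullA, PreCompensators.fullB,
      Matrix.fromBlocks_mulVec, Matrix.fromRows_mulVec, Sum.elim_comp_inl, Sum.elim_comp_inr]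
    funext j
    cases j with
    | inl j =>
      simp only [Sum.elim_inl, Pi.add_apply, Pi.sub_apply, Matrix.mulVec_add, Matrix.mulVec_sub,
        ← Matrix.mulVec_mulVec]
      ring
    | inr j => simp
  choose ns As Cs hAs hstep using hD4
  have hstep' := fun i => hstep i (xb i) (xi i) (v i) (fun k => -(K *ᵥ chi i k)) (hxb i)
    (fun k => by rw [hcl.preIII, hzb]) (fun k => by
      change (D i).Ch *ᵥ xi i k + (D i).Dh *ᵥ (-(K *ᵥ chi i k))
        + (D i).Fh *ᵥ (D i).zbar ((M i).measurement (x i) k) (pp i k) = _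
      rw [hzb])
  choose xch sig hxch hsig hC using hstep'
  obtain ⟨xh0, hxh0⟩ := hout (xr 0)
  have hxr : ∀ k, xr k = Ar ^ k *ᵥ xr 0 := by
    intro k
    induction k with
    | zero => simp
    | succ k ih => rw [hcl.reference, ih, Matrix.mulVec_mulVec, ← pow_succ']
  -- The exosystem output is that of an unforced target trajectory, which serves as reference below.
  have hyr : (fun t => Cr *ᵥ xr t) = fun t => T.C *ᵥ (T.A ^ t *ᵥ xh0) := by
    funext t
    rw [hxh0, ← hxr]
  have hyx : (fun j => (M j).output (x j) (w j)) = fun j t => T.C *ᵥ xch j t := by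
    funext j t
    rw [hy, hC]
  have key := tendsto_target_sub_reference T (eigenvalues_norm_le_one hAr hcp) hHK G hG
    xch xhat chi (fun k => T.A ^ k *ᵥ xh0) (fun i k => Cs i *ᵥ sig i k)
    (fun i => tendsto_mulVec_zero _ ((hAs i).tendsto_zero_of_autonomous (hsig i)))
    hxch (fun k => by rw [Matrix.mulVec_mulVec, ← pow_succ'])
    (fun i k => by rw [hcl.observer, hyr, hyx]) (fun i k => hcl.exchange i k) i
  have h := tendsto_mulVec_zero T.C key
  refine h.congr fun k => ?_
  rw [Matrix.mulVec_sub, hy, hC, ← congrFun hyr k]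

/-! ### Transfer functions, system matrices and invariant zeros -/

notation "rf(" A ")" => Matrix.map A (algebraMap (Polynomial ℝ) (RatFunc ℝ))
notation "rc(" A ")" => Matrix.map A (RatFunc.C : ℝ →+* RatFunc ℝ)

section Rosenbrock

variable {α β γ : Type*} [Fintype α] [DecidableEq α] [Fintype β] [Fintype γ]

/-- Evaluation of a real polynomial at a complex number. -/
abbrev evalC (t : ℂ) : Polynomial ℝ →+* ℂ := Polynomial.eval₂RingHom (algebraMap ℝ ℂ) t

theorem charmatrix_map {S : Type*} [CommRing S] (f : Polynomial ℝ →+* S) (A : Matrix α α ℝ) :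
    A.charmatrix.map f = f Polynomial.X • (1 : Matrix α α S) - A.map (f.comp Polynomial.C) := by
  ext i j
  by_cases h : i = j
  · subst h; simp
  · simp [h]

theorem charmatrix_map_evalC (t : ℂ) (A : Matrix α α ℝ) :
    A.charmatrix.map (evalC t) = t • (1 : Matrix α α ℂ) - cx(A) := by
  rw [charmatrix_map]
  ext i j
  simp

theorem charmatrix_map_ratFunc (A : Matrix α α ℝ) :
    rf(A.charmatrix) = (RatFunc.X : RatFunc ℝ) • (1 : Matrix α α (RatFunc ℝ)) - rc(A) := by
  rw [charmatrix_map]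
  ext i j
  simp

theorem isUnit_X_sub (A : Matrix α α ℝ) :
    IsUnit ((RatFunc.X : RatFunc ℝ) • (1 : Matrix α α (RatFunc ℝ)) - rc(A)) := by
  rw [Matrix.isUnit_iff_isUnit_det, isUnit_iff_ne_zero, ← charmatrix_map_ratFunc,
    ← RingHom.mapMatrix_apply, ← RingHom.map_det]
  exact (map_ne_zero_iff _ (RatFunc.algebraMap_injective ℝ)).2 A.charpoly_monic.ne_zero

omit [Fintype β] [Fintype γ] in
-- The resolvent is the adjugate over the characteristic polynomial. In this polynomial form,
-- identities between rational matrices can be evaluated at complex points.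
theorem charpoly_smul_transfer (A : Matrix α α ℝ) (B : Matrix α β ℝ) (C : Matrix γ α ℝ)
    (D : Matrix γ β ℝ) :
    algebraMap (Polynomial ℝ) (RatFunc ℝ) A.charpoly • transfer A B C D
      = rf(C.map Polynomial.C * A.charmatrix.adjugate * B.map Polynomial.C
        + A.charpoly • D.map Polynomial.C) := by
  have h0 : algebraMap (Polynomial ℝ) (RatFunc ℝ) A.charpoly ≠ 0 :=
    (map_ne_zero_iff _ (RatFunc.algebraMap_injective ℝ)).2 A.charpoly_monic.ne_zero
  have h1 : algebraMap (Polynomial ℝ) (RatFunc ℝ) A.charpoly •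
      ((RatFunc.X : RatFunc ℝ) • (1 : Matrix α α (RatFunc ℝ)) - rc(A))⁻¹
      = rf(A.charmatrix.adjugate) := by
    rw [Matrix.inv_def, ← charmatrix_map_ratFunc, ← RingHom.mapMatrix_apply, ← RingHom.map_det,
      ← RingHom.map_adjugate, RingHom.mapMatrix_apply, smul_smul, Ring.inverse_eq_inv']
    erw [mul_inv_cancel₀ h0]
    rw [one_smul]
  rw [transfer, smul_add, ← Matrix.smul_mul, ← Matrix.mul_smul, h1,
    Matrix.map_add _ (map_add _), Matrix.map_mul, Matrix.map_mul]
  congr 1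
  ext i j; simp

theorem RightInvertible.exists_polynomial [DecidableEq γ] {A : Matrix α α ℝ} {B : Matrix α β ℝ}
    {C : Matrix γ α ℝ} {D : Matrix γ β ℝ} (h : RightInvertible A B C D) :
    ∃ (R : Matrix β γ (Polynomial ℝ)) (b : Polynomial ℝ), b ≠ 0 ∧
      (C.map Polynomial.C * A.charmatrix.adjugate * B.map Polynomial.C
        + A.charpoly • D.map Polynomial.C) * R = b • (1 : Matrix γ γ (Polynomial ℝ)) := by
  obtain ⟨R, hR⟩ := h
  obtain ⟨b, hb⟩ := IsLocalization.exist_integer_multiples_of_finite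
    (nonZeroDivisors (Polynomial ℝ)) (fun ij : β × γ => R ij.1 ij.2)
  choose R' hR' using fun i j => hb (i, j)
  have h1 : rf(Matrix.of R') = algebraMap (Polynomial ℝ) (RatFunc ℝ) b • R := by
    ext i j
    have := hR' i j
    simp only [Matrix.map_apply, Matrix.of_apply, Matrix.smul_apply, smul_eq_mul]
    rw [this, Algebra.smul_def]
  refine ⟨Matrix.of R', A.charpoly * b, mul_ne_zero A.charpoly_monic.ne_zero
    (nonZeroDivisors.ne_zero b.2), ?_⟩
  apply Matrix.map_injective (RatFunc.algebraMap_injective ℝ)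
  change Matrix.map _ _ = Matrix.map _ _
  rw [Matrix.map_mul, ← charpoly_smul_transfer, h1, Matrix.smul_mul, Matrix.mul_smul, hR,
    smul_smul]
  ext i j
  by_cases hij : i = j
  · subst hij; simp
  · simp [hij]

omit [Fintype β] in
theorem rosenbrock_vecMul_eq_zero_iff {A : Matrix α α ℝ} {B : Matrix α β ℝ}
    {C : Matrix γ α ℝ} {D : Matrix γ β ℝ} {s : ℂ} {a : α → ℂ} {c : γ → ℂ} :
    Sum.elim a c ᵥ* rosenbrock A B C D s = 0 ↔
      a ᵥ* cx(A) = s • a + c ᵥ* cx(C) ∧ a ᵥ* cx(B) = c ᵥ* cx(D) := by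
  rw [rosenbrock, Matrix.vecMul_fromBlocks, ← Sum.elim_zero_zero, Sum.elim_eq_iff]
  simp only [Sum.elim_comp_inl, Sum.elim_comp_inr, Matrix.vecMul_sub, Matrix.vecMul_smul,
    Matrix.vecMul_one, Matrix.vecMul_neg]
  refine and_congr ⟨fun h => ?_, fun h => ?_⟩ ⟨fun h => ?_, fun h => ?_⟩
  · rw [sub_add_eq_add_sub, sub_eq_zero] at h
    exact h.symm
  · rw [h]; abel
  · rw [neg_add_eq_zero] at h
    exact h
  · rw [h]; abel

omit [Fintype γ] in
theorem rosenbrock_mulVec_eq_zero_iff {A : Matrix α α ℝ} {B : Matrix α β ℝ}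
    {C : Matrix γ α ℝ} {D : Matrix γ β ℝ} {s : ℂ} {x : α → ℂ} {u : β → ℂ} :
    rosenbrock A B C D s *ᵥ Sum.elim x u = 0 ↔
      s • x = cx(A) *ᵥ x + cx(B) *ᵥ u ∧ cx(C) *ᵥ x + cx(D) *ᵥ u = 0 := by
  rw [rosenbrock, Matrix.fromBlocks_mulVec, ← Sum.elim_zero_zero, Sum.elim_eq_iff]
  simp only [Sum.elim_comp_inl, Sum.elim_comp_inr, Matrix.sub_mulVec, Matrix.smul_mulVec,
    Matrix.one_mulVec, Matrix.neg_mulVec]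
  refine and_congr ⟨fun h => ?_, fun h => ?_⟩ Iff.rfl
  · rw [← sub_eq_add_neg, sub_sub, sub_eq_zero] at h
    exact h
  · rw [h]; abel

theorem exists_evalC_ne_zero {b : Polynomial ℝ} (hb : b ≠ 0) : ∃ t : ℂ, evalC t b ≠ 0 := by
  have h : (b.map (algebraMap ℝ ℂ)) ≠ 0 := (Polynomial.map_ne_zero_iff (algebraMap ℝ ℂ).injective).2 hb
  obtain ⟨t, ht⟩ := (Polynomial.finite_setOfPred_isRoot h).infinite_compl.nonempty
  refine ⟨t, fun h0 => ht ?_⟩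
  simpa [Polynomial.IsRoot, Polynomial.eval_map] using h0

/-- The system matrix of a right-invertible system has full row rank somewhere. -/
theorem RightInvertible.exists_rosenbrock_injective [DecidableEq γ] {A : Matrix α α ℝ}
    {B : Matrix α β ℝ} {C : Matrix γ α ℝ} {D : Matrix γ β ℝ} (h : RightInvertible A B C D) :
    ∃ t : ℂ, ∀ w, w ᵥ* rosenbrock A B C D t = 0 → w = 0 := by
  obtain ⟨R, b, hb, hR⟩ := h.exists_polynomial
  -- Away from the zeros of b and the eigenvalues of A, the polynomial right inverse and the
  -- resolvent are both usable: a left null vector (a, c) first gives a in terms of c, then c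
  -- annihilates the numerator, so c = 0.
  obtain ⟨t, ht⟩ := exists_evalC_ne_zero (mul_ne_zero hb A.charpoly_monic.ne_zero)
  rw [map_mul, mul_ne_zero_iff] at ht
  refine ⟨t, fun w hw => ?_⟩
  obtain ⟨a, c, rfl⟩ : ∃ a c, w = Sum.elim a c := ⟨w ∘ Sum.inl, w ∘ Sum.inr,
    (Sum.elim_comp_inl_inr w).symm⟩
  obtain ⟨h1, h2⟩ := rosenbrock_vecMul_eq_zero_iff.1 hw
  have hJ : (t • (1 : Matrix α α ℂ) - cx(A)) * A.charmatrix.adjugate.map (evalC t)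
      = evalC t A.charpoly • (1 : Matrix α α ℂ) := by
    rw [← charmatrix_map_evalC, ← Matrix.map_mul, Matrix.mul_adjugate]
    ext i j
    by_cases hij : i = j
    · subst hij; simp [Matrix.charpoly]
    · simp [hij]
  have hE : (cx(C) * A.charmatrix.adjugate.map (evalC t) * cx(B)
      + evalC t A.charpoly • cx(D)) * R.map (evalC t) = evalC t b • (1 : Matrix γ γ ℂ) := by
    have h3 := congrArg (fun E => E.map (evalC t)) hR
    simp only [Matrix.map_mul, Matrix.map_add _ (map_add (evalC t))] at h3
    convert h3 using 1
    · congr 1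
      congr 1
      · congr 1
        · congr 1
          ext i j; simp
        · ext i j; simp
      · ext i j; simp
    · ext i j
      by_cases hij : i = j
      · subst hij; simp
      · simp [hij]
  have h3 : a ᵥ* (t • (1 : Matrix α α ℂ) - cx(A)) = -(c ᵥ* cx(C)) := by
    rw [Matrix.vecMul_sub, Matrix.vecMul_smul, Matrix.vecMul_one, h1]
    abel
  have h4 : evalC t A.charpoly • a = -(c ᵥ* (cx(C) * A.charmatrix.adjugate.map (evalC t))) := by
    have := congrArg (fun z => z ᵥ* A.charmatrix.adjugate.map (evalC t)) h3
    beta_reduce at this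
    rw [Matrix.vecMul_vecMul, hJ, Matrix.vecMul_smul, Matrix.vecMul_one, Matrix.neg_vecMul,
      Matrix.vecMul_vecMul] at this
    exact this
  have h5 : c ᵥ* (cx(C) * A.charmatrix.adjugate.map (evalC t) * cx(B)
      + evalC t A.charpoly • cx(D)) = 0 := by
    rw [Matrix.vecMul_add, Matrix.vecMul_smul, ← h2, ← Matrix.smul_vecMul, h4, Matrix.neg_vecMul,
      Matrix.vecMul_vecMul, add_neg_cancel]
  have h6 : c = 0 := by
    have := congrArg (fun z => z ᵥ* R.map (evalC t)) h5
    beta_reduce at this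
    rw [Matrix.vecMul_vecMul, hE, Matrix.vecMul_smul, Matrix.vecMul_one, Matrix.zero_vecMul] at this
    exact (smul_eq_zero.1 this).resolve_left ht.1
  subst h6
  rw [Matrix.zero_vecMul, neg_zero] at h4
  rw [(smul_eq_zero.1 h4).resolve_left ht.2, Sum.elim_zero_zero]

theorem rank_eq_card_iff {m n : Type*} [Fintype m] [Fintype n] {R : Matrix m n ℂ} :
    R.rank = Fintype.card m ↔ ∀ w, w ᵥ* R = 0 → w = 0 := by
  have h1 : (∀ w, w ᵥ* R = 0 → w = 0) ↔ LinearIndependent ℂ R.row := by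
    rw [← Matrix.vecMul_injective_iff]
    exact (injective_iff_map_eq_zero R.vecMulLinear).symm
  rw [h1]
  refine ⟨fun h => ?_, LinearIndependent.rank_matrix⟩
  rw [linearIndependent_iff_card_eq_finrank_span, ← h, Matrix.rank_eq_finrank_span_row]
  rfl

theorem not_isInvariantZero_of_injective {A : Matrix α α ℝ} {B : Matrix α β ℝ} {C : Matrix γ α ℝ}
    {D : Matrix γ β ℝ} {s : ℂ} (h : ∀ w, w ᵥ* rosenbrock A B C D s = 0 → w = 0) :
    ¬ IsInvariantZero A B C D s := by
  rintro ⟨t, ht⟩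
  rw [rank_eq_card_iff.2 h] at ht
  exact absurd (Matrix.rank_le_card_height _) (not_le.2 ht)

/-- The normal rank is the full row rank here, so away from invariant zeros there is no left null
vector. With `not_isInvariantZero_of_injective`, all later statements on zeros become statements on
left null vectors. -/
theorem RightInvertible.injective_of_not_isInvariantZero [DecidableEq γ] {A : Matrix α α ℝ}
    {B : Matrix α β ℝ} {C : Matrix γ α ℝ} {D : Matrix γ β ℝ} (h : RightInvertible A B C D) {s : ℂ}
    (hs : ¬ IsInvariantZero A B C D s) : ∀ w, w ᵥ* rosenbrock A B C D s = 0 → w = 0 := by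
  obtain ⟨t, ht⟩ := h.exists_rosenbrock_injective
  rw [← rank_eq_card_iff] at ht ⊢
  refine le_antisymm (Matrix.rank_le_card_height _) ?_
  rw [← ht]
  exact not_lt.1 fun hlt => hs ⟨t, hlt⟩

theorem exists_vecMul_of_isInvariantZero {A : Matrix α α ℝ} {B : Matrix α β ℝ} {C : Matrix γ α ℝ}
    {D : Matrix γ β ℝ} {s : ℂ} (h : IsInvariantZero A B C D s) :
    ∃ w, w ≠ 0 ∧ w ᵥ* rosenbrock A B C D s = 0 := by
  by_contra hcon
  push Not at hcon
  exact not_isInvariantZero_of_injective (fun w hw => by_contra fun h0 => hcon w h0 hw) h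

theorem mulVec_injective_of_vecMul_injective {n : Type*} [Fintype n] {R : Matrix n n ℂ}
    (h : ∀ w : n → ℂ, w ᵥ* R = 0 → w = 0) : ∀ w : n → ℂ, R *ᵥ w = 0 → w = 0 := by
  classical
  intro w hw
  by_contra h0
  have h1 : R.det = 0 := Matrix.exists_mulVec_eq_zero_iff.1 ⟨w, h0, hw⟩
  obtain ⟨w', h2, h3⟩ := (Matrix.exists_vecMul_eq_zero_iff (M := R)).2 h1
  exact h2 (h w' h3)

theorem vecMul_injective_of_mulVec_injective {n : Type*} [Fintype n] {R : Matrix n n ℂ}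
    (h : ∀ w : n → ℂ, R *ᵥ w = 0 → w = 0) : ∀ w : n → ℂ, w ᵥ* R = 0 → w = 0 := by
  classical
  intro w hw
  by_contra h0
  have h1 : R.det = 0 := Matrix.exists_vecMul_eq_zero_iff.1 ⟨w, h0, hw⟩
  obtain ⟨w', h2, h3⟩ := (Matrix.exists_mulVec_eq_zero_iff (M := R)).2 h1
  exact h2 (h w' h3)

theorem invertible_of_rightInvertible [DecidableEq γ] {A : Matrix α α ℝ} {B : Matrix α γ ℝ}
    {C : Matrix γ α ℝ} {D : Matrix γ γ ℝ} (h : RightInvertible A B C D) : Invertible A B C D := by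
  obtain ⟨R, hR⟩ := h
  exact ⟨⟨R, mul_eq_one_comm.1 hR⟩, R, hR⟩

omit [Fintype γ] in
/-- The transfer function matrix of a cascade. -/
theorem transfer_cascade {α₂ δ : Type*} [Fintype α₂] [DecidableEq α₂] (A₁ : Matrix α α ℝ)
    (B₁ : Matrix α β ℝ) (C₁ : Matrix γ α ℝ) (D₁ : Matrix γ β ℝ) (A₂ : Matrix α₂ α₂ ℝ)
    (B₂ : Matrix α₂ δ ℝ) (C₂ : Matrix β α₂ ℝ) (D₂ : Matrix β δ ℝ) :
    transfer (fromBlocks A₁ (B₁ * C₂) 0 A₂) (fromRows (B₁ * D₂) B₂) (fromCols C₁ (D₁ * C₂))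
      (D₁ * D₂) = transfer A₁ B₁ C₁ D₁ * transfer A₂ B₂ C₂ D₂ := by
  have h1 : (RatFunc.X : RatFunc ℝ) • (1 : Matrix (α ⊕ α₂) (α ⊕ α₂) (RatFunc ℝ))
      - rc(fromBlocks A₁ (B₁ * C₂) 0 A₂)
      = fromBlocks ((RatFunc.X : RatFunc ℝ) • 1 - rc(A₁)) (-(rc(B₁) * rc(C₂))) 0
        ((RatFunc.X : RatFunc ℝ) • 1 - rc(A₂)) := by
    rw [← Matrix.fromBlocks_one, Matrix.fromBlocks_smul, Matrix.fromBlocks_map,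
      sub_eq_add_neg, Matrix.fromBlocks_neg, Matrix.fromBlocks_add, Matrix.map_mul]
    simp [sub_eq_add_neg]
  have h2 : rc(fromRows (B₁ * D₂) B₂) = fromRows (rc(B₁) * rc(D₂)) rc(B₂) := by
    ext i j
    cases i <;> simp [← Matrix.map_mul]
  have h3 : rc(fromCols C₁ (D₁ * C₂)) = fromCols rc(C₁) (rc(D₁) * rc(C₂)) := by
    ext i j
    cases j <;> simp [← Matrix.map_mul]
  rw [transfer, h1, h2, h3, Matrix.inv_fromBlocks_zero₂₁_of_isUnit_iff _ _ _
    (iff_of_true (isUnit_X_sub A₁) (isUnit_X_sub A₂)), Matrix.fromCols_mul_fromBlocks,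
    Matrix.fromCols_mul_fromRows, Matrix.map_mul]
  simp only [transfer]
  generalize ((RatFunc.X : RatFunc ℝ) • (1 : Matrix α α (RatFunc ℝ)) - rc(A₁))⁻¹ = R₁
  generalize ((RatFunc.X : RatFunc ℝ) • (1 : Matrix α₂ α₂ (RatFunc ℝ)) - rc(A₂))⁻¹ = R₂
  simp only [Matrix.mul_add, Matrix.add_mul, Matrix.mul_neg, Matrix.neg_mul, neg_neg,
    Matrix.mul_zero, add_zero, Matrix.mul_assoc]
  abel

omit [Fintype γ] in
theorem transfer_cascade' {α₂ δ : Type*} [Fintype α₂] [DecidableEq α₂] (A₁ : Matrix α α ℝ)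
    (B₁ : Matrix α β ℝ) (C₁ : Matrix γ α ℝ) (A₂ : Matrix α₂ α₂ ℝ)
    (B₂ : Matrix α₂ δ ℝ) (C₂ : Matrix β α₂ ℝ) (D₂ : Matrix β δ ℝ) :
    transfer (fromBlocks A₁ (B₁ * C₂) 0 A₂) (fromRows (B₁ * D₂) B₂) (fromCols C₁ 0) 0
      = transfer A₁ B₁ C₁ 0 * transfer A₂ B₂ C₂ D₂ := by
  have := transfer_cascade A₁ B₁ C₁ 0 A₂ B₂ C₂ D₂
  rwa [Matrix.zero_mul, Matrix.zero_mul] at this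

end Rosenbrock

section SquareInvertible

variable {α γ : Type*} [Fintype α] [DecidableEq α] [Fintype γ] [DecidableEq γ]

theorem mul_adjugate_evalC (A : Matrix α α ℝ) (t : ℂ) :
    (t • (1 : Matrix α α ℂ) - cx(A)) * A.charmatrix.adjugate.map (evalC t)
      = evalC t A.charpoly • (1 : Matrix α α ℂ) := by
  rw [← charmatrix_map_evalC, ← Matrix.map_mul, Matrix.mul_adjugate]
  ext i j
  by_cases hij : i = j
  · subst hij; simp [Matrix.charpoly]
  · simp [hij]

theorem evalC_charpoly_ne_zero {A : Matrix α α ℝ} {t : ℂ} (ht : t ∉ eigenvalues A) :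
    evalC t A.charpoly ≠ 0 := by
  intro h
  apply ht
  rw [mem_eigenvalues_iff_det, ← charmatrix_map_evalC, ← RingHom.mapMatrix_apply, ← RingHom.map_det]
  exact h

/-- If the numerator had zero determinant, a null vector u of its value at t would give the null
vector (adj(t - A) B u, χ(t) u) of the system matrix, and χ(t) ≠ 0. -/
theorem invertible_of_rosenbrock_injective {A : Matrix α α ℝ} {B : Matrix α γ ℝ}
    {C : Matrix γ α ℝ} {D : Matrix γ γ ℝ} {t : ℂ} (ht : t ∉ eigenvalues A)
    (h : ∀ w, rosenbrock A B C D t *ᵥ w = 0 → w = 0) : Invertible A B C D := by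
  apply invertible_of_rightInvertible
  set Np : Matrix γ γ (Polynomial ℝ) := C.map Polynomial.C * A.charmatrix.adjugate *
    B.map Polynomial.C + A.charpoly • D.map Polynomial.C with hNp
  have hχ := evalC_charpoly_ne_zero ht
  have hE : Np.map (evalC t) = cx(C) * A.charmatrix.adjugate.map (evalC t) * cx(B)
      + evalC t A.charpoly • cx(D) := by
    simp only [hNp, Matrix.map_mul, Matrix.map_add _ (map_add (evalC t))]
    congr 1
    · congr 1
      · congr 1
        ext i j; simp
      · ext i j; simp
    · ext i j; simp
  have hdet : Np.det ≠ 0 := by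
    intro h0
    have h1 : (Np.map (evalC t)).det = 0 := by
      rw [← RingHom.mapMatrix_apply, ← RingHom.map_det, h0, map_zero]
    obtain ⟨u, hu0, hu⟩ := Matrix.exists_mulVec_eq_zero_iff.2 h1
    apply hu0
    have h2 : rosenbrock A B C D t *ᵥ Sum.elim (A.charmatrix.adjugate.map (evalC t) *ᵥ (cx(B) *ᵥ u))
        (evalC t A.charpoly • u) = 0 := by
      rw [rosenbrock_mulVec_eq_zero_iff]
      constructor
      · have h3 := congrArg (fun E => E *ᵥ (cx(B) *ᵥ u)) (mul_adjugate_evalC A t)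
        beta_reduce at h3
        rw [← Matrix.mulVec_mulVec, Matrix.sub_mulVec, Matrix.smul_mulVec, Matrix.one_mulVec,
          Matrix.smul_mulVec, Matrix.one_mulVec, sub_eq_iff_eq_add] at h3
        rw [h3, Matrix.mulVec_smul, add_comm]
      · rw [hE, Matrix.add_mulVec, Matrix.smul_mulVec, ← Matrix.mulVec_smul, ← Matrix.mulVec_mulVec,
          ← Matrix.mulVec_mulVec] at hu
        exact hu
    have h3 := h _ h2
    rw [← Sum.elim_zero_zero, Sum.elim_eq_iff] at h3
    exact (smul_eq_zero.1 h3.2).resolve_left hχ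
  have h1 := charpoly_smul_transfer A B C D
  have h2 : IsUnit (rf(Np)).det := by
    rw [isUnit_iff_ne_zero, ← RingHom.mapMatrix_apply, ← RingHom.map_det]
    exact (map_ne_zero_iff _ (RatFunc.algebraMap_injective ℝ)).2 hdet
  refine ⟨algebraMap (Polynomial ℝ) (RatFunc ℝ) A.charpoly • (rf(Np))⁻¹, ?_⟩
  rw [Matrix.mul_smul, ← Matrix.smul_mul, h1]
  exact Matrix.mul_nonsing_inv _ h2

omit [DecidableEq α] in
theorem mulVec_re_im_eq_zero {m : Type*} {R : Matrix m α ℝ} {v : α → ℂ} (h : cx(R) *ᵥ v = 0) :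
    R *ᵥ (fun i => (v i).re) = 0 ∧ R *ᵥ (fun i => (v i).im) = 0 := by
  constructor <;> funext i
  · have := congrArg Complex.re (congrFun h i)
    simpa [Matrix.mulVec, dotProduct, Complex.re_sum] using this
  · have := congrArg Complex.im (congrFun h i)
    simpa [Matrix.mulVec, dotProduct, Complex.im_sum] using this

omit [DecidableEq α] in
theorem cx_mulVec_ofReal {m : Type*} (R : Matrix m α ℝ) (x : α → ℝ) :
    cx(R) *ᵥ (fun i => (x i : ℂ)) = fun i => (((R *ᵥ x) i : ℝ) : ℂ) := by
  funext i
  simp [Matrix.mulVec, dotProduct]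

omit [Fintype γ] [DecidableEq γ] in
theorem complex_eq_zero_of_markov_observable {A : Matrix α α ℝ} {C : Matrix γ α ℝ} {n : ℕ}
    (hinj : ∀ x : α → ℝ, (∀ i < n, (C * A ^ i) *ᵥ x = 0) → x = 0) {v : α → ℂ}
    (hv : ∀ i < n, cx(C * A ^ i) *ᵥ v = 0) : v = 0 := by
  have h1 := hinj _ fun i hi => (mulVec_re_im_eq_zero (hv i hi)).1
  have h2 := hinj _ fun i hi => (mulVec_re_im_eq_zero (hv i hi)).2
  funext i
  exact Complex.ext (congrFun h1 i) (congrFun h2 i)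

end SquareInvertible

/-! ### The target model -/

section Target

variable {α γ : Type*} [Fintype α] [DecidableEq α] [Fintype γ] [DecidableEq γ]

/-- A uniform-rank system which is observed by its first `n` Markov rows has no zero directions. -/
theorem rosenbrock_injective_of_uniformRank {A : Matrix α α ℝ} {B : Matrix α γ ℝ}
    {C : Matrix γ α ℝ} {n : ℕ} (hrank : UniformRank A B C n)
    (hinj : ∀ x : α → ℝ, (∀ i < n, (C * A ^ i) *ᵥ x = 0) → x = 0) (s : ℂ) :
    ∀ w, rosenbrock A B C 0 s *ᵥ w = 0 → w = 0 := by
  intro w hw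
  obtain ⟨x, u, rfl⟩ : ∃ x u, w = Sum.elim x u := ⟨w ∘ Sum.inl, w ∘ Sum.inr,
    (Sum.elim_comp_inl_inr w).symm⟩
  obtain ⟨h1, h2⟩ := rosenbrock_mulVec_eq_zero_iff.1 hw
  rw [Matrix.map_zero _ (map_zero _), Matrix.zero_mulVec, add_zero] at h2
  have h3 : ∀ i < n, cx(C * A ^ i) *ᵥ x = 0 := by
    intro i
    induction i with
    | zero => intro _; simpa using h2
    | succ i ih =>
      intro hi
      have h4 := ih (by omega)
      have h5 := congrArg (fun z => cx(C * A ^ i) *ᵥ z) h1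
      beta_reduce at h5
      rw [Matrix.mulVec_smul, h4, smul_zero, Matrix.mulVec_add, Matrix.mulVec_mulVec,
        Matrix.mulVec_mulVec, ← Matrix.map_mul, ← Matrix.map_mul, hrank.2.1 i hi,
        Matrix.map_zero _ (map_zero _), Matrix.zero_mulVec, add_zero, Matrix.mul_assoc,
        ← pow_succ] at h5
      exact h5.symm
  have hx := complex_eq_zero_of_markov_observable hinj h3
  subst hx
  rw [smul_zero, Matrix.mulVec_zero, zero_add] at h1
  have h4 := congrArg (fun z => cx(C * A ^ (n - 1)) *ᵥ z) h1
  beta_reduce at h4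
  rw [Matrix.mulVec_zero, Matrix.mulVec_mulVec, ← Matrix.map_mul] at h4
  have h5 : IsUnit cx(C * A ^ (n - 1) * B) := by
    rw [← RingHom.mapMatrix_apply]
    exact hrank.2.2.map _
  have h6 : u = 0 := by
    refine Matrix.mulVec_injective_of_isUnit h5 ?_
    rw [← h4, Matrix.mulVec_zero]
  rw [h6, Sum.elim_zero_zero]

variable {p r : ℕ} {T : TargetModel p} {Ar : Matrix (Fin r) (Fin r) ℝ}
  {Cr : Matrix (Fin p) (Fin r) ℝ} {nq : ℕ}

theorem TargetModel.Remodels.vecMul_injective (hT : T.Remodels Ar Cr nq) (s : ℂ) :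
    ∀ w, w ᵥ* rosenbrock T.A T.B T.C 0 s = 0 → w = 0 :=
  hT.invertible.2.injective_of_not_isInvariantZero (hT.no_zeros s)

theorem TargetModel.Remodels.mulVec_injective (hT : T.Remodels Ar Cr nq) (s : ℂ) :
    ∀ w, rosenbrock T.A T.B T.C 0 s *ᵥ w = 0 → w = 0 :=
  mulVec_injective_of_vecMul_injective (hT.vecMul_injective s)

/-- Without invariant zeros the system matrix is invertible everywhere, and its null vectors with
one component zero are exactly those of the two Hautus tests. -/
theorem TargetModel.Remodels.exists_gainPair (hT : T.Remodels Ar Cr nq) :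
    ∃ H K, T.IsGainPair H K := by
  obtain ⟨F, hF⟩ : Stabilizable T.A T.B := stabilizable_of_hautus fun s _ w hw hwB => by
    have := hT.vecMul_injective s (Sum.elim w 0)
      (rosenbrock_vecMul_eq_zero_iff.2 ⟨by rw [hw, Matrix.zero_vecMul, add_zero], by rw [hwB, Matrix.zero_vecMul]⟩)
    rw [← Sum.elim_zero_zero, Sum.elim_eq_iff] at this
    exact this.1
  obtain ⟨L, hL⟩ : Detectable T.C T.A := detectable_of_hautus fun s _ w hw hwC => by
    have := hT.mulVec_injective s (Sum.elim w 0)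
      (rosenbrock_mulVec_eq_zero_iff.2 ⟨by simpa using hw.symm, by simpa using hwC⟩)
    rw [← Sum.elim_zero_zero, Sum.elim_eq_iff] at this
    exact this.1
  refine ⟨-L, -F, ?_, ?_⟩
  · rwa [Matrix.neg_mul, sub_neg_eq_add]
  · rwa [Matrix.mul_neg, sub_neg_eq_add]

/-- The map from A ^ l B u to output samples is block triangular with an invertible block in the
corner, so the samples are prescribed successively: the correction with A ^ l B sets sample n - 1 -
l without touching earlier ones, and the induction hypothesis repairs the later ones. -/
theorem UniformRank.surjective {A : Matrix α α ℝ} {B : Matrix α γ ℝ}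
    {C : Matrix γ α ℝ} {n : ℕ} (h : UniformRank A B C n) (y : ℕ → γ → ℝ) :
    ∃ x : α → ℝ, ∀ i < n, (C * A ^ i) *ᵥ x = y i := by
  have key : ∀ l ≤ n, ∀ y : ℕ → γ → ℝ, ∃ x : α → ℝ, (∀ i < n, n ≤ i + l → (C * A ^ i) *ᵥ x = y i) ∧
      ∀ i, i + l < n → (C * A ^ i) *ᵥ x = 0 := by
    intro l
    induction l with
    | zero =>
      intro _ y
      exact ⟨0, fun i h1 h2 => by omega, fun i _ => Matrix.mulVec_zero _⟩
    | succ l ih =>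
      intro hl y
      let x₁ : α → ℝ := (A ^ l * B) *ᵥ ((C * A ^ (n - 1) * B)⁻¹ *ᵥ y (n - 1 - l))
      have hx₁ : ∀ i, (C * A ^ i) *ᵥ x₁
          = (C * A ^ (i + l) * B) *ᵥ ((C * A ^ (n - 1) * B)⁻¹ *ᵥ y (n - 1 - l)) := by
        intro i
        simp only [x₁, Matrix.mulVec_mulVec, Matrix.mul_assoc, pow_add]
      obtain ⟨x₂, h1, h2⟩ := ih (by omega) (fun i => y i - (C * A ^ i) *ᵥ x₁)
      refine ⟨x₁ + x₂, fun i hi hil => ?_, fun i hi => ?_⟩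
      · rw [Matrix.mulVec_add]
        by_cases hc : n ≤ i + l
        · rw [h1 i hi hc]; abel
        · rw [h2 i (by omega), add_zero, hx₁, show i + l = n - 1 by omega, Matrix.mulVec_mulVec,
            Matrix.mul_nonsing_inv _ ((Matrix.isUnit_iff_isUnit_det _).1 h.2.2),
            Matrix.one_mulVec, show n - 1 - l = i by omega]
      · rw [Matrix.mulVec_add, hx₁, h.2.1 _ (by omega), Matrix.zero_mulVec, zero_add,
          h2 i (by omega)]
  obtain ⟨x, hx, -⟩ := key n le_rfl y
  exact ⟨x, fun i hi => hx i hi (by omega)⟩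

/-- The common kernel of the first n_q Markov rows is invariant under a suitable state feedback and
lies in the kernel of C. If it were nonzero, an eigenvector in it would be a zero direction, but
there are none. Thus n_q output samples are coordinates of the target state. -/
theorem TargetModel.Remodels.eq_zero_of_markov (hT : T.Remodels Ar Cr nq) {x : Fin T.h → ℝ}
    (hx : ∀ i < nq, (T.C * T.A ^ i) *ᵥ x = 0) : x = 0 := by
  have hU : IsUnit (T.C * T.A ^ (nq - 1) * T.B) := hT.uniformRank.2.2
  have hn := hT.uniformRank.1
  -- This feedback makes the output sample number n_q vanish.
  let F : Matrix (Fin p) (Fin T.h) ℝ := -((T.C * T.A ^ (nq - 1) * T.B)⁻¹ * (T.C * T.A ^ nq))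
  have hinv : ∀ i < nq, T.C * T.A ^ i * (T.A + T.B * F) = if i + 1 < nq then T.C * T.A ^ (i + 1)
      else 0 := by
    intro i hi
    rw [Matrix.mul_add, Matrix.mul_assoc T.C, ← pow_succ, ← Matrix.mul_assoc _ T.B]
    split_ifs with h
    · rw [hT.uniformRank.2.1 i h, Matrix.zero_mul, add_zero]
    · have hi' : i = nq - 1 := by omega
      subst hi'
      rw [Matrix.mul_neg, ← Matrix.mul_assoc,
        Matrix.mul_nonsing_inv _ ((Matrix.isUnit_iff_isUnit_det _).1 hU), Matrix.one_mul,
        Nat.sub_add_cancel hn, add_neg_cancel]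
  let V : Submodule ℂ (Fin T.h → ℂ) :=
    ⨅ i : Fin nq, LinearMap.ker (cx(T.C * T.A ^ (i : ℕ))).mulVecLin
  have hV : ∀ v, v ∈ V ↔ ∀ i < nq, cx(T.C * T.A ^ i) *ᵥ v = 0 := by
    intro v
    simp only [V, Submodule.mem_iInf, LinearMap.mem_ker, Matrix.mulVecLin_apply]
    exact ⟨fun h i hi => h ⟨i, hi⟩, fun h i => h i i.2⟩
  have hmaps : ∀ v ∈ V, cx(T.A + T.B * F).mulVecLin v ∈ V := by
    intro v hv
    rw [hV] at hv ⊢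
    intro i hi
    rw [Matrix.mulVecLin_apply, Matrix.mulVec_mulVec, ← Matrix.map_mul, hinv i hi]
    split_ifs with h
    · exact hv _ h
    · rw [Matrix.map_zero _ (map_zero _), Matrix.zero_mulVec]
  by_contra hx0
  have hxV : (fun i => (x i : ℂ)) ∈ V := by
    rw [hV]
    intro i hi
    rw [cx_mulVec_ofReal, hx i hi]
    funext j
    simp
  have hnt : Nontrivial V := by
    refine ⟨⟨_, hxV⟩, 0, fun h => hx0 ?_⟩
    funext i
    have := congrFun (congrArg Subtype.val h) i
    simpa using this
  obtain ⟨s, hs⟩ := Module.End.exists_eigenvalue (cx(T.A + T.B * F).mulVecLin.restrict hmaps)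
  obtain ⟨v, hv⟩ := hs.exists_hasEigenvector
  have h1 : cx(T.A + T.B * F) *ᵥ (v : Fin T.h → ℂ) = s • (v : Fin T.h → ℂ) :=
    congrArg Subtype.val hv.apply_eq_smul
  have h2 := (hV _).1 v.2 0 (by omega)
  have h3 := hT.mulVec_injective s (Sum.elim (v : Fin T.h → ℂ) (cx(F) *ᵥ (v : Fin T.h → ℂ)))
    (rosenbrock_mulVec_eq_zero_iff.2 ⟨by
      rw [← h1, Matrix.map_add _ (map_add _), Matrix.map_mul, Matrix.add_mulVec,
        Matrix.mulVec_mulVec], by simpa using h2⟩)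
  rw [← Sum.elim_zero_zero, Sum.elim_eq_iff] at h3
  exact hv.2 (Subtype.ext h3.1)

end Target

/-! ### Existence of a target model -/

section AdaptedBasis

variable {ι : Type*} [Fintype ι] [DecidableEq ι]

theorem exists_adapted_basis {a : ℕ} (O : Matrix ι (Fin a) ℝ)
    (hO : ∀ x : Fin a → ℝ, O *ᵥ x = 0 → x = 0) :
    ∃ (b : ℕ) (P : Matrix ι (Fin a ⊕ Fin b) ℝ) (Q : Matrix (Fin a ⊕ Fin b) ι ℝ),
      P * Q = 1 ∧ Q * P = 1 ∧ ∀ x, P *ᵥ Sum.elim x 0 = O *ᵥ x := by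
  obtain ⟨W, hW⟩ := (LinearMap.range O.mulVecLin).exists_isCompl
  have hinj : Function.Injective O.mulVecLin := (injective_iff_map_eq_zero _).2 hO
  let e : ((Fin a ⊕ Fin (Module.finrank ℝ W)) → ℝ) ≃ₗ[ℝ] (ι → ℝ) :=
    (LinearEquiv.sumArrowLequivProdArrow _ _ ℝ ℝ).trans
      (((LinearEquiv.ofInjective O.mulVecLin hinj).prodCongr
        (Module.finBasis ℝ W).equivFun.symm).trans (Submodule.prodEquivOfIsCompl _ _ hW))
  refine ⟨_, LinearMap.toMatrix' e.toLinearMap, LinearMap.toMatrix' e.symm.toLinearMap, ?_, ?_,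
    fun x => ?_⟩
  · rw [← LinearMap.toMatrix'_comp]
    simp [← LinearMap.toMatrix'_id]
  · rw [← LinearMap.toMatrix'_comp]
    simp [← LinearMap.toMatrix'_id]
  · rw [LinearMap.toMatrix'_mulVec]
    change e (Sum.elim x 0) = O *ᵥ x
    have h1 : (LinearEquiv.sumArrowLequivProdArrow (Fin a) (Fin (Module.finrank ℝ W)) ℝ ℝ)
        (Sum.elim x 0) = (x, 0) := rfl
    simp only [e, LinearEquiv.trans_apply, h1, LinearEquiv.prodCongr_apply, map_zero,
      Submodule.coe_prodEquivOfIsCompl', ZeroMemClass.coe_zero, add_zero]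
    rfl

omit [DecidableEq ι] in
theorem blockTriangular_of_adapted {a b : ℕ} {A : Matrix ι ι ℝ} {O : Matrix ι (Fin a) ℝ}
    {A₁ : Matrix (Fin a) (Fin a) ℝ} (hA : A * O = O * A₁) {P : Matrix ι (Fin a ⊕ Fin b) ℝ}
    {Q : Matrix (Fin a ⊕ Fin b) ι ℝ} (hQP : Q * P = 1) (hP : ∀ x, P *ᵥ Sum.elim x 0 = O *ᵥ x) :
    Q * A * P = fromBlocks A₁ (Q * A * P).toBlocks₁₂ 0 (Q * A * P).toBlocks₂₂ := by
  have key : ∀ x : Fin a → ℝ, (Q * A * P) *ᵥ Sum.elim x 0 = Sum.elim (A₁ *ᵥ x) 0 := by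
    intro x
    rw [← Matrix.mulVec_mulVec, hP, Matrix.mulVec_mulVec, Matrix.mul_assoc, hA,
      ← Matrix.mulVec_mulVec, ← Matrix.mulVec_mulVec, ← hP, Matrix.mulVec_mulVec, hQP,
      Matrix.one_mulVec]
  have key' : ∀ j i, (Q * A * P) i (Sum.inl j)
      = Sum.elim (A₁ *ᵥ Pi.single j 1) (0 : Fin b → ℝ) i := by
    intro j i
    rw [← key, Sum.elim_single_zero, Matrix.mulVec_single_one, Matrix.col_apply]
  conv_lhs => rw [← Matrix.fromBlocks_toBlocks (Q * A * P)]
  congr 1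
  · ext i j
    rw [Matrix.toBlocks₁₁, Matrix.of_apply, key', Sum.elim_inl, Matrix.mulVec_single_one,
      Matrix.col_apply]
  · ext i j
    rw [Matrix.toBlocks₂₁, Matrix.of_apply, key', Sum.elim_inr, Pi.zero_apply, Matrix.zero_apply]

/-- In a basis adapted to the range of O, the matrix is block triangular with the diagonal block A_r
and a second block that is nilpotent, since A ^ n maps everything into that range. -/
theorem charpoly_eq_mul_X_pow {r : ℕ} {A : Matrix ι ι ℝ} {O : Matrix ι (Fin r) ℝ}
    {Ar : Matrix (Fin r) (Fin r) ℝ} (hO : ∀ x : Fin r → ℝ, O *ᵥ x = 0 → x = 0)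
    (hA : A * O = O * Ar) {n : ℕ} (hn : ∀ w, ∃ x, A ^ n *ᵥ w = O *ᵥ x) :
    ∃ e : ℕ, A.charpoly = Ar.charpoly * Polynomial.X ^ e := by
  obtain ⟨b, P, Q, hPQ, hQP, hP⟩ := exists_adapted_basis O hO
  have hblock := blockTriangular_of_adapted hA hQP hP
  set N := (Q * A * P).toBlocks₂₂ with hN
  have hpow : ∀ k, (Q * A * P) ^ k = Q * A ^ k * P := by
    intro k
    induction k with
    | zero => rw [pow_zero, pow_zero, Matrix.mul_one, hQP]
    | succ k ih =>
      rw [pow_succ, ih, pow_succ]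
      calc Q * A ^ k * P * (Q * A * P) = Q * A ^ k * (P * Q) * A * P := by
            simp only [Matrix.mul_assoc]
        _ = Q * (A ^ k * A) * P := by rw [hPQ, Matrix.mul_one, Matrix.mul_assoc Q]
  have hNpow : ∀ k (x : Fin b → ℝ), ((Q * A * P) ^ k *ᵥ Sum.elim 0 x) ∘ Sum.inr = N ^ k *ᵥ x := by
    intro k x
    induction k with
    | zero => simp
    | succ k ih =>
      rw [pow_succ', ← Matrix.mulVec_mulVec, hblock, Matrix.fromBlocks_mulVec, ← hblock,
        Sum.elim_comp_inr, ih, Matrix.zero_mulVec, zero_add, pow_succ', Matrix.mulVec_mulVec]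
  have hnil : N ^ n = 0 := by
    refine Matrix.ext_of_mulVec_single fun i => ?_
    rw [← hNpow, hpow, ← Matrix.mulVec_mulVec, ← Matrix.mulVec_mulVec, Matrix.zero_mulVec]
    obtain ⟨x, hx⟩ := hn (P *ᵥ Sum.elim 0 (Pi.single i 1))
    rw [hx, ← hP, Matrix.mulVec_mulVec, hQP, Matrix.one_mulVec, Sum.elim_comp_inr]
  have hcN : N.charpoly = Polynomial.X ^ b := by
    have := (Matrix.isNilpotent_charpoly_sub_pow_of_isNilpotent ⟨n, hnil⟩).eq_zero
    rwa [Fintype.card_fin, sub_eq_zero] at this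
  -- P and Q have different index types, so the equality of their sizes is obtained from ranks; it
  -- cancels the powers of the variable in the characteristic polynomials of Q (A P) and (A P) Q.
  have hcard : Fintype.card (Fin r ⊕ Fin b) = Fintype.card ι := by
    have h1 := Matrix.rank_mul_le_left P Q
    have h2 := Matrix.rank_mul_le_left Q P
    rw [hPQ, Matrix.rank_one] at h1
    rw [hQP, Matrix.rank_one] at h2
    exact le_antisymm (h2.trans (Matrix.rank_le_card_width Q))
      (h1.trans (Matrix.rank_le_card_width P))
  refine ⟨b, ?_⟩
  have h1 := Matrix.charpoly_mul_comm' Q (A * P)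
  rw [Matrix.mul_assoc A, hPQ, Matrix.mul_one, hcard] at h1
  have h2 := mul_left_cancel₀ (pow_ne_zero _ Polynomial.X_ne_zero) h1
  rw [← h2, ← Matrix.mul_assoc, hblock, Matrix.charpoly_fromBlocks_zero₂₁, hcN]

end AdaptedBasis

/-- The infimum is attained only if the set is nonempty. The kernels decrease and stabilize by
finite dimension, and observability forces the stable value to be zero. -/
theorem eq_zero_of_observabilityIndex_le {p r n : ℕ} {Ar : Matrix (Fin r) (Fin r) ℝ}
    {Cr : Matrix (Fin p) (Fin r) ℝ} (hobs : Observable Cr Ar) (hn : observabilityIndex Cr Ar ≤ n)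
    {x : Fin r → ℝ} (hx : ∀ k < n, (Cr * Ar ^ k) *ᵥ x = 0) : x = 0 := by
  let V : ℕ → Submodule ℝ (Fin r → ℝ) := fun n => ⨅ k : Fin n, LinearMap.ker
    (Cr * Ar ^ (k : ℕ)).mulVecLin
  have hV : ∀ n v, v ∈ V n ↔ ∀ k < n, (Cr * Ar ^ k) *ᵥ v = 0 := by
    intro n v
    simp only [V, Submodule.mem_iInf, LinearMap.mem_ker, Matrix.mulVecLin_apply]
    exact ⟨fun h i hi => h ⟨i, hi⟩, fun h i => h i i.2⟩
  have hanti : Antitone V := fun m n hmn v hv => (hV _ _).2 fun k hk =>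
    (hV _ _).1 hv k (hk.trans_le hmn)
  obtain ⟨m, hm⟩ := IsArtinian.monotone_stabilizes ⟨fun n => OrderDual.toDual (V n), hanti⟩
  have hmem : m ∈ {n : ℕ | ∀ x : Fin r → ℝ, (∀ k < n, (Cr * Ar ^ k) *ᵥ x = 0) → x = 0} := by
    intro x hx
    refine hobs x fun k => ?_
    have h1 : x ∈ V m := (hV _ _).2 hx
    have h2 : V m = V (max m (k + 1)) := hm _ (le_max_left _ _)
    rw [h2, hV] at h1
    exact h1 k (by omega)
  exact Nat.sInf_mem ⟨m, hmem⟩ x fun k hk => hx k (lt_of_lt_of_le hk hn)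

/-! ### The target model as a shift register of output samples -/

section Companion

variable {p r nq : ℕ}

/-- The shift on windows of `nq` output samples. -/
def windowShift (p nq : ℕ) : (Fin nq × Fin p → ℝ) →ₗ[ℝ] (Fin nq × Fin p → ℝ) where
  toFun w ia := if h : (ia.1 : ℕ) + 1 < nq then w (⟨ia.1 + 1, h⟩, ia.2) else 0
  map_add' w w' := by
    funext ia
    simp only [Pi.add_apply]
    split_ifs <;> simp
  map_smul' c w := by
    funext ia
    simp only [Pi.smul_apply, RingHom.id_apply]
    split_ifs <;> simp

/-- The insertion of a new sample at the end of a window. -/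
def windowInsert (p nq : ℕ) : (Fin p → ℝ) →ₗ[ℝ] (Fin nq × Fin p → ℝ) where
  toFun u ia := if (ia.1 : ℕ) + 1 < nq then 0 else u ia.2
  map_add' w w' := by
    funext ia
    simp only [Pi.add_apply]
    split_ifs <;> simp
  map_smul' c w := by
    funext ia
    simp only [Pi.smul_apply, RingHom.id_apply]
    split_ifs <;> simp

/-- The windows whose samples from index `s` on are consistent with the exosystem. -/
def consistentWindows (Ar : Matrix (Fin r) (Fin r) ℝ) (Cr : Matrix (Fin p) (Fin r) ℝ) (nq s : ℕ) :
    Submodule ℝ (Fin nq × Fin p → ℝ) where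
  carrier := {w | ∃ x : Fin r → ℝ, ∀ k : Fin nq, ∀ a, s ≤ (k : ℕ) →
    w (k, a) = ((Cr * Ar ^ ((k : ℕ) - s)) *ᵥ x) a}
  add_mem' := by
    rintro w w' ⟨x, hx⟩ ⟨x', hx'⟩
    exact ⟨x + x', fun k a hk => by
      rw [Pi.add_apply, hx k a hk, hx' k a hk, Matrix.mulVec_add, Pi.add_apply]⟩
  zero_mem' := ⟨0, fun k a _ => by rw [Matrix.mulVec_zero]; rfl⟩
  smul_mem' := by
    rintro c w ⟨x, hx⟩
    exact ⟨c • x, fun k a hk => by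
      rw [Pi.smul_apply, hx k a hk, Matrix.mulVec_smul, Pi.smul_apply]⟩

/-- The windows consistent with the exosystem from index s on form an increasing chain, from the
exosystem windows (s = 0) to all windows (s = n_q). Appending the right next sample lowers s by one,
so the flag lemma gives a linear feedback after which every window is consistent within n_q steps.
Hence the eigenvalues added to those of A_r are zero. -/
theorem exists_window_feedback {Ar : Matrix (Fin r) (Fin r) ℝ} {Cr : Matrix (Fin p) (Fin r) ℝ}
    (hinj : ∀ x : Fin r → ℝ, (∀ k < nq, (Cr * Ar ^ k) *ᵥ x = 0) → x = 0) :
    ∃ (F : (Fin nq × Fin p → ℝ) →ₗ[ℝ] (Fin p → ℝ)) (O : Matrix (Fin nq × Fin p) (Fin r) ℝ),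
      (∀ x k a, (O *ᵥ x) (k, a) = ((Cr * Ar ^ (k : ℕ)) *ᵥ x) a) ∧
      (∀ x, windowShift p nq (O *ᵥ x) + windowInsert p nq (F (O *ᵥ x)) = O *ᵥ (Ar *ᵥ x)) ∧
      ∀ w, ∃ x, ((windowShift p nq + windowInsert p nq ∘ₗ F) ^ nq) w = O *ᵥ x := by
  let O : Matrix (Fin nq × Fin p) (Fin r) ℝ :=
    Matrix.of fun ka j => (Cr * Ar ^ (ka.1 : ℕ)) ka.2 j
  have hO : ∀ x k a, (O *ᵥ x) (k, a) = ((Cr * Ar ^ (k : ℕ)) *ᵥ x) a := fun _ _ _ => rfl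
  have hOinj : LinearMap.ker O.mulVecLin = ⊥ := by
    rw [LinearMap.ker_eq_bot']
    intro x hx
    refine hinj x fun k hk => funext fun a => ?_
    rw [← hO x ⟨k, hk⟩ a]
    exact congrFun hx _
  obtain ⟨L, hL⟩ := O.mulVecLin.exists_leftInverse_of_injective hOinj
  have hL' : ∀ x, L (O *ᵥ x) = x := fun x => LinearMap.congr_fun hL x
  -- On exosystem windows the appended sample is prescribed: a left inverse of O recovers x, whose
  -- next sample is C_r A_r ^ n_q x.
  let F₀ : (Fin nq × Fin p → ℝ) →ₗ[ℝ] (Fin p → ℝ) := (Cr * Ar ^ nq).mulVecLin ∘ₗ L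
  have hF₀ : ∀ x, windowShift p nq (O *ᵥ x) + windowInsert p nq (F₀ (O *ᵥ x))
      = O *ᵥ (Ar *ᵥ x) := by
    intro x
    funext ⟨k, a⟩
    have e : F₀ (O *ᵥ x) = (Cr * Ar ^ nq) *ᵥ x := by
      change (Cr * Ar ^ nq) *ᵥ (L (O *ᵥ x)) = _
      rw [hL']
    rw [hO, Matrix.mulVec_mulVec, Matrix.mul_assoc, ← pow_succ, e, Pi.add_apply]
    simp only [windowShift, windowInsert, LinearMap.coe_mk, AddHom.coe_mk]
    split_ifs with h
    · rw [add_zero, hO]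
    · have hk : (k : ℕ) + 1 = nq := by omega
      rw [zero_add, hk]
  have hX0 : ∀ w, w ∈ consistentWindows Ar Cr nq 0 ↔ ∃ x, w = O *ᵥ x := by
    intro w
    constructor
    · rintro ⟨x, hx⟩
      exact ⟨x, funext fun ka => hx ka.1 ka.2 (Nat.zero_le _)⟩
    · rintro ⟨x, rfl⟩
      exact ⟨x, fun k a _ => rfl⟩
  obtain ⟨F, hF0, hF⟩ := exists_linearMap_mapsTo_flag (windowShift p nq) (windowInsert p nq)
    (consistentWindows Ar Cr nq)
    (by
      rintro s w ⟨x, hx⟩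
      refine ⟨Ar *ᵥ x, fun k a hk => ?_⟩
      rw [hx k a (by omega), Matrix.mulVec_mulVec, Matrix.mul_assoc, ← pow_succ,
        show (k : ℕ) - s = k - (s + 1) + 1 by omega])
    F₀
    (fun w hw => by
      obtain ⟨x, rfl⟩ := (hX0 w).1 hw
      exact (hX0 _).2 ⟨_, hF₀ x⟩)
    (by
      rintro s w ⟨x, hx⟩
      -- After the shift, entry k ≥ s must be C_r A_r ^ (k - s) x; for the last entry k = nq - 1
      -- this is the appended sample.
      refine ⟨(Cr * Ar ^ (nq - 1 - s)) *ᵥ x, x, fun k a hk => ?_⟩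
      simp only [windowShift, windowInsert, LinearMap.coe_mk, AddHom.coe_mk, Pi.add_apply]
      split_ifs with h
      · rw [add_zero, hx _ _ (by simpa using hk)]
        simp
      · rw [zero_add, show (k : ℕ) = nq - 1 by omega])
    nq
  refine ⟨F, O, hO, fun x => ?_, fun w => ?_⟩
  · rw [hF0 _ ((hX0 _).2 ⟨x, rfl⟩), hF₀]
  · rw [← hX0]
    have key : ∀ t ≤ nq, ((windowShift p nq + windowInsert p nq ∘ₗ F) ^ t) w
        ∈ consistentWindows Ar Cr nq (nq - t) := by
      intro t
      induction t with
      | zero =>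
        intro _
        exact ⟨0, fun k a hk => by omega⟩
      | succ t ih =>
        intro ht
        rw [pow_succ', Module.End.mul_apply]
        refine hF (nq - (t + 1)) (by omega) _ ?_
        rw [show nq - (t + 1) + 1 = nq - t by omega]
        exact ih (by omega)
    simpa using key nq le_rfl

/-- Output is the first sample of the window, and inputs enter at the end. Thus C A ^ i reads sample
i, and the Markov parameters are 0, …, 0, I. Reading all samples identifies the state, so there are
no zeros. -/
theorem exists_targetModel {Ar : Matrix (Fin r) (Fin r) ℝ} {Cr : Matrix (Fin p) (Fin r) ℝ}
    (hnq : 1 ≤ nq) (hinj : ∀ x : Fin r → ℝ, (∀ k < nq, (Cr * Ar ^ k) *ᵥ x = 0) → x = 0) :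
    ∃ T : TargetModel p, T.Remodels Ar Cr nq := by
  obtain ⟨F, O, hO, hFO, hFn⟩ := exists_window_feedback hinj
  let A₀ : Matrix (Fin nq × Fin p) (Fin nq × Fin p) ℝ :=
    LinearMap.toMatrix' (windowShift p nq + windowInsert p nq ∘ₗ F)
  let B₀ : Matrix (Fin nq × Fin p) (Fin p) ℝ := LinearMap.toMatrix' (windowInsert p nq)
  let C₀ : Matrix (Fin p) (Fin nq × Fin p) ℝ :=
    LinearMap.toMatrix' (LinearMap.funLeft ℝ ℝ fun a => ((⟨0, hnq⟩ : Fin nq), a))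
  have hA₀ : ∀ w, A₀ *ᵥ w = windowShift p nq w + windowInsert p nq (F w) := fun w =>
    LinearMap.toMatrix'_mulVec _ _
  have hB₀ : ∀ u, B₀ *ᵥ u = windowInsert p nq u := fun u => LinearMap.toMatrix'_mulVec _ _
  have hC₀ : ∀ w a, (C₀ *ᵥ w) a = w (⟨0, hnq⟩, a) := fun w a => by
    rw [LinearMap.toMatrix'_mulVec]
    rfl
  have hpow : ∀ i k (h : k + i < nq) w a, (A₀ ^ i *ᵥ w) (⟨k, by omega⟩, a) = w (⟨k + i, h⟩, a) := by
    intro i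
    induction i with
    | zero => intro k h w a; simp
    | succ i ih =>
      intro k h w a
      rw [pow_succ', ← Matrix.mulVec_mulVec, hA₀, Pi.add_apply]
      have h1 : k + 1 < nq := by omega
      simp only [windowShift, windowInsert, LinearMap.coe_mk, AddHom.coe_mk, dif_pos h1, if_pos h1,
        add_zero]
      rw [ih (k + 1) (by omega) w a]
      congr 3
      omega
  have hCA : ∀ i (h : i < nq) w a, ((C₀ * A₀ ^ i) *ᵥ w) a = w (⟨i, h⟩, a) := by
    intro i h w a
    rw [← Matrix.mulVec_mulVec, hC₀, hpow i 0 (by omega)]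
    simp
  have hM : ∀ i, i + 1 < nq → C₀ * A₀ ^ i * B₀ = 0 := by
    intro i h
    refine Matrix.ext_of_mulVec_single fun j => funext fun a => ?_
    rw [← Matrix.mulVec_mulVec, hCA i (by omega), hB₀]
    simp [windowInsert, h]
  have hM1 : C₀ * A₀ ^ (nq - 1) * B₀ = 1 := by
    refine Matrix.ext_of_mulVec_single fun j => funext fun a => ?_
    rw [← Matrix.mulVec_mulVec, hCA (nq - 1) (by omega), hB₀, Matrix.one_mulVec]
    simp only [windowInsert, LinearMap.coe_mk, AddHom.coe_mk]
    rw [if_neg (by omega)]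
  have hAO : A₀ * O = O * Ar := by
    refine Matrix.ext_of_mulVec_single fun j => ?_
    rw [← Matrix.mulVec_mulVec, hA₀, hFO, Matrix.mulVec_mulVec]
  have hOinj : ∀ x : Fin r → ℝ, O *ᵥ x = 0 → x = 0 := by
    intro x hx
    refine hinj x fun k hk => funext fun a => ?_
    rw [← hO x ⟨k, hk⟩ a, hx]
    rfl
  have hcp := charpoly_eq_mul_X_pow hOinj hAO (n := nq) fun w => by
    obtain ⟨x, hx⟩ := hFn w
    refine ⟨x, ?_⟩
    rw [← hx]
    have : ∀ i, A₀ ^ i *ᵥ w = ((windowShift p nq + windowInsert p nq ∘ₗ F) ^ i) w := by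
      intro i
      induction i with
      | zero => simp
      | succ i ih =>
        rw [pow_succ', ← Matrix.mulVec_mulVec, ih, pow_succ', Module.End.mul_apply]
        exact hA₀ _
    exact this nq
  let e : Fin (nq * p) ≃ Fin nq × Fin p := finProdFinEquiv.symm
  have hApow : ∀ i, (A₀.submatrix e e) ^ i = (A₀ ^ i).submatrix e e := by
    intro i
    induction i with
    | zero => simp
    | succ i ih => rw [pow_succ, ih, Matrix.submatrix_mul_equiv, pow_succ]
  let T : TargetModel p := ⟨nq * p, A₀.submatrix e e, B₀.submatrix e id, C₀.submatrix id e⟩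
  have hTC : ∀ i, T.C * T.A ^ i = (C₀ * A₀ ^ i).submatrix id e := by
    intro i
    change C₀.submatrix id e * (A₀.submatrix e e) ^ i = _
    rw [hApow, Matrix.submatrix_mul_equiv]
  have hTM : ∀ i, T.C * T.A ^ i * T.B = C₀ * A₀ ^ i * B₀ := by
    intro i
    rw [hTC]
    change (C₀ * A₀ ^ i).submatrix id e * B₀.submatrix e id = _
    rw [Matrix.submatrix_mul_equiv, Matrix.submatrix_id_id]
  have hrank : UniformRank T.A T.B T.C nq :=
    ⟨hnq, fun k hk => by rw [hTM, hM k hk], by rw [hTM, hM1]; exact isUnit_one⟩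
  have hTinj : ∀ x : Fin T.h → ℝ, (∀ i < nq, (T.C * T.A ^ i) *ᵥ x = 0) → x = 0 := by
    intro x hx
    have h1 : x ∘ e.symm = 0 := by
      funext ⟨k, a⟩
      have h2 := congrFun (hx k k.2) a
      rw [hTC, Matrix.submatrix_mulVec_equiv] at h2
      exact (hCA k k.2 (x ∘ e.symm) a).symm.trans h2
    funext j
    have := congrFun h1 (e j)
    simpa using this
  have hros := rosenbrock_injective_of_uniformRank hrank hTinj
  refine ⟨T, ⟨fun x0 => ⟨(O *ᵥ x0) ∘ e, fun k => ?_⟩, ?_, hrank, fun s => ?_, ?_⟩⟩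
  · rw [Matrix.mulVec_mulVec, hTC, Matrix.submatrix_mulVec_equiv]
    have h1 : ((O *ᵥ x0) ∘ e) ∘ e.symm = O *ᵥ x0 := by
      funext j
      simp
    rw [h1, Function.comp_id]
    have h2 : A₀ ^ k * O = O * Ar ^ k := by
      induction k with
      | zero => simp
      | succ k ih => rw [pow_succ, Matrix.mul_assoc, hAO, ← Matrix.mul_assoc, ih, Matrix.mul_assoc,
          ← pow_succ]
    rw [Matrix.mulVec_mulVec, Matrix.mul_assoc, h2, ← Matrix.mulVec_mulVec]
    funext a
    rw [hC₀, ← Matrix.mulVec_mulVec, hO]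
    simp
  · obtain ⟨t, ht⟩ := (finite_eigenvalues T.A).infinite_compl.nonempty
    exact invertible_of_rosenbrock_injective ht (hros t)
  · exact not_isInvariantZero_of_injective (vecMul_injective_of_mulVec_injective (hros s))
  · obtain ⟨d, hd⟩ := hcp
    refine ⟨d, ?_⟩
    rw [← hd]
    exact Matrix.charpoly_reindex e.symm A₀

end Companion

/-! ### Finite impulse response realizations -/

/-- Substitution of `1 / z` for the variable of a polynomial. -/
abbrev atInv : Polynomial ℝ →+* RatFunc ℝ := Polynomial.eval₂RingHom RatFunc.C RatFunc.X⁻¹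

section Realization

variable {α β γ : Type*} [Fintype α] [DecidableEq α] [Fintype β] [Fintype γ]

omit [Fintype β] [Fintype γ] in
theorem transfer_submatrix {α' : Type*} [Fintype α'] [DecidableEq α'] (e : α' ≃ α)
    (A : Matrix α α ℝ) (B : Matrix α β ℝ) (C : Matrix γ α ℝ) (D : Matrix γ β ℝ) :
    transfer (A.submatrix e e) (B.submatrix e id) (C.submatrix id e) D = transfer A B C D := by
  have h1 : (RatFunc.X : RatFunc ℝ) • (1 : Matrix α' α' (RatFunc ℝ)) - rc(A.submatrix e e)
      = ((RatFunc.X : RatFunc ℝ) • (1 : Matrix α α (RatFunc ℝ)) - rc(A)).submatrix e e := by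
    ext i j
    simp [Matrix.one_apply]
  rw [transfer, h1, Matrix.inv_submatrix_equiv, ← Matrix.submatrix_map, ← Matrix.submatrix_map,
    Matrix.submatrix_mul_equiv, Matrix.submatrix_mul_equiv, Matrix.submatrix_id_id, transfer]

omit [Fintype β] [Fintype γ] in
theorem transfer_eq_add (A : Matrix α α ℝ) (B : Matrix α β ℝ) (C : Matrix γ α ℝ)
    (D : Matrix γ β ℝ) : transfer A B C D = transfer A B C 0 + rc(D) := by
  rw [transfer, transfer, Matrix.map_zero _ (map_zero _), add_zero]

theorem IsSchur.fromBlocks {α' : Type*} [Fintype α'] [DecidableEq α'] {A : Matrix α α ℝ}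
    {D : Matrix α' α' ℝ} (hA : IsSchur A) (hD : IsSchur D) (B : Matrix α α' ℝ) :
    IsSchur (fromBlocks A B 0 D) := by
  intro s hs
  obtain ⟨v, hv0, hv⟩ := mem_eigenvalues_iff_mulVec.1 hs
  by_contra hcon
  push Not at hcon
  obtain ⟨a, b, rfl⟩ : ∃ a b, v = Sum.elim a b := ⟨v ∘ Sum.inl, v ∘ Sum.inr,
    (Sum.elim_comp_inl_inr v).symm⟩
  have h0 : s • Sum.elim a b = Sum.elim (s • a) (s • b) := by
    funext i
    cases i <;> rfl
  rw [Matrix.fromBlocks_map, Matrix.fromBlocks_mulVec, h0, Sum.elim_eq_iff, Sum.elim_comp_inl,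
    Sum.elim_comp_inr, Matrix.map_zero _ (map_zero _), Matrix.zero_mulVec, zero_add] at hv
  have hb := hD.eq_zero_of_mulVec hcon hv.2
  subst hb
  rw [Matrix.mulVec_zero, add_zero] at hv
  have ha := hA.eq_zero_of_mulVec hcon hv.1
  subst ha
  exact hv0 Sum.elim_zero_zero

/-- Horner's scheme: W = W₀ + λ W₁ is realized by a delay register fed by a realization of W₁, plus
the feedthrough W₀. The state matrix is block triangular with nilpotent blocks, hence Schur stable.
The last property gives the response at any s ≠ 0 without a resolvent. -/
theorem exists_fir_realization [DecidableEq γ] (d : ℕ) (W : Matrix γ β (Polynomial ℝ))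
    (hW : ∀ i j n, d ≤ n → (W i j).coeff n = 0) :
    ∃ (n : ℕ) (A : Matrix (Fin n) (Fin n) ℝ) (B : Matrix (Fin n) β ℝ) (C : Matrix γ (Fin n) ℝ)
      (D : Matrix γ β ℝ), IsSchur A ∧ transfer A B C D = W.map atInv ∧
      ∀ (s : ℂ), s ≠ 0 → ∀ (x : Fin n → ℂ) (u : β → ℂ), s • x = cx(A) *ᵥ x + cx(B) *ᵥ u →
        cx(C) *ᵥ x + cx(D) *ᵥ u = W.map (evalC s⁻¹) *ᵥ u := by
  induction d generalizing W with
  | zero =>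
    have hW0 : W = 0 := by
      ext i j n
      simp [hW i j n (Nat.zero_le n)]
    subst hW0
    refine ⟨0, 0, 0, 0, 0, IsSchur.of_pow_eq_zero (n := 1) (by simp), ?_, fun s _ x u _ => ?_⟩
    · rw [transfer, Matrix.map_zero _ (map_zero _), Matrix.map_zero _ (map_zero _),
        Matrix.map_zero _ (map_zero _), Matrix.mul_zero, zero_add]
      ext i j
      simp
    · rw [Matrix.map_zero _ (map_zero _), Matrix.map_zero _ (map_zero _),
        Matrix.map_zero _ (map_zero _), Matrix.zero_mulVec, Matrix.zero_mulVec, add_zero]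
  | succ d ih =>
    let W₀ : Matrix γ β ℝ := W.map fun q => q.coeff 0
    let W₁ : Matrix γ β (Polynomial ℝ) := W.map Polynomial.divX
    have hWd : W = (Polynomial.X : Polynomial ℝ) • W₁ + W₀.map Polynomial.C := by
      ext1 i j
      simp only [W₁, W₀, Matrix.add_apply, Matrix.smul_apply, Matrix.map_apply, smul_eq_mul]
      exact (Polynomial.X_mul_divX_add _).symm
    obtain ⟨n, A, B, C, D, hA, htr, hev⟩ := ih W₁ fun i j k hk => by
      simp only [W₁, Matrix.map_apply, Polynomial.coeff_divX]
      exact hW i j (k + 1) (by omega)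
    let e : Fin (Fintype.card (γ ⊕ Fin n)) ≃ γ ⊕ Fin n := (Fintype.equivFin _).symm
    have hS : IsSchur (Matrix.fromBlocks (0 : Matrix γ γ ℝ) ((1 : Matrix γ γ ℝ) * C) 0 A) :=
      (IsSchur.of_pow_eq_zero (n := 1) (by simp)).fromBlocks hA _
    refine ⟨_, (Matrix.fromBlocks (0 : Matrix γ γ ℝ) ((1 : Matrix γ γ ℝ) * C) 0 A).submatrix e e,
      (fromRows ((1 : Matrix γ γ ℝ) * D) B).submatrix e id,
      (fromCols (1 : Matrix γ γ ℝ) 0).submatrix id e, W₀, hS.submatrix e, ?_, ?_⟩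
    · rw [transfer_submatrix, transfer_eq_add, transfer_cascade', htr]
      have h1 : transfer (0 : Matrix γ γ ℝ) (1 : Matrix γ γ ℝ) (1 : Matrix γ γ ℝ) 0
          = (RatFunc.X : RatFunc ℝ)⁻¹ • (1 : Matrix γ γ (RatFunc ℝ)) := by
        rw [transfer, Matrix.map_zero _ (map_zero _), Matrix.map_one _ (map_zero _) (map_one _),
          sub_zero, Matrix.one_mul, Matrix.mul_one, add_zero]
        refine Matrix.inv_eq_right_inv ?_
        rw [Matrix.smul_mul, Matrix.mul_smul, Matrix.one_mul, smul_smul,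
          mul_inv_cancel₀ RatFunc.X_ne_zero, one_smul]
      rw [h1, Matrix.smul_mul, Matrix.one_mul]
      conv_rhs => rw [hWd]
      ext i j
      simp
    · intro s hs x u hx
      set y := x ∘ e.symm with hy
      have hx' : x = y ∘ e := by
        funext i
        simp [hy]
      rw [← Matrix.submatrix_map, ← Matrix.submatrix_map, Matrix.submatrix_mulVec_equiv,
        ← hy] at hx
      have hx2 : s • y = cx(Matrix.fromBlocks (0 : Matrix γ γ ℝ) ((1 : Matrix γ γ ℝ) * C) 0 A) *ᵥ y
          + cx(fromRows ((1 : Matrix γ γ ℝ) * D) B) *ᵥ u := by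
        have := congrArg (fun z => z ∘ e.symm) hx
        beta_reduce at this
        funext i
        have h2 := congrFun this i
        simpa [hy, Matrix.submatrix, Matrix.mulVec, dotProduct] using h2
      obtain ⟨a, b, hab⟩ : ∃ a b, y = Sum.elim a b := ⟨y ∘ Sum.inl, y ∘ Sum.inr,
        (Sum.elim_comp_inl_inr y).symm⟩
      have hR : cx(fromRows ((1 : Matrix γ γ ℝ) * D) B) = fromRows cx(D) cx(B) := by
        ext i j
        cases i <;> simp
      have h0 : s • Sum.elim a b = Sum.elim (s • a) (s • b) := by
        funext i
        cases i <;> rfl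
      rw [hab, hR, Matrix.fromBlocks_map, Matrix.fromBlocks_mulVec, Matrix.fromRows_mulVec, h0,
        Matrix.map_zero _ (map_zero _), Matrix.map_zero _ (map_zero _), Matrix.zero_mulVec,
        Matrix.zero_mulVec, Matrix.one_mul, zero_add, zero_add, Sum.elim_comp_inr,
        ← Sum.elim_add_add, Sum.elim_eq_iff] at hx2
      have h3 := hev s hs b u hx2.2
      rw [h3] at hx2
      have h4 : cx((fromCols (1 : Matrix γ γ ℝ) (0 : Matrix γ (Fin n) ℝ)).submatrix id e) *ᵥ x
          = a := by
        rw [← Matrix.submatrix_map, Matrix.submatrix_mulVec_equiv, ← hy, hab]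
        have : cx(fromCols (1 : Matrix γ γ ℝ) (0 : Matrix γ (Fin n) ℝ)) = fromCols 1 0 := by
          ext i j
          cases j <;> simp [Matrix.one_apply, apply_ite]
        rw [this, Matrix.fromCols_mulVec_sumElim, Matrix.one_mulVec, Matrix.zero_mulVec, add_zero,
          Function.comp_id]
      have h5 : a = s⁻¹ • (W₁.map (evalC s⁻¹) *ᵥ u) := by
        rw [← hx2.1, smul_smul, inv_mul_cancel₀ hs, one_smul]
      rw [h4, h5, hWd, ← Matrix.smul_mulVec, ← Matrix.add_mulVec]
      congr 1
      ext i j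
      simp

theorem exists_fir [DecidableEq γ] (W : Matrix γ β (Polynomial ℝ)) :
    ∃ (n : ℕ) (A : Matrix (Fin n) (Fin n) ℝ) (B : Matrix (Fin n) β ℝ) (C : Matrix γ (Fin n) ℝ)
      (D : Matrix γ β ℝ), IsSchur A ∧ transfer A B C D = W.map atInv ∧
      ∀ (s : ℂ), s ≠ 0 → ∀ (x : Fin n → ℂ) (u : β → ℂ), s • x = cx(A) *ᵥ x + cx(B) *ᵥ u →
        cx(C) *ᵥ x + cx(D) *ᵥ u = W.map (evalC s⁻¹) *ᵥ u := by
  refine exists_fir_realization (∑ i, ∑ j, (W i j).natDegree + 1) W fun i j n hn => ?_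
  refine Polynomial.coeff_eq_zero_of_natDegree_lt (lt_of_lt_of_le (Nat.lt_succ_of_le ?_) hn)
  exact (Finset.single_le_sum (f := fun j => (W i j).natDegree) (fun _ _ => Nat.zero_le _)
    (Finset.mem_univ j)).trans (Finset.single_le_sum (f := fun i => ∑ j, (W i j).natDegree)
    (fun _ _ => Nat.zero_le _) (Finset.mem_univ i))

end Realization

/-! ### The Smith form of a polynomial matrix of full row rank -/

/-- The rectangular matrix with the given diagonal. -/
def rectDiagonal {R : Type*} [Zero R] (p m : ℕ) (a : Fin p → R) : Matrix (Fin p) (Fin m) R :=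
  Matrix.of fun i j => if (i : ℕ) = (j : ℕ) then a i else 0

section Smith

variable {R : Type*} [CommRing R] [IsDomain R] [IsPrincipalIdealRing R]

/-- The image of N has full rank, so there are a basis b' of the target and scalars a_i such that
the a_i b'_i form a basis of the image. Preimages of these form W, a basis of the kernel forms K,
and (W K) is unimodular with inverse made of Ξ and Z. Beyond the Smith form itself, N W = P diag(a)
and N W Ξ = N are kept: they express squaring down by W without loss of the image. -/
theorem exists_smith_form {p m : ℕ} (N : Matrix (Fin p) (Fin m) R) (Y : Matrix (Fin m) (Fin p) R)
    (b : R) (hb : b ≠ 0) (hY : N * Y = b • (1 : Matrix (Fin p) (Fin p) R)) :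
    p ≤ m ∧ ∃ (P P' : Matrix (Fin p) (Fin p) R) (V V' : Matrix (Fin m) (Fin m) R) (a : Fin p → R)
      (W : Matrix (Fin m) (Fin p) R) (Ξ : Matrix (Fin p) (Fin m) R),
      P * P' = 1 ∧ V * V' = 1 ∧ (∀ i, a i ≠ 0) ∧ N * W = P * Matrix.diagonal a ∧
      N * W * Ξ = N ∧ Ξ * W = 1 ∧ N = P * rectDiagonal p m a * V := by
  let f : (Fin m → R) →ₗ[R] (Fin p → R) := N.mulVecLin
  -- The image contains b R^p, because N Y = b I.
  have hrank : Module.finrank R (LinearMap.range f) = Module.finrank R (Fin p → R) := by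
    refine le_antisymm (Submodule.finrank_le _) ?_
    let g : (Fin p → R) →ₗ[R] LinearMap.range f :=
      LinearMap.codRestrict _ (LinearMap.lsmul R (Fin p → R) b) fun x => ⟨Y *ᵥ x, by
        change N *ᵥ (Y *ᵥ x) = b • x
        rw [Matrix.mulVec_mulVec, hY, Matrix.smul_mulVec, Matrix.one_mulVec]⟩
    refine LinearMap.finrank_le_finrank_of_injective (f := g) ?_
    intro x y hxy
    have h1 : b • x = b • y := congrArg Subtype.val hxy
    exact smul_right_injective _ hb h1
  obtain ⟨b', a, ab', hab⟩ := Submodule.exists_smith_normal_form_of_rank_eq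
    (Pi.basisFun R (Fin p)) hrank
  have ha : ∀ i, a i ≠ 0 := by
    intro i h0
    have h1 := hab i
    rw [h0, zero_smul] at h1
    exact ab'.ne_zero i (Subtype.ext h1)
  choose w hw using fun i => (ab' i).2
  obtain ⟨n, kb⟩ := Submodule.basisOfPid (Pi.basisFun R (Fin m)) (LinearMap.ker f)
  let P : Matrix (Fin p) (Fin p) R := Matrix.of fun i j => b' j i
  let P' : Matrix (Fin p) (Fin p) R := Matrix.of fun i j => b'.repr (Pi.single j 1) i
  let W : Matrix (Fin m) (Fin p) R := Matrix.of fun i j => w j i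
  let Ξ : Matrix (Fin p) (Fin m) R := Matrix.of fun i j => ab'.repr ⟨f (Pi.single j 1), _, rfl⟩ i
  let K : Matrix (Fin m) (Fin n) R := Matrix.of fun i j => (kb j : Fin m → R) i
  have hPP : P * P' = 1 := by
    refine Matrix.ext_of_mulVec_single fun j => ?_
    have h1 := b'.sum_repr (Pi.single j 1)
    rw [Matrix.one_mulVec, Matrix.mulVec_single_one]
    conv_rhs => rw [← h1]
    funext i
    simp [Matrix.col_apply, Matrix.mul_apply, P, P', mul_comm]
  have hNW : N * W = P * Matrix.diagonal a := by
    refine Matrix.ext_of_mulVec_single fun j => ?_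
    rw [Matrix.mulVec_single_one, Matrix.mulVec_single_one]
    funext i
    rw [Matrix.col_apply, Matrix.col_apply, Matrix.mul_diagonal]
    have h1 := congrFun ((hw j).trans (hab j)) i
    rw [Pi.smul_apply, smul_eq_mul, mul_comm] at h1
    exact h1
  have hNWΞ : N * W * Ξ = N := by
    refine Matrix.ext_of_mulVec_single fun j => ?_
    have h1 := congrArg Subtype.val (ab'.sum_repr ⟨f (Pi.single j 1), _, rfl⟩)
    have h2 : f (Pi.single j 1) = N *ᵥ Pi.single j 1 := rfl
    rw [← h2]
    refine Eq.trans ?_ h1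
    rw [Matrix.mul_assoc, ← Matrix.mulVec_mulVec, ← Matrix.mulVec_mulVec]
    have h3 : W *ᵥ (Ξ *ᵥ Pi.single j 1) = ∑ i, ab'.repr ⟨f (Pi.single j 1), _, rfl⟩ i • w i := by
      rw [Matrix.mulVec_single_one]
      funext k
      simp [Matrix.mulVec, dotProduct, W, Ξ, Matrix.col_apply, mul_comm]
    rw [h3]
    have h4 : ∀ x, N *ᵥ x = f x := fun _ => rfl
    rw [h4, map_sum, Submodule.coe_sum]
    refine Finset.sum_congr rfl fun i _ => ?_
    rw [map_smul, hw]
    rfl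
  have hNK : N * K = 0 := by
    refine Matrix.ext_of_mulVec_single fun j => ?_
    rw [Matrix.mulVec_single_one, Matrix.zero_mulVec]
    exact (kb j).2
  have hdet : (N * W).det ≠ 0 := by
    rw [hNW, Matrix.det_mul, Matrix.det_diagonal]
    refine mul_ne_zero (fun h => ?_) (Finset.prod_ne_zero_iff.2 fun i _ => ha i)
    have := congrArg Matrix.det hPP
    rw [Matrix.det_mul, h, zero_mul, Matrix.det_one] at this
    exact zero_ne_one this
  -- N W and K are cancellable on the left; this gives the remaining block identities between (W K)
  -- and its inverse.
  have hNWinj : ∀ {k : ℕ} (E : Matrix (Fin p) (Fin k) R), N * W * E = 0 → E = 0 := by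
    intro k E hE
    have h1 : (N * W).adjugate * (N * W * E) = 0 := by rw [hE, Matrix.mul_zero]
    rw [← Matrix.mul_assoc, Matrix.adjugate_mul, Matrix.smul_mul, Matrix.one_mul] at h1
    exact (smul_eq_zero.1 h1).resolve_left hdet
  have hKinj : ∀ {k : ℕ} (E : Matrix (Fin n) (Fin k) R), K * E = 0 → E = 0 := by
    intro k E hE
    refine Matrix.ext_of_mulVec_single fun j => ?_
    have h1 : K *ᵥ (E *ᵥ Pi.single j 1) = 0 := by
      rw [Matrix.mulVec_mulVec, hE, Matrix.zero_mulVec]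
    have h2 : ∑ i, (E *ᵥ Pi.single j 1) i • kb i = 0 := by
      apply Subtype.ext
      rw [Submodule.coe_sum]
      refine Eq.trans ?_ h1
      funext k
      simp [Matrix.mulVec, dotProduct, K, mul_comm]
    rw [Matrix.zero_mulVec]
    exact funext (Fintype.linearIndependent_iff.1 kb.linearIndependent _ h2)
  have hΞW : Ξ * W = 1 := by
    refine sub_eq_zero.1 (hNWinj _ ?_)
    rw [Matrix.mul_sub, ← Matrix.mul_assoc, hNWΞ, Matrix.mul_one, sub_self]
  have hΞK : Ξ * K = 0 := hNWinj _ (by rw [← Matrix.mul_assoc, hNWΞ, hNK])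
  have hmem : ∀ j, ((1 - W * Ξ) *ᵥ Pi.single j 1) ∈ LinearMap.ker f := by
    intro j
    change N *ᵥ _ = 0
    rw [Matrix.mulVec_mulVec, Matrix.mul_sub, Matrix.mul_one, ← Matrix.mul_assoc, hNWΞ, sub_self,
      Matrix.zero_mulVec]
  let Z : Matrix (Fin n) (Fin m) R := Matrix.of fun i j => kb.repr ⟨_, hmem j⟩ i
  have hKZ : W * Ξ + K * Z = 1 := by
    refine eq_sub_iff_add_eq'.1 (Matrix.ext_of_mulVec_single fun j => ?_)
    have h1 := congrArg Subtype.val (kb.sum_repr ⟨_, hmem j⟩)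
    refine Eq.trans ?_ h1
    rw [Submodule.coe_sum, Matrix.mulVec_single_one]
    funext k
    simp [Matrix.col_apply, Matrix.mul_apply, K, Z, mul_comm]
  have hZW : Z * W = 0 := hKinj _ (by
    have := congrArg (fun E => E * W) hKZ
    beta_reduce at this
    rw [Matrix.add_mul, Matrix.mul_assoc, hΞW, Matrix.mul_one, Matrix.one_mul,
      Matrix.mul_assoc] at this
    exact add_eq_left.1 this)
  have hZK : Z * K = 1 := by
    refine sub_eq_zero.1 (hKinj _ ?_)
    have := congrArg (fun E => E * K) hKZ
    beta_reduce at this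
    rw [Matrix.add_mul, Matrix.mul_assoc, hΞK, Matrix.mul_zero, zero_add, Matrix.one_mul,
      Matrix.mul_assoc] at this
    rw [Matrix.mul_sub, this, Matrix.mul_one, sub_self]
  have hVV : fromCols W K * fromRows Ξ Z = 1 := by rw [Matrix.fromCols_mul_fromRows, hKZ]
  have hVV' : fromRows Ξ Z * fromCols W K = 1 := by
    rw [Matrix.fromRows_mul_fromCols, hΞW, hΞK, hZW, hZK, Matrix.fromBlocks_one]
  have hcard : m = p + n := by
    have := Matrix.square_of_invertible _ _ hVV hVV'
    simpa using this
  subst hcard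
  refine ⟨Nat.le_add_right p n, P, P', (fromRows Ξ Z).submatrix finSumFinEquiv.symm id,
    (fromCols W K).submatrix id finSumFinEquiv.symm, a, W, Ξ, hPP, ?_, ha, hNW, hNWΞ, hΞW, ?_⟩
  · rw [← Matrix.submatrix_mul _ _ _ id _ Function.bijective_id, hVV', Matrix.submatrix_one_equiv]
  · have h1 : rectDiagonal p (p + n) a
        = (fromCols (Matrix.diagonal a) (0 : Matrix (Fin p) (Fin n) R)).submatrix id
          finSumFinEquiv.symm := by
      ext i j
      refine Fin.addCases (fun j => ?_) (fun j => ?_) j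
      · by_cases h : i = j
        · subst h; simp [rectDiagonal]
        · simp [rectDiagonal, h, Fin.ext_iff.not.1 h]
      · have : (i : ℕ) ≠ p + j := by omega
        simp [rectDiagonal, this]
    rw [h1, Matrix.mul_assoc, Matrix.submatrix_mul_equiv, Matrix.submatrix_id_id,
      Matrix.fromCols_mul_fromRows, Matrix.zero_mul, add_zero, ← Matrix.mul_assoc, ← hNW, hNWΞ]

end Smith

/-! ### Proper rational functions -/

theorem atInv_X : atInv Polynomial.X = (RatFunc.X : RatFunc ℝ)⁻¹ := by
  simp

theorem atInv_C (c : ℝ) : atInv (Polynomial.C c) = RatFunc.C c := by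
  simp

theorem algebraMap_eq_mul_atInv_reflect {p : Polynomial ℝ} {d : ℕ} (hp : p.natDegree ≤ d) :
    algebraMap (Polynomial ℝ) (RatFunc ℝ) p
      = (RatFunc.X : RatFunc ℝ) ^ d * atInv (Polynomial.reflect d p) := by
  let _ : _root_.Invertible (RatFunc.X : RatFunc ℝ) := invertibleOfNonzero RatFunc.X_ne_zero
  have h1 := Polynomial.eval₂_reflect_mul_pow (RatFunc.C : ℝ →+* RatFunc ℝ) RatFunc.X d p hp
  have h2 : algebraMap (Polynomial ℝ) (RatFunc ℝ)
      = Polynomial.eval₂RingHom RatFunc.C RatFunc.X := by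
    refine Polynomial.ringHom_ext (fun a => ?_) ?_
    · simp
    · simp
  rw [h2, Polynomial.coe_eval₂RingHom, ← h1, invOf_eq_inv, mul_comm]
  rfl

theorem atInv_injective : Function.Injective atInv := by
  refine (injective_iff_map_eq_zero _).2 fun p hp => ?_
  have hr : (Polynomial.reflect p.natDegree p).natDegree ≤ p.natDegree := by
    rw [Polynomial.natDegree_le_iff_coeff_eq_zero]
    intro n hn
    rw [Polynomial.coeff_reflect, Polynomial.revAt_eq_self_of_lt hn]
    exact Polynomial.coeff_eq_zero_of_natDegree_lt hn
  have h1 := algebraMap_eq_mul_atInv_reflect hr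
  rw [Polynomial.reflect_reflect, hp, mul_zero] at h1
  have h2 := RatFunc.algebraMap_injective ℝ (h1.trans (map_zero _).symm)
  rwa [Polynomial.reflect_eq_zero_iff] at h2

/-- The ring of proper rational functions. -/
def properSubring : Subring (RatFunc ℝ) where
  carrier := {f | f.intDegree ≤ 0}
  mul_mem' {f g} hf hg := by
    rcases eq_or_ne f 0 with rfl | hf0
    · simp
    rcases eq_or_ne g 0 with rfl | hg0
    · simp
    rw [Set.mem_ofPred_eq] at *
    rw [RatFunc.intDegree_mul hf0 hg0]
    omega
  one_mem' := by simp
  add_mem' {f g} hf hg := by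
    rcases eq_or_ne g 0 with rfl | hg0
    · simpa using hf
    rcases eq_or_ne (f + g) 0 with h0 | h0
    · simp [h0]
    exact (RatFunc.intDegree_add_le hg0 h0).trans (max_le hf hg)
  zero_mem' := by simp
  neg_mem' {f} hf := by
    rw [Set.mem_ofPred_eq] at *
    rwa [RatFunc.intDegree_neg]

theorem mem_properSubring {f : RatFunc ℝ} : f ∈ properSubring ↔ f.intDegree ≤ 0 := Iff.rfl

theorem C_mem_properSubring (c : ℝ) : (RatFunc.C c : RatFunc ℝ) ∈ properSubring := by
  rw [mem_properSubring, RatFunc.intDegree_C]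

theorem X_inv_mem_properSubring : (RatFunc.X : RatFunc ℝ)⁻¹ ∈ properSubring := by
  rw [mem_properSubring, RatFunc.intDegree_inv, RatFunc.intDegree_X]
  norm_num

theorem atInv_mem_properSubring (p : Polynomial ℝ) : atInv p ∈ properSubring := by
  induction p using Polynomial.induction_on' with
  | add p q hp hq =>
    rw [map_add]
    exact add_mem hp hq
  | monomial n a =>
    rw [Polynomial.coe_eval₂RingHom, Polynomial.eval₂_monomial]
    exact mul_mem (C_mem_properSubring a) (pow_mem X_inv_mem_properSubring n)

theorem eq_zero_of_X_mul_mem_properSubring {c : ℝ}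
    (h : (RatFunc.X : RatFunc ℝ) * RatFunc.C c ∈ properSubring) : c = 0 := by
  by_contra hc
  rw [mem_properSubring, RatFunc.intDegree_mul RatFunc.X_ne_zero
    ((map_ne_zero _).2 hc), RatFunc.intDegree_X, RatFunc.intDegree_C] at h
  norm_num at h

theorem X_mul_mem_properSubring {f : RatFunc ℝ} (hf : f.intDegree < 0) :
    (RatFunc.X : RatFunc ℝ) * f ∈ properSubring := by
  rcases eq_or_ne f 0 with rfl | hf0
  · simp
  rw [mem_properSubring, RatFunc.intDegree_mul RatFunc.X_ne_zero hf0, RatFunc.intDegree_X]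
  omega

/-- If p(1/z) had negative degree, z p(1/z) would be proper, and subtracting a polynomial in 1/z
would make z p(0) proper, which forces p(0) = 0. -/
theorem atInv_inv_mem_properSubring {p : Polynomial ℝ} (hp : p.coeff 0 ≠ 0) :
    (atInv p)⁻¹ ∈ properSubring := by
  rw [mem_properSubring, RatFunc.intDegree_inv]
  by_contra hcon
  have h1 := X_mul_mem_properSubring (f := atInv p) (by omega)
  have h2 : (RatFunc.X : RatFunc ℝ) * RatFunc.C (p.coeff 0)
      = RatFunc.X * atInv p - atInv p.divX := by
    conv_rhs => rw [← Polynomial.X_mul_divX_add p]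
    rw [map_add, map_mul, atInv_X, atInv_C, mul_add, mul_inv_cancel_left₀ RatFunc.X_ne_zero,
      Polynomial.divX_add, Polynomial.divX_C, add_zero]
    have : (Polynomial.X * p.divX).divX = p.divX := by
      ext n
      simp [Polynomial.coeff_divX]
    rw [this, add_sub_cancel_left]
  refine hp (eq_zero_of_X_mul_mem_properSubring ?_)
  rw [h2]
  exact sub_mem h1 (atInv_mem_properSubring _)

/-- Reflecting numerator and denominator at the degree of the denominator rewrites the fraction in
1/z; the new constant coefficient is the old leading one. -/
theorem exists_atInv_div {f : RatFunc ℝ} (hf : f ∈ properSubring) :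
    ∃ e d : Polynomial ℝ, d.coeff 0 ≠ 0 ∧ f * atInv d = atInv e := by
  have hd0 := f.denom_ne_zero
  have hN : f.num.natDegree ≤ f.denom.natDegree := by
    rw [mem_properSubring, RatFunc.intDegree] at hf
    omega
  refine ⟨Polynomial.reflect f.denom.natDegree f.num,
    Polynomial.reflect f.denom.natDegree f.denom, ?_, ?_⟩
  · rw [Polynomial.coeff_reflect, Polynomial.revAt_zero]
    exact fun h => hd0 (Polynomial.leadingCoeff_eq_zero.1 h)
  · have h1 : f * algebraMap (Polynomial ℝ) (RatFunc ℝ) f.denom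
        = algebraMap (Polynomial ℝ) (RatFunc ℝ) f.num := by
      refine (eq_div_iff ?_).1 (RatFunc.num_div_denom f).symm
      exact ((map_ne_zero_iff _ (RatFunc.algebraMap_injective ℝ)).2 hd0)
    rw [algebraMap_eq_mul_atInv_reflect le_rfl, algebraMap_eq_mul_atInv_reflect hN,
      mul_left_comm] at h1
    exact mul_left_cancel₀ (pow_ne_zero _ RatFunc.X_ne_zero) h1

/-- The Taylor expansion at infinity in powers of 1/z, with a proper remainder. -/
theorem exists_truncation {f : RatFunc ℝ} (hf : f ∈ properSubring) (k : ℕ) :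
    ∃ (q : Polynomial ℝ) (g : RatFunc ℝ), g ∈ properSubring ∧
      f = atInv q + ((RatFunc.X : RatFunc ℝ)⁻¹) ^ k * g := by
  induction k with
  | zero => exact ⟨0, f, hf, by simp⟩
  | succ k ih =>
    obtain ⟨q, g, hg, rfl⟩ := ih
    obtain ⟨e, d, hd, hed⟩ := exists_atInv_div hg
    have hd0 : atInv d ≠ 0 := fun h => hd (by
      rw [atInv_injective (h.trans (map_zero _).symm), Polynomial.coeff_zero])
    -- The value of g at infinity.
    set c : ℝ := e.coeff 0 / d.coeff 0 with hc
    have h1 : Polynomial.X ∣ e - Polynomial.C c * d := by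
      rw [Polynomial.X_dvd_iff, Polynomial.coeff_sub, Polynomial.coeff_C_mul, hc,
        div_mul_cancel₀ _ hd, sub_self]
    obtain ⟨e', he'⟩ := h1
    refine ⟨q + Polynomial.X ^ k * Polynomial.C c, atInv e' * (atInv d)⁻¹,
      mul_mem (atInv_mem_properSubring _) (atInv_inv_mem_properSubring hd), ?_⟩
    have h2 := congrArg atInv he'
    rw [map_sub, map_mul, map_mul, ← hed, atInv_X, atInv_C] at h2
    have h3 : g = RatFunc.C c + (RatFunc.X : RatFunc ℝ)⁻¹ * (atInv e' * (atInv d)⁻¹) := by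
      rw [← mul_assoc, ← h2, sub_mul, mul_assoc, mul_assoc, mul_inv_cancel₀ hd0, mul_one,
        mul_one, add_sub_cancel]
    rw [map_add, map_mul, map_pow, atInv_X, atInv_C, add_assoc, add_right_inj, pow_succ,
      mul_assoc, ← mul_add, ← h3]

section Proper

variable {α β γ : Type*}

theorem isProper_iff_mem {U : Matrix α β (RatFunc ℝ)} :
    IsProper U ↔ ∀ i j, U i j ∈ properSubring := Iff.rfl

theorem IsProper.mul [Fintype β] {U : Matrix α β (RatFunc ℝ)} {V : Matrix β γ (RatFunc ℝ)}
    (hU : IsProper U) (hV : IsProper V) : IsProper (U * V) := fun i j => by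
  rw [Matrix.mul_apply]
  exact properSubring.sum_mem fun k _ => mul_mem (isProper_iff_mem.1 hU i k)
    (isProper_iff_mem.1 hV k j)

theorem IsProper.add {U V : Matrix α β (RatFunc ℝ)} (hU : IsProper U) (hV : IsProper V) :
    IsProper (U + V) := fun i j =>
  properSubring.add_mem (isProper_iff_mem.1 hU i j) (isProper_iff_mem.1 hV i j)

theorem IsProper.sub {U V : Matrix α β (RatFunc ℝ)} (hU : IsProper U) (hV : IsProper V) :
    IsProper (U - V) := fun i j =>
  properSubring.sub_mem (isProper_iff_mem.1 hU i j) (isProper_iff_mem.1 hV i j)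

theorem IsProper.smul {U : Matrix α β (RatFunc ℝ)} {f : RatFunc ℝ} (hf : f ∈ properSubring)
    (hU : IsProper U) : IsProper (f • U) := fun i j =>
  properSubring.mul_mem hf (isProper_iff_mem.1 hU i j)

theorem isProper_atInv (W : Matrix α β (Polynomial ℝ)) : IsProper (W.map atInv) := fun i j =>
  atInv_mem_properSubring (W i j)

theorem isProper_C (D : Matrix α β ℝ) : IsProper (rc(D)) := fun i j =>
  C_mem_properSubring (D i j)

theorem isProper_diagonal [DecidableEq α] {d : α → RatFunc ℝ} (hd : ∀ i, d i ∈ properSubring) :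
    IsProper (Matrix.diagonal d) := fun i j => by
  rw [Matrix.diagonal_apply]
  split_ifs
  · exact hd i
  · exact properSubring.zero_mem

theorem eq_zero_of_X_smul_isProper {D : Matrix α β ℝ}
    (h : IsProper ((RatFunc.X : RatFunc ℝ) • rc(D))) : D = 0 := by
  ext i j
  exact eq_zero_of_X_mul_mem_properSubring (h i j)

theorem IsProper.exists_truncation {Q : Matrix α β (RatFunc ℝ)} (hQ : IsProper Q) (k : ℕ) :
    ∃ (F : Matrix α β (Polynomial ℝ)) (Q' : Matrix α β (RatFunc ℝ)), IsProper Q' ∧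
      Q = F.map atInv + ((RatFunc.X : RatFunc ℝ)⁻¹) ^ k • Q' := by
  choose F Q' h1 h2 using fun i j => MAS.exists_truncation (isProper_iff_mem.1 hQ i j) k
  exact ⟨Matrix.of F, Matrix.of Q', h1, Matrix.ext h2⟩

variable [Fintype α] [DecidableEq α] [Fintype β] [Fintype γ]

/-- The matrix `I - λ A`. -/
def revCharmatrix (A : Matrix α α ℝ) : Matrix α α (Polynomial ℝ) :=
  1 - (Polynomial.X : Polynomial ℝ) • A.map Polynomial.C

/-- `det (I - λ A)`. -/
def revCharpoly (A : Matrix α α ℝ) : Polynomial ℝ := (revCharmatrix A).det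

theorem revCharpoly_coeff_zero (A : Matrix α α ℝ) : (revCharpoly A).coeff 0 = 1 := by
  rw [Polynomial.coeff_zero_eq_eval_zero, revCharpoly, ← Polynomial.coe_evalRingHom,
    RingHom.map_det]
  have : (Polynomial.evalRingHom (0 : ℝ)).mapMatrix (revCharmatrix A) = 1 := by
    ext i j
    simp [revCharmatrix, Matrix.one_apply, apply_ite]
  rw [this, Matrix.det_one]

theorem atInv_revCharpoly_ne_zero (A : Matrix α α ℝ) : atInv (revCharpoly A) ≠ 0 := fun h => by
  have h1 := atInv_injective (h.trans (map_zero _).symm)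
  have h2 := revCharpoly_coeff_zero A
  rw [h1, Polynomial.coeff_zero] at h2
  exact zero_ne_one h2

/-- The numerator `C adj(I - λ A) λ B` of the transfer function matrix in the variable
`λ = 1 / z`. -/
def revNumerator (A : Matrix α α ℝ) (B : Matrix α β ℝ) (C : Matrix γ α ℝ) :
    Matrix γ β (Polynomial ℝ) :=
  C.map Polynomial.C * (revCharmatrix A).adjugate
    * ((Polynomial.X : Polynomial ℝ) • B.map Polynomial.C)

theorem X_sub_inv_eq (A : Matrix α α ℝ) :
    ((RatFunc.X : RatFunc ℝ) • (1 : Matrix α α (RatFunc ℝ)) - rc(A))⁻¹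
      = (RatFunc.X : RatFunc ℝ)⁻¹ • (atInv (revCharpoly A))⁻¹ •
        (revCharmatrix A).adjugate.map atInv := by
  refine Matrix.inv_eq_right_inv ?_
  have h1 : (RatFunc.X : RatFunc ℝ) • (1 : Matrix α α (RatFunc ℝ)) - rc(A)
      = (RatFunc.X : RatFunc ℝ) • (revCharmatrix A).map atInv := by
    ext i j
    simp only [revCharmatrix, Matrix.sub_apply, Matrix.smul_apply, Matrix.map_apply, map_sub,
      smul_eq_mul, map_mul, atInv_X, atInv_C, Matrix.one_apply, mul_sub,
      mul_inv_cancel_left₀ (RatFunc.X_ne_zero : (RatFunc.X : RatFunc ℝ) ≠ 0)]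
    rw [apply_ite atInv, map_one, map_zero]
  rw [h1, Matrix.smul_mul, Matrix.mul_smul, smul_smul, mul_inv_cancel₀ RatFunc.X_ne_zero, one_smul,
    Matrix.mul_smul, ← Matrix.map_mul, Matrix.mul_adjugate, ← revCharpoly]
  have h2 : (revCharpoly A • (1 : Matrix α α (Polynomial ℝ))).map atInv
      = atInv (revCharpoly A) • 1 := by
    ext i j
    simp only [Matrix.smul_apply, Matrix.map_apply, smul_eq_mul, map_mul, Matrix.one_apply]
    rw [apply_ite atInv, map_one, map_zero]
  rw [h2, smul_smul, inv_mul_cancel₀ (atInv_revCharpoly_ne_zero A), one_smul]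

omit [Fintype β] [Fintype γ] in
theorem transfer_eq_revNumerator (A : Matrix α α ℝ) (B : Matrix α β ℝ) (C : Matrix γ α ℝ) :
    transfer A B C 0 = (atInv (revCharpoly A))⁻¹ • (revNumerator A B C).map atInv := by
  have h1 : (C.map Polynomial.C).map atInv = rc(C) := by
    ext i j
    simp
  have h2 : ((Polynomial.X : Polynomial ℝ) • B.map Polynomial.C).map atInv
      = (RatFunc.X : RatFunc ℝ)⁻¹ • rc(B) := by
    ext i j
    simp only [Matrix.map_apply, Matrix.smul_apply, smul_eq_mul, map_mul, atInv_X, atInv_C]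
  rw [transfer, Matrix.map_zero _ (map_zero _), add_zero, X_sub_inv_eq, revNumerator,
    Matrix.map_mul, Matrix.map_mul, h1, h2, Matrix.mul_smul, Matrix.mul_smul, Matrix.mul_smul,
    Matrix.smul_mul, Matrix.smul_mul, smul_comm]

omit [Fintype β] [Fintype γ] in
theorem isProper_X_smul_transfer (A : Matrix α α ℝ) (B : Matrix α β ℝ) (C : Matrix γ α ℝ) :
    IsProper ((RatFunc.X : RatFunc ℝ) • transfer A B C 0) := by
  rw [transfer, Matrix.map_zero _ (map_zero _), add_zero, X_sub_inv_eq, Matrix.mul_smul,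
    Matrix.smul_mul, smul_smul, mul_inv_cancel₀ RatFunc.X_ne_zero, one_smul]
  refine ((isProper_C C).mul (IsProper.smul (atInv_inv_mem_properSubring ?_)
    (isProper_atInv _))).mul (isProper_C B)
  rw [revCharpoly_coeff_zero]
  exact one_ne_zero

omit [Fintype β] [Fintype γ] in
theorem X_smul_transfer (A : Matrix α α ℝ) (B : Matrix α β ℝ) (C : Matrix γ α ℝ) :
    (RatFunc.X : RatFunc ℝ) • transfer A B C 0 = rc(C * B) + transfer A B (C * A) 0 := by
  have h1 : ((RatFunc.X : RatFunc ℝ) • (1 : Matrix α α (RatFunc ℝ)) - rc(A))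
      * ((RatFunc.X : RatFunc ℝ) • (1 : Matrix α α (RatFunc ℝ)) - rc(A))⁻¹ = 1 :=
    Matrix.mul_nonsing_inv _ ((Matrix.isUnit_iff_isUnit_det _).1 (isUnit_X_sub A))
  rw [Matrix.sub_mul, Matrix.smul_mul, Matrix.one_mul, sub_eq_iff_eq_add] at h1
  rw [transfer, transfer, Matrix.map_zero _ (map_zero _), add_zero, add_zero, ← Matrix.smul_mul,
    ← Matrix.mul_smul, h1, Matrix.mul_add, Matrix.mul_one, Matrix.add_mul, ← Matrix.map_mul,
    ← Matrix.mul_assoc, ← Matrix.map_mul]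

omit [Fintype γ] [Fintype β] in
-- Multiplication by z splits off the first Markov parameter C B and replaces C by C A. Comparing
-- the parts that are not strictly proper determines C B, and induction on n determines the rest.
theorem markov_of_transfer [DecidableEq γ] {A : Matrix α α ℝ} {B : Matrix α γ ℝ}
    {C : Matrix γ α ℝ} {n : ℕ} (hn : 1 ≤ n) {V : Matrix γ γ (RatFunc ℝ)} (hV : IsProper V)
    (h : transfer A B C 0
      = ((RatFunc.X : RatFunc ℝ)⁻¹) ^ n • (1 + (RatFunc.X : RatFunc ℝ)⁻¹ • V)) :
    (∀ k, k + 1 < n → C * A ^ k * B = 0) ∧ C * A ^ (n - 1) * B = 1 := by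
  have hX : (RatFunc.X : RatFunc ℝ) ≠ 0 := RatFunc.X_ne_zero
  have hU : IsProper (1 + (RatFunc.X : RatFunc ℝ)⁻¹ • V) := by
    refine IsProper.add ?_ (IsProper.smul X_inv_mem_properSubring hV)
    rw [← Matrix.diagonal_one]
    exact isProper_diagonal fun _ => properSubring.one_mem
  induction n generalizing C with
  | zero => omega
  | succ n ih =>
    have h1 := X_smul_transfer A B C
    rw [h, smul_smul, pow_succ', mul_inv_cancel_left₀ hX] at h1
    have hT := isProper_X_smul_transfer A B (C * A)
    rcases Nat.eq_zero_or_pos n with rfl | hn0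
    · refine ⟨fun k hk => by omega, ?_⟩
      rw [pow_zero, one_smul] at h1
      have h2 : rc(C * B - 1) = (RatFunc.X : RatFunc ℝ)⁻¹ • V - transfer A B (C * A) 0 := by
        rw [Matrix.map_sub _ (map_sub _), Matrix.map_one _ (map_zero _) (map_one _),
          sub_eq_sub_iff_add_eq_add, add_comm _ (1 : Matrix γ γ (RatFunc ℝ)), h1]
      have h3 : C * B - 1 = 0 := by
        refine eq_zero_of_X_smul_isProper ?_
        rw [h2, smul_sub, smul_smul, mul_inv_cancel₀ hX, one_smul]
        exact hV.sub hT
      simpa using sub_eq_zero.1 h3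
    · have h2 : C * B = 0 := by
        refine eq_zero_of_X_smul_isProper ?_
        rw [eq_sub_of_add_eq h1.symm, smul_sub]
        refine IsProper.sub ?_ hT
        obtain ⟨k, rfl⟩ : ∃ k, n = k + 1 := ⟨n - 1, by omega⟩
        rw [smul_smul, pow_succ', mul_inv_cancel_left₀ hX]
        exact IsProper.smul (properSubring.pow_mem X_inv_mem_properSubring _) hU
      rw [h2, Matrix.map_zero _ (map_zero _), zero_add] at h1
      obtain ⟨h3, h4⟩ := ih hn0 h1.symm
      refine ⟨fun k hk => ?_, ?_⟩
      · rcases k with _ | k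
        · rw [pow_zero, Matrix.mul_one, h2]
        · rw [pow_succ', ← Matrix.mul_assoc]
          exact h3 k (by omega)
      · obtain ⟨k, rfl⟩ : ∃ k, n = k + 1 := ⟨n - 1, by omega⟩
        rw [Nat.add_sub_cancel] at h4 ⊢
        rw [pow_succ', ← Matrix.mul_assoc]
        exact h4

/-- The polynomial identity for the right inverse is carried from z to 1/z by reflecting all
coefficients at one common degree bound d. -/
theorem RightInvertible.exists_revNumerator_mul [DecidableEq γ] {A : Matrix α α ℝ}
    {B : Matrix α β ℝ} {C : Matrix γ α ℝ} (h : RightInvertible A B C 0) :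
    ∃ (Y : Matrix β γ (Polynomial ℝ)) (b : Polynomial ℝ), b ≠ 0 ∧
      revNumerator A B C * Y = b • (1 : Matrix γ γ (Polynomial ℝ)) := by
  obtain ⟨R, b, hb, hR⟩ := h.exists_polynomial
  have hc0 : algebraMap (Polynomial ℝ) (RatFunc ℝ) A.charpoly ≠ 0 :=
    (map_ne_zero_iff _ (RatFunc.algebraMap_injective ℝ)).2 A.charpoly_monic.ne_zero
  set d : ℕ := b.natDegree + ∑ i, ∑ j, ((A.charpoly • R) i j).natDegree with hd
  have hRd : ∀ i j, ((A.charpoly • R) i j).natDegree ≤ d := fun i j =>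
    ((Finset.single_le_sum (f := fun j => ((A.charpoly • R) i j).natDegree)
      (fun _ _ => Nat.zero_le _) (Finset.mem_univ j)).trans (Finset.single_le_sum
      (f := fun i => ∑ j, ((A.charpoly • R) i j).natDegree) (fun _ _ => Nat.zero_le _)
      (Finset.mem_univ i))).trans (Nat.le_add_left _ _)
  have hbd : b.natDegree ≤ d := Nat.le_add_right _ _
  refine ⟨(A.charpoly • R).map (Polynomial.reflect d), revCharpoly A * Polynomial.reflect d b,
    ?_, ?_⟩
  · refine mul_ne_zero (fun h => ?_) (fun h => hb (Polynomial.reflect_eq_zero_iff.1 h))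
    have := revCharpoly_coeff_zero A
    rw [h, Polynomial.coeff_zero] at this
    exact zero_ne_one this
  · have h1 : (RatFunc.X : RatFunc ℝ) ^ d • ((A.charpoly • R).map (Polynomial.reflect d)).map atInv
        = algebraMap (Polynomial ℝ) (RatFunc ℝ) A.charpoly • rf(R) := by
      ext1 i j
      have := algebraMap_eq_mul_atInv_reflect (hRd i j)
      rw [Matrix.smul_apply, smul_eq_mul, map_mul] at this
      exact this.symm
    have hb1 : ∀ q : Polynomial ℝ, rf(q • (1 : Matrix γ γ (Polynomial ℝ)))
        = algebraMap (Polynomial ℝ) (RatFunc ℝ) q • 1 := fun q => by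
      ext i j
      simp only [Matrix.smul_apply, Matrix.map_apply, smul_eq_mul, map_mul, Matrix.one_apply]
      rw [apply_ite (algebraMap (Polynomial ℝ) (RatFunc ℝ)), map_one, map_zero]
    have hb2 : ∀ q : Polynomial ℝ, (q • (1 : Matrix γ γ (Polynomial ℝ))).map atInv
        = atInv q • 1 := fun q => by
      ext i j
      simp only [Matrix.smul_apply, Matrix.map_apply, smul_eq_mul, map_mul, Matrix.one_apply]
      rw [apply_ite atInv, map_one, map_zero]
    have h2 : transfer A B C 0 * (algebraMap (Polynomial ℝ) (RatFunc ℝ) A.charpoly • rf(R))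
        = algebraMap (Polynomial ℝ) (RatFunc ℝ) b • 1 := by
      rw [Matrix.mul_smul, ← Matrix.smul_mul, charpoly_smul_transfer, ← Matrix.map_mul, hR, hb1]
    rw [← h1, transfer_eq_revNumerator, Matrix.mul_smul, Matrix.smul_mul, ← Matrix.map_mul,
      algebraMap_eq_mul_atInv_reflect hbd, mul_smul] at h2
    have h3 := smul_right_injective _ (pow_ne_zero d (RatFunc.X_ne_zero (K := ℝ))) h2
    rw [inv_smul_eq_iff₀ (atInv_revCharpoly_ne_zero A), smul_smul, ← map_mul, ← hb2] at h3
    exact Matrix.map_injective atInv_injective h3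

end Proper

/-! ### The infinite zero structure from the Smith form in `1 / z` -/

theorem isBiproper_atInv {p : ℕ} {P P' : Matrix (Fin p) (Fin p) (Polynomial ℝ)} (h : P * P' = 1) :
    IsBiproper (P.map atInv) :=
  ⟨isProper_atInv P, P'.map atInv, isProper_atInv P', by
    rw [← Matrix.map_mul, h, Matrix.map_one _ (map_zero _) (map_one _)]⟩

/-- The point z = ∞ is λ = 0. Unimodular matrices over polynomials in λ are biproper, and so are
factors that do not vanish at λ = 0; only the powers of λ remain. -/
theorem isInfiniteZeroStructure_of_smith {α : Type*} [Fintype α] [DecidableEq α] {p m : ℕ}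
    {A : Matrix α α ℝ} {B : Matrix α (Fin m) ℝ} {C : Matrix (Fin p) α ℝ} (hpm : p ≤ m)
    {P P' : Matrix (Fin p) (Fin p) (Polynomial ℝ)} (hP : P * P' = 1)
    {V V' : Matrix (Fin m) (Fin m) (Polynomial ℝ)} (hV : V * V' = 1) {f : Polynomial ℝ}
    (hf : f.coeff 0 ≠ 0) {q : Fin p → ℕ} {a : Fin p → Polynomial ℝ}
    (ha : ∀ i, (a i).coeff 0 ≠ 0)
    (hT : transfer A B C 0 = (atInv f)⁻¹ •
      (P * rectDiagonal p m (fun i => Polynomial.X ^ q i * a i) * V).map atInv) :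
    IsInfiniteZeroStructure A B C (List.ofFn q) := by
  refine ⟨by simp, by simpa using hpm, ?_⟩
  -- The biproper factors of the diagonal are absorbed on the side of the inputs, with 1 in the
  -- surplus columns.
  let d : Fin m → Polynomial ℝ := fun j => if h : (j : ℕ) < p then a ⟨j, h⟩ else 1
  have hd : ∀ j, (d j).coeff 0 ≠ 0 := fun j => by
    simp only [d]
    split_ifs
    · exact ha _
    · simp
  have hne : ∀ g : Polynomial ℝ, g.coeff 0 ≠ 0 → atInv g ≠ 0 := fun g hg h => hg (by
    rw [atInv_injective (h.trans (map_zero _).symm), Polynomial.coeff_zero])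
  refine ⟨P.map atInv, (atInv f)⁻¹ • (Matrix.diagonal (fun j => atInv (d j)) * V.map atInv),
    isBiproper_atInv hP, ⟨?_, atInv f • (V'.map atInv * Matrix.diagonal fun j => (atInv (d j))⁻¹),
    ?_, ?_⟩, ?_⟩
  · exact IsProper.smul (atInv_inv_mem_properSubring hf)
      ((isProper_diagonal fun j => atInv_mem_properSubring _).mul (isProper_atInv V))
  · exact IsProper.smul (atInv_mem_properSubring f)
      ((isProper_atInv V').mul (isProper_diagonal fun j => atInv_inv_mem_properSubring (hd j)))
  · rw [Matrix.smul_mul, Matrix.mul_smul, smul_smul, inv_mul_cancel₀ (hne f hf), one_smul,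
      Matrix.mul_assoc, ← Matrix.mul_assoc (V.map atInv), ← Matrix.map_mul, hV,
      Matrix.map_one _ (map_zero _) (map_one _), Matrix.one_mul, Matrix.diagonal_mul_diagonal,
      ← Matrix.diagonal_one]
    congr 1
    funext j
    exact mul_inv_cancel₀ (hne _ (hd j))
  · have h1 : (rectDiagonal p m fun i => Polynomial.X ^ q i * a i).map atInv
        = infinityForm p m (List.ofFn q) * Matrix.diagonal fun j => atInv (d j) := by
      ext1 i j
      rw [Matrix.mul_diagonal]
      simp only [rectDiagonal, infinityForm, Matrix.map_apply, Matrix.of_apply]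
      split_ifs with hij
      · have hj : (j : ℕ) < p := hij ▸ i.2
        have hi : (⟨(j : ℕ), hj⟩ : Fin p) = i := Fin.ext hij.symm
        simp only [d, hj, dif_pos, hi, map_mul, map_pow, atInv_X, List.getElem?_ofFn, Fin.is_lt,
          Fin.eta, Option.elim_some, inv_pow]
      · rw [map_zero, zero_mul]
    rw [hT, Matrix.map_mul, Matrix.map_mul, h1, Matrix.mul_smul, Matrix.mul_assoc, Matrix.mul_assoc,
      Matrix.mul_assoc]

/-! ### Squaring down by a finite impulse response pre-compensator -/

section SquaringDown

variable {α β γ : Type*} [Fintype α] [DecidableEq α] [Fintype β] [Fintype γ]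

omit [Fintype β] in
-- By the resolvent identity, output injection changes the numerator only by a factor on the left
-- and a nonzero scalar. Hence it preserves annihilation from the right.
theorem revCharpoly_smul_revNumerator_injection (A : Matrix α α ℝ) (B : Matrix α β ℝ)
    (C : Matrix γ α ℝ) (L : Matrix α γ ℝ) :
    ∃ E : Matrix γ γ (Polynomial ℝ),
      revCharpoly A • revNumerator (A + L * C) B C = E * revNumerator A B C := by
  classical
  set Δ := revCharmatrix A with hΔ
  set ΔL := revCharmatrix (A + L * C) with hΔL
  have h1 : Δ - ΔL = (Polynomial.X : Polynomial ℝ) • (L.map Polynomial.C * C.map Polynomial.C) := by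
    rw [hΔ, hΔL, revCharmatrix, revCharmatrix, Matrix.map_add _ (map_add _), smul_add,
      ← Matrix.map_mul]
    abel
  have h2 : revCharpoly A • ΔL.adjugate = revCharpoly (A + L * C) • Δ.adjugate
      + ΔL.adjugate * (Δ - ΔL) * Δ.adjugate := by
    rw [Matrix.mul_sub, Matrix.sub_mul, Matrix.mul_assoc, Matrix.mul_adjugate,
      Matrix.adjugate_mul, Matrix.mul_smul, Matrix.mul_one, Matrix.smul_mul, Matrix.one_mul,
      revCharpoly, revCharpoly]
    abel
  refine ⟨revCharpoly (A + L * C) • 1 + (Polynomial.X : Polynomial ℝ) •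
    (C.map Polynomial.C * ΔL.adjugate * L.map Polynomial.C), ?_⟩
  simp only [revNumerator]
  rw [← hΔ, ← hΔL, ← Matrix.smul_mul, ← Matrix.mul_smul, h2, h1]
  simp only [Matrix.mul_add, Matrix.add_mul, Matrix.smul_mul, Matrix.mul_smul, Matrix.one_mul,
    Matrix.mul_assoc]

/-- The input (I - W Ξ) u is invisible at the output. As s may be an eigenvalue of A, the state
response is computed for the stable A + L C instead. Its output still vanishes there, because the
numerator after injection also annihilates I - W Ξ, and on states with C x = 0 the injection acts
trivially. -/
theorem exists_mulVec_eq_of_squaring [DecidableEq β] {A : Matrix α α ℝ} {B : Matrix α β ℝ}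
    {C : Matrix γ α ℝ} (hdet : Detectable C A) {W : Matrix β γ (Polynomial ℝ)}
    {Ξ : Matrix γ β (Polynomial ℝ)}
    (hN : revNumerator A B C * W * Ξ = revNumerator A B C) {s : ℂ} (hs : 1 ≤ ‖s‖) (u : β → ℂ) :
    ∃ x : α → ℂ, s • x - cx(A) *ᵥ x
        = cx(B) *ᵥ (u - W.map (evalC s⁻¹) *ᵥ (Ξ.map (evalC s⁻¹) *ᵥ u)) ∧ cx(C) *ᵥ x = 0 := by
  obtain ⟨L, hL⟩ := hdet
  have hs0 : s ≠ 0 := fun h => by simp [h] at hs; linarith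
  have hsL : s ∉ eigenvalues (A + L * C) := fun h => absurd (hL s h) (not_lt.2 hs)
  set u' := u - W.map (evalC s⁻¹) *ᵥ (Ξ.map (evalC s⁻¹) *ᵥ u) with hu'
  obtain ⟨x, hx⟩ := exists_mulVec_of_notMem_eigenvalues hsL (cx(B) *ᵥ u')
  have h1 : revNumerator (A + L * C) B C * (1 - W * Ξ) = 0 := by
    obtain ⟨E, hE⟩ := revCharpoly_smul_revNumerator_injection A B C L
    have h2 : revCharpoly A • (revNumerator (A + L * C) B C * (1 - W * Ξ)) = 0 := by
      rw [← Matrix.smul_mul, hE, Matrix.mul_assoc, Matrix.mul_sub, Matrix.mul_one,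
        ← Matrix.mul_assoc, hN, sub_self, Matrix.mul_zero]
    refine (smul_eq_zero.1 h2).resolve_left fun h => ?_
    have := revCharpoly_coeff_zero A
    rw [h, Polynomial.coeff_zero] at this
    exact zero_ne_one this
  have hΔ : (revCharmatrix (A + L * C)).map (evalC s⁻¹) = s⁻¹ • (s • 1 - cx(A + L * C)) := by
    ext i j
    simp only [revCharmatrix, Matrix.sub_apply, Matrix.smul_apply, Matrix.map_apply, map_sub,
      smul_eq_mul, map_mul, Matrix.one_apply, mul_sub, inv_mul_cancel_left₀ hs0]
    rw [apply_ite (evalC s⁻¹), map_one, map_zero]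
    simp
  have hδ : evalC s⁻¹ (revCharpoly (A + L * C)) ≠ 0 := by
    rw [revCharpoly, RingHom.map_det, RingHom.mapMatrix_apply, hΔ, Matrix.det_smul]
    exact mul_ne_zero (pow_ne_zero _ (inv_ne_zero hs0)) fun h => hsL (mem_eigenvalues_iff_det.2 h)
  have hC : cx(C) *ᵥ x = 0 := by
    have h2 : ((revNumerator (A + L * C) B C) * (1 - W * Ξ)).map (evalC s⁻¹) *ᵥ u = 0 := by
      rw [h1, Matrix.map_zero _ (map_zero _), Matrix.zero_mulVec]
    have h3 : (1 - W * Ξ).map (evalC s⁻¹) *ᵥ u = u' := by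
      rw [Matrix.map_sub _ (map_sub _), Matrix.map_one _ (map_zero _) (map_one _),
        Matrix.sub_mulVec, Matrix.one_mulVec, Matrix.map_mul, ← Matrix.mulVec_mulVec]
    have h4 : (C.map Polynomial.C).map (evalC s⁻¹) = cx(C) := by
      ext i j
      simp
    have h5 : ((Polynomial.X : Polynomial ℝ) • B.map Polynomial.C).map (evalC s⁻¹)
        = s⁻¹ • cx(B) := by
      ext i j
      simp
      exact mul_comm _ _
    rw [Matrix.map_mul, ← Matrix.mulVec_mulVec, h3, revNumerator, Matrix.map_mul, Matrix.map_mul,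
      h4, h5, ← Matrix.mulVec_mulVec, Matrix.smul_mulVec, ← hx] at h2
    have h6 : s⁻¹ • (s • x - cx(A + L * C) *ᵥ x)
        = (revCharmatrix (A + L * C)).map (evalC s⁻¹) *ᵥ x := by
      rw [hΔ, Matrix.smul_mulVec, Matrix.sub_mulVec, Matrix.smul_mulVec, Matrix.one_mulVec]
    have h7 : (revCharmatrix (A + L * C)).adjugate.map (evalC s⁻¹)
        * (revCharmatrix (A + L * C)).map (evalC s⁻¹)
        = evalC s⁻¹ (revCharpoly (A + L * C)) • 1 := by
      rw [← Matrix.map_mul, Matrix.adjugate_mul, ← revCharpoly]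
      ext i j
      simp only [Matrix.smul_apply, Matrix.map_apply, smul_eq_mul, map_mul, Matrix.one_apply]
      rw [apply_ite (evalC s⁻¹), map_one, map_zero]
    rw [h6, Matrix.mulVec_mulVec, Matrix.mul_assoc, h7, Matrix.mul_smul, Matrix.mul_one,
      Matrix.smul_mulVec] at h2
    exact (smul_eq_zero.1 h2).resolve_left hδ
  refine ⟨x, ?_, hC⟩
  rw [← hx, Matrix.map_add _ (map_add _), Matrix.map_mul, Matrix.add_mulVec,
    ← Matrix.mulVec_mulVec, hC, Matrix.mulVec_zero, add_zero]

end SquaringDown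

/-! ### Pre-compensator I: squaring down without unstable zeros -/

section FirstPreCompensator

variable {α β γ κ : Type*} [Fintype α] [DecidableEq α] [Fintype β] [Fintype γ] [Fintype κ]
  [DecidableEq κ]

omit [Fintype α] [DecidableEq α] [Fintype β] in
theorem cx_fromRows {α' : Type*} (A : Matrix α β ℝ) (B : Matrix α' β ℝ) :
    cx(fromRows A B) = fromRows cx(A) cx(B) := by
  ext i j
  cases i <;> rfl

omit [Fintype α] [DecidableEq α] [Fintype β] in
theorem cx_fromCols {β' : Type*} (A : Matrix α β ℝ) (B : Matrix α β' ℝ) :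
    cx(fromCols A B) = fromCols cx(A) cx(B) := by
  ext i j
  cases j <;> rfl

theorem smul_sumElim {ι ι' : Type*} (s : ℂ) (a : ι → ℂ) (b : ι' → ℂ) :
    s • Sum.elim a b = Sum.elim (s • a) (s • b) := by
  funext i
  cases i <;> rfl

theorem vecMul_fromRows_sumElim {ι ι' ι'' : Type*} [Fintype ι] [Fintype ι'] (A : Matrix ι ι'' ℂ)
    (B : Matrix ι' ι'' ℂ) (a : ι → ℂ) (b : ι' → ℂ) :
    Sum.elim a b ᵥ* fromRows A B = a ᵥ* A + b ᵥ* B := by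
  rw [Matrix.vecMul_fromRows, Sum.elim_comp_inl, Sum.elim_comp_inr]

theorem detectable_of_fromBlocks {δ : Type*} [Fintype δ] [DecidableEq δ] {A : Matrix α α ℝ}
    {E : Matrix α δ ℝ} {S : Matrix δ δ ℝ} {C : Matrix γ α ℝ} {G : Matrix γ δ ℝ}
    (h : Detectable (fromCols C G) (fromBlocks A E 0 S)) : Detectable C A := by
  classical
  refine detectable_of_hautus fun s hs v hv hC => ?_
  have h1 : Sum.elim v (0 : δ → ℂ) = 0 := by
    refine h.hautus hs ?_ ?_
    · rw [Matrix.fromBlocks_map, Matrix.fromBlocks_mulVec, smul_sumElim, Sum.elim_comp_inl,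
        Sum.elim_comp_inr, Matrix.mulVec_zero, Matrix.mulVec_zero, add_zero, hv,
        Matrix.map_zero _ (map_zero _), Matrix.zero_mulVec, add_zero, smul_zero]
    · rw [cx_fromCols, Matrix.fromCols_mulVec_sumElim, hC, Matrix.mulVec_zero, add_zero]
  rw [← Sum.elim_zero_zero, Sum.elim_eq_iff] at h1
  exact h1.1

theorem Detectable.cascade {δ : Type*} [Fintype δ] [DecidableEq δ] {A : Matrix α α ℝ}
    {C : Matrix γ α ℝ} (h : Detectable C A) {S : Matrix δ δ ℝ} (hS : IsSchur S)
    (E : Matrix α δ ℝ) : Detectable (fromCols C (0 : Matrix γ δ ℝ)) (fromBlocks A E 0 S) := by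
  classical
  refine detectable_of_hautus fun s hs v hv hC => ?_
  obtain ⟨a, b, rfl⟩ : ∃ a b, v = Sum.elim a b := ⟨v ∘ Sum.inl, v ∘ Sum.inr,
    (Sum.elim_comp_inl_inr v).symm⟩
  rw [Matrix.fromBlocks_map, Matrix.fromBlocks_mulVec, smul_sumElim, Sum.elim_comp_inl,
    Sum.elim_comp_inr, Sum.elim_eq_iff, Matrix.map_zero _ (map_zero _), Matrix.zero_mulVec,
    zero_add] at hv
  have hb := hS.eq_zero_of_mulVec hs hv.2
  subst hb
  rw [Matrix.mulVec_zero, add_zero] at hv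
  rw [cx_fromCols, Matrix.fromCols_mulVec_sumElim, Matrix.mulVec_zero, add_zero] at hC
  rw [h.hautus hs hv.1 hC, Sum.elim_zero_zero]

omit [DecidableEq α] in
/-- A system that is cascaded with an asymptotically stable pre-compensator whose transfer function
matrix has the value `Ws` at `s`: a left null vector of the cascade annihilates `B Ws`. -/
theorem vecMul_mulVec_of_cascade {ε : Type*} [Fintype ε] {B : Matrix α β ℝ} {Aq : Matrix κ κ ℝ}
    {Bq : Matrix κ ε ℝ} {Cq : Matrix β κ ℝ} {Dq : Matrix β ε ℝ} (hAq : IsSchur Aq) {s : ℂ}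
    (hs : 1 ≤ ‖s‖) {Ws : Matrix β ε ℂ}
    (hW : ∀ x u, s • x = cx(Aq) *ᵥ x + cx(Bq) *ᵥ u → cx(Cq) *ᵥ x + cx(Dq) *ᵥ u = Ws *ᵥ u)
    {w₁ : α → ℂ} {w₂ : κ → ℂ} (h₁ : w₁ ᵥ* cx(B * Cq) + w₂ ᵥ* cx(Aq) = s • w₂)
    (h₂ : w₁ ᵥ* cx(B * Dq) + w₂ ᵥ* cx(Bq) = 0) (u : ε → ℂ) :
    w₁ ⬝ᵥ (cx(B) *ᵥ (Ws *ᵥ u)) = 0 := by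
  obtain ⟨x, hx⟩ := exists_mulVec_of_notMem_eigenvalues
    (fun h => absurd (hAq s h) (not_lt.2 hs)) (cx(Bq) *ᵥ u)
  rw [← hW x u (by rw [← hx]; abel)]
  have h3 := congrArg (fun y => y ⬝ᵥ x) h₁
  have h4 := congrArg (fun y => y ⬝ᵥ u) h₂
  beta_reduce at h3 h4
  rw [add_dotProduct, ← Matrix.dotProduct_mulVec, ← Matrix.dotProduct_mulVec, Matrix.map_mul,
    ← Matrix.mulVec_mulVec] at h3
  rw [add_dotProduct, ← Matrix.dotProduct_mulVec, ← Matrix.dotProduct_mulVec, Matrix.map_mul,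
    ← Matrix.mulVec_mulVec, zero_dotProduct] at h4
  rw [← hx, dotProduct_sub, dotProduct_smul] at h4
  rw [smul_dotProduct] at h3
  rw [Matrix.mulVec_add, dotProduct_add]
  linear_combination h3 + h4

/-- Null vector conditions are checked by pairing with inputs, because the responses of the cascade
are known only vector by vector. -/
theorem vecMul_eq_zero_of_dotProduct_mulVec {ι ι' : Type*} [Fintype ι] [Fintype ι'] {w : ι → ℂ}
    {B : Matrix ι ι' ℂ} (h : ∀ u, w ⬝ᵥ (B *ᵥ u) = 0) : w ᵥ* B = 0 := by
  refine dotProduct_eq_zero _ fun u => ?_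
  rw [← Matrix.dotProduct_mulVec]
  exact h u

variable {ε : Type*} [Fintype ε] {A : Matrix α α ℝ} {B : Matrix α β ℝ} {C : Matrix γ α ℝ}
  {Aq : Matrix κ κ ℝ} {Bq : Matrix κ ε ℝ} {Cq : Matrix β κ ℝ} {Dq : Matrix β ε ℝ}

omit [DecidableEq α] in
/-- A left null vector of the system matrix of the cascade comes from one of the given system. -/
theorem vecMul_of_cascade (hAq : IsSchur Aq) {s : ℂ} (hs : 1 ≤ ‖s‖) {Ws : Matrix β ε ℂ}
    (hW : ∀ x u, s • x = cx(Aq) *ᵥ x + cx(Bq) *ᵥ u → cx(Cq) *ᵥ x + cx(Dq) *ᵥ u = Ws *ᵥ u)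
    {Ξs : Matrix ε β ℂ} (hΞ : ∀ u, ∃ x : α → ℂ, s • x - cx(A) *ᵥ x
      = cx(B) *ᵥ (u - Ws *ᵥ (Ξs *ᵥ u)) ∧ cx(C) *ᵥ x = 0)
    {w₁ : α → ℂ} {w₂ : κ → ℂ} {c : γ → ℂ} (h₀ : w₁ ᵥ* cx(A) = s • w₁ + c ᵥ* cx(C))
    (h₁ : w₁ ᵥ* cx(B * Cq) + w₂ ᵥ* cx(Aq) = s • w₂)
    (h₂ : w₁ ᵥ* cx(B * Dq) + w₂ ᵥ* cx(Bq) = 0) : w₁ ᵥ* cx(B) = 0 ∧ (w₁ = 0 → w₂ = 0) := by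
  refine ⟨vecMul_eq_zero_of_dotProduct_mulVec fun u => ?_, fun h => ?_⟩
  · obtain ⟨x, hx, hCx⟩ := hΞ u
    have h3 := congrArg (fun y => y ⬝ᵥ x) h₀
    beta_reduce at h3
    rw [add_dotProduct, ← Matrix.dotProduct_mulVec, ← Matrix.dotProduct_mulVec, hCx,
      dotProduct_zero, add_zero, smul_dotProduct] at h3
    have h4 := congrArg (fun y => w₁ ⬝ᵥ y) hx
    beta_reduce at h4
    rw [dotProduct_sub, dotProduct_smul, h3, sub_self, Matrix.mulVec_sub, dotProduct_sub,
      vecMul_mulVec_of_cascade hAq hs hW h₁ h₂, sub_zero] at h4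
    exact h4.symm
  · subst h
    rw [Matrix.zero_vecMul, zero_add] at h₁
    exact hAq.eq_zero_of_vecMul hs h₁

end FirstPreCompensator

/-- Compensation by W replaces the numerator N by P diag(a). For ‖s‖ ≥ 1 a left null vector of the
cascade annihilates the range of B W and, by N W Ξ = N, that of B (I - W Ξ), hence that of B; it
therefore comes from the agent. The factor Q, which inverts the transfer matrix up to an n-fold
delay, is what the homogenization needs. -/
theorem AgentModel.Admissible.exists_first {p : ℕ} {M : AgentModel p} (hM : M.Admissible) :
    ∃ D : PreCompensators M, D.Step1 ∧
      ∀ n ∈ upperBounds (infiniteZeroOrders M.A M.B M.C),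
        ∃ Q : Matrix (Fin p) (Fin p) (RatFunc ℝ), IsProper Q ∧
          transfer D.cascA D.cascB D.cascC 0 * Q = ((RatFunc.X : RatFunc ℝ)⁻¹) ^ n • 1 := by
  obtain ⟨Y, b, hb, hY⟩ := hM.rightInvertible.exists_revNumerator_mul
  obtain ⟨hpm, P, P', V, V', a, W, Ξ, hP, hV, ha, hNW, hNWΞ, hΞW, hN⟩ :=
    exists_smith_form _ Y b hb hY
  -- The multiplicity of λ = 0 in the i-th invariant factor is the i-th infinite zero order.
  choose a' ha' hX using fun i => Polynomial.exists_eq_pow_rootMultiplicity_mul_and_not_dvd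
    (a i) (ha i) 0
  set q : Fin p → ℕ := fun i => (a i).rootMultiplicity 0 with hq
  simp only [map_zero, sub_zero] at ha' hX
  have ha0 : ∀ i, (a' i).coeff 0 ≠ 0 := fun i h => hX i (Polynomial.X_dvd_iff.2 h)
  have haq : a = fun i => Polynomial.X ^ q i * a' i := funext ha'
  obtain ⟨nκ, Aq, Bq, Cq, Dq, hAq, htr, hev⟩ := exists_fir W
  -- The data of pre-compensators II and III are placeholders; `Step1` involves only I.
  let D : PreCompensators M :=
    { nq := nκ, Aq := Aq, Bq := Bq, Cq := Cq, Dq := Dq, Pi := 0, Gam := 0, Bp := 0, Dp := 0,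
      nh := 0, Ah := 0, Bh := 0, Eh := 0, Ch := 0, Dh := 0, Fh := 0 }
  have hδ : (revCharpoly M.A).coeff 0 ≠ 0 := by
    rw [revCharpoly_coeff_zero]
    exact one_ne_zero
  have hδ0 := atInv_revCharpoly_ne_zero M.A
  have hT : transfer D.cascA D.cascB D.cascC 0
      = (atInv (revCharpoly M.A))⁻¹ • (P * Matrix.diagonal a).map atInv := by
    have := transfer_cascade' M.A M.B M.C Aq Bq Cq Dq
    rw [htr, transfer_eq_revNumerator M.A M.B M.C, Matrix.smul_mul, ← Matrix.map_mul, hNW] at this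
    exact this
  have hdiag : ∀ d : Fin p → Polynomial ℝ, (Matrix.diagonal d).map atInv
      = Matrix.diagonal fun i => atInv (d i) := fun d => by
    rw [Matrix.diagonal_map (map_zero _)]
  have hinf : IsInfiniteZeroStructure M.A M.B M.C (List.ofFn q) := by
    refine isInfiniteZeroStructure_of_smith hpm hP hV hδ ha0 ?_
    rw [transfer_eq_revNumerator, hN, haq]
  have hQ : ∀ n ∈ upperBounds (infiniteZeroOrders M.A M.B M.C),
      ∃ Q : Matrix (Fin p) (Fin p) (RatFunc ℝ), IsProper Q ∧
        transfer D.cascA D.cascB D.cascC 0 * Q = ((RatFunc.X : RatFunc ℝ)⁻¹) ^ n • 1 := by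
    intro n hn
    have hqn : ∀ i, q i ≤ n := fun i => hn ⟨_, hinf, List.mem_ofFn.2 ⟨i, rfl⟩⟩
    refine ⟨atInv (revCharpoly M.A) • (Matrix.diagonal (fun i =>
      ((RatFunc.X : RatFunc ℝ)⁻¹) ^ (n - q i) * (atInv (a' i))⁻¹) * P'.map atInv), ?_, ?_⟩
    · refine IsProper.smul (atInv_mem_properSubring _) ((isProper_diagonal fun i => ?_).mul
        (isProper_atInv _))
      exact mul_mem (pow_mem X_inv_mem_properSubring _) (atInv_inv_mem_properSubring (ha0 i))
    · have h1 : Matrix.diagonal (fun i => atInv (a i)) * Matrix.diagonal (fun i =>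
          ((RatFunc.X : RatFunc ℝ)⁻¹) ^ (n - q i) * (atInv (a' i))⁻¹)
          = ((RatFunc.X : RatFunc ℝ)⁻¹) ^ n • 1 := by
        rw [Matrix.diagonal_mul_diagonal, ← Matrix.diagonal_one, ← Matrix.diagonal_smul]
        congr 1
        funext i
        have h2 : atInv (a' i) ≠ 0 := fun h => ha0 i (by
          rw [atInv_injective (h.trans (map_zero _).symm), Polynomial.coeff_zero])
        rw [haq, map_mul, map_pow, atInv_X, Pi.smul_apply, smul_eq_mul, mul_one]
        calc _ = ((RatFunc.X : RatFunc ℝ)⁻¹ ^ q i * (RatFunc.X : RatFunc ℝ)⁻¹ ^ (n - q i))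
              * (atInv (a' i) * (atInv (a' i))⁻¹) := by ring
          _ = _ := by rw [mul_inv_cancel₀ h2, mul_one, ← pow_add, Nat.add_sub_cancel' (hqn i)]
      rw [hT, Matrix.mul_smul, Matrix.smul_mul, smul_smul, mul_inv_cancel₀ hδ0, one_smul,
        Matrix.map_mul, hdiag, Matrix.mul_assoc, ← Matrix.mul_assoc (Matrix.diagonal _), h1,
        Matrix.smul_mul, Matrix.one_mul, Matrix.mul_smul, ← Matrix.map_mul, hP,
        Matrix.map_one _ (map_zero _) (map_one _)]
  have hri : RightInvertible D.cascA D.cascB D.cascC 0 := by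
    have h0 : ∀ i, atInv (a i) ≠ 0 := fun i => (map_ne_zero_iff _ atInv_injective).2 (ha i)
    refine ⟨atInv (revCharpoly M.A) • (Matrix.diagonal (fun i => (atInv (a i))⁻¹)
      * P'.map atInv), ?_⟩
    rw [hT, Matrix.mul_smul, Matrix.smul_mul, smul_smul, mul_inv_cancel₀ hδ0, one_smul,
      Matrix.map_mul, hdiag, Matrix.mul_assoc, ← Matrix.mul_assoc (Matrix.diagonal _),
      Matrix.diagonal_mul_diagonal]
    have h1 : (Matrix.diagonal fun i => atInv (a i) * (atInv (a i))⁻¹)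
        = (1 : Matrix (Fin p) (Fin p) (RatFunc ℝ)) := by
      rw [← Matrix.diagonal_one]
      congr 1
      funext i
      exact mul_inv_cancel₀ (h0 i)
    rw [h1, Matrix.one_mul, ← Matrix.map_mul, hP, Matrix.map_one _ (map_zero _) (map_one _)]
  have hdet : Detectable M.C M.A := detectable_of_fromBlocks hM.detectable_output
  -- The common reduction for stabilizability (c = 0) and for the absence of new zeros.
  have hkey : ∀ s : ℂ, 1 ≤ ‖s‖ → ∀ (w₁ : Fin M.n → ℂ) (w₂ : Fin nκ → ℂ) (c : Fin p → ℂ),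
      Sum.elim w₁ w₂ ᵥ* cx(D.cascA) = s • Sum.elim w₁ w₂ + c ᵥ* cx(D.cascC) →
      Sum.elim w₁ w₂ ᵥ* cx(D.cascB) = 0 →
      w₁ ᵥ* cx(M.A) = s • w₁ + c ᵥ* cx(M.C) ∧ w₁ ᵥ* cx(M.B) = 0 ∧ (w₁ = 0 → w₂ = 0) := by
    intro s hs w₁ w₂ c h1 h2
    have hs0 : s ≠ 0 := fun h => by simp [h] at hs; linarith
    rw [PreCompensators.cascA, PreCompensators.cascC, Matrix.fromBlocks_map,
      Matrix.vecMul_fromBlocks, smul_sumElim, cx_fromCols, Matrix.vecMul_fromCols,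
      ← Sum.elim_add_add, Sum.elim_eq_iff, Sum.elim_comp_inl, Sum.elim_comp_inr,
      Matrix.map_zero _ (map_zero _), Matrix.map_zero _ (map_zero _), Matrix.vecMul_zero,
      Matrix.vecMul_zero, add_zero, add_zero] at h1
    rw [PreCompensators.cascB, cx_fromRows, vecMul_fromRows_sumElim] at h2
    exact ⟨h1.1, vecMul_of_cascade hAq hs (hev s hs0)
      (exists_mulVec_eq_of_squaring hdet hNWΞ hs) h1.1 h1.2 h2⟩
  have hsplit : ∀ v : Fin M.n ⊕ Fin nκ → ℂ, ∃ a b, v = Sum.elim a b := fun v =>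
    ⟨v ∘ Sum.inl, v ∘ Sum.inr, (Sum.elim_comp_inl_inr v).symm⟩
  refine ⟨D, ?_, hQ⟩
  refine ⟨hAq, invertible_of_rightInvertible hri, ?_, hdet.cascade hAq _,
    (detectable_of_fromBlocks hM.detectable_measurement).cascade hAq _, ⟨_, hinf, ?_⟩, ?_, ?_⟩
  · refine stabilizable_of_hautus fun s hs w hw hwB => ?_
    obtain ⟨w₁, w₂, rfl⟩ := hsplit w
    obtain ⟨h1, h2, h3⟩ := hkey s hs w₁ w₂ 0 (by rw [hw, Matrix.zero_vecMul, add_zero]) hwB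
    rw [Matrix.zero_vecMul, add_zero] at h1
    have h4 := hM.stabilizable.hautus hs h1 h2
    rw [h4, h3 h4, Sum.elim_zero_zero]
  · refine isInfiniteZeroStructure_of_smith le_rfl hP (mul_one (1 : Matrix (Fin p) (Fin p) _)) hδ
      ha0 ?_
    rw [hT, Matrix.mul_one, haq]
    congr 3
    ext1 i j
    simp only [rectDiagonal, Matrix.diagonal_apply, Matrix.of_apply, Fin.ext_iff]
  · intro s hs
    obtain ⟨w, hw0, hw⟩ := exists_vecMul_of_isInvariantZero hs
    by_contra hcon
    obtain ⟨a₁, c, rfl⟩ : ∃ a₁ c, w = Sum.elim a₁ c := ⟨w ∘ Sum.inl, w ∘ Sum.inr,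
      (Sum.elim_comp_inl_inr w).symm⟩
    rw [rosenbrock_vecMul_eq_zero_iff, Matrix.map_zero _ (map_zero _), Matrix.vecMul_zero] at hw
    -- A left null vector of the agent, extended by zero on the compensator state, is one of the
    -- cascade.
    have h1 := hri.injective_of_not_isInvariantZero hcon
      (Sum.elim (Sum.elim a₁ (0 : Fin nκ → ℂ)) c) (by
        rw [rosenbrock_vecMul_eq_zero_iff, Matrix.map_zero _ (map_zero _), Matrix.vecMul_zero,
          PreCompensators.cascA, PreCompensators.cascC, PreCompensators.cascB,
          Matrix.fromBlocks_map, Matrix.vecMul_fromBlocks, smul_sumElim, cx_fromCols,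
          Matrix.vecMul_fromCols, ← Sum.elim_add_add, Sum.elim_eq_iff, Sum.elim_comp_inl,
          Sum.elim_comp_inr, Matrix.map_zero _ (map_zero _), Matrix.map_zero _ (map_zero _),
          cx_fromRows, vecMul_fromRows_sumElim, Matrix.map_mul, Matrix.map_mul,
          ← Matrix.vecMul_vecMul, ← Matrix.vecMul_vecMul, hw.2]
        simp only [Matrix.zero_vecMul, smul_zero, add_zero, and_true]
        exact ⟨hw.1, by rw [zero_add, Matrix.vecMul_zero]⟩)
    rw [← Sum.elim_zero_zero, Sum.elim_eq_iff, ← Sum.elim_zero_zero, Sum.elim_eq_iff] at h1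
    exact hw0 (by rw [h1.1.1, h1.2, Sum.elim_zero_zero])
  · intro s hs
    by_contra hcon
    push Not at hcon
    refine not_isInvariantZero_of_injective (fun w hw => ?_) hs
    obtain ⟨w', c, rfl⟩ : ∃ w' c, w = Sum.elim w' c := ⟨w ∘ Sum.inl, w ∘ Sum.inr,
      (Sum.elim_comp_inl_inr w).symm⟩
    obtain ⟨w₁, w₂, rfl⟩ := hsplit w'
    rw [rosenbrock_vecMul_eq_zero_iff, Matrix.map_zero _ (map_zero _), Matrix.vecMul_zero] at hw
    obtain ⟨h1, h2, h3⟩ := hkey s hcon.2 w₁ w₂ c hw.1 hw.2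
    have h4 := hM.rightInvertible.injective_of_not_isInvariantZero hcon.1 (Sum.elim w₁ c) (by
      rw [rosenbrock_vecMul_eq_zero_iff, Matrix.map_zero _ (map_zero _), Matrix.vecMul_zero]
      exact ⟨h1, h2⟩)
    rw [← Sum.elim_zero_zero, Sum.elim_eq_iff] at h4
    rw [h3 h4.1, h4.1, h4.2, Sum.elim_zero_zero, Sum.elim_zero_zero]

/-! ### The regulator equations -/

section Regulator

variable {α γ δ : Type*} [Fintype α] [DecidableEq α] [Fintype γ] [Fintype δ] [DecidableEq δ]

/-- The regulator equations have no nonzero homogeneous solution when no eigenvalue of the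
disturbance generator is an invariant zero. -/
theorem eq_zero_of_homogeneous_regulator {A : Matrix α α ℝ} {B : Matrix α γ ℝ} {C : Matrix γ α ℝ}
    {S : Matrix δ δ ℝ}
    (h : ∀ s ∈ eigenvalues S, ∀ w, rosenbrock A B C (0 : Matrix γ γ ℝ) s *ᵥ w = 0 → w = 0)
    {X : Matrix α δ ℂ} {Y : Matrix γ δ ℂ} (hX : X * cx(S) = cx(A) * X + cx(B) * Y)
    (hY : cx(C) * X = 0) : X = 0 ∧ Y = 0 := by
  -- Right multiplication by S preserves the homogeneous solutions V. An eigenvector (X', Y') of it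
  -- in V has left eigenvectors of S as its nonzero rows, and null vectors of the system matrix at
  -- the same s as its columns.
  let R : (Matrix α δ ℂ × Matrix γ δ ℂ) →ₗ[ℂ] (Matrix α δ ℂ × Matrix γ δ ℂ) :=
    { toFun := fun Z => (Z.1 * cx(S), Z.2 * cx(S))
      map_add' := fun Z Z' => by simp [Matrix.add_mul]
      map_smul' := fun c Z => by simp }
  let V : Submodule ℂ (Matrix α δ ℂ × Matrix γ δ ℂ) :=
    { carrier := {Z | Z.1 * cx(S) = cx(A) * Z.1 + cx(B) * Z.2 ∧ cx(C) * Z.1 = 0}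
      add_mem' := by
        rintro ⟨X, Y⟩ ⟨X', Y'⟩ ⟨h1, h2⟩ ⟨h3, h4⟩
        refine ⟨?_, ?_⟩
        · simp only [Prod.mk_add_mk, Matrix.add_mul, Matrix.mul_add] at *
          rw [h1, h3]
          abel
        · simp only [Prod.mk_add_mk, Matrix.mul_add] at *
          rw [h2, h4, add_zero]
      zero_mem' := by simp
      smul_mem' := by
        rintro c ⟨X, Y⟩ ⟨h1, h2⟩
        refine ⟨?_, ?_⟩
        · simp only [Prod.smul_mk, Matrix.smul_mul, Matrix.mul_smul] at *
          rw [h1, smul_add]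
        · simp only [Prod.smul_mk, Matrix.mul_smul] at *
          rw [h2, smul_zero] }
  have hRV : ∀ Z ∈ V, R Z ∈ V := by
    rintro ⟨X, Y⟩ ⟨h1, h2⟩
    refine ⟨?_, ?_⟩
    · simp only [R, LinearMap.coe_mk, AddHom.coe_mk] at *
      rw [← Matrix.mul_assoc, ← Matrix.mul_assoc, ← Matrix.add_mul, ← h1]
    · simp only [R, LinearMap.coe_mk, AddHom.coe_mk] at *
      rw [← Matrix.mul_assoc, h2, Matrix.zero_mul]
  by_contra hcon
  have hmem : ((X, Y) : Matrix α δ ℂ × Matrix γ δ ℂ) ∈ V := ⟨hX, hY⟩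
  have hnt : Nontrivial V := by
    refine ⟨⟨⟨(X, Y), hmem⟩, 0, fun h0 => hcon ?_⟩⟩
    have h1 := congrArg Subtype.val h0
    exact Prod.mk_eq_zero.1 h1
  obtain ⟨s, hs⟩ := Module.End.exists_eigenvalue (R.restrict hRV)
  obtain ⟨⟨⟨X', Y'⟩, h1, h2⟩, hZ⟩ := hs.exists_hasEigenvector
  have h3 : (X' * cx(S), Y' * cx(S)) = (s • X', s • Y') := congrArg Subtype.val hZ.apply_eq_smul
  have h0 : ¬ (X' = 0 ∧ Y' = 0) := fun h0 => hZ.2 (Subtype.ext (Prod.mk_eq_zero.2 h0))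
  have hX' := congrArg Prod.fst h3
  have hY' := congrArg Prod.snd h3
  simp only at h1 h2 hX' hY'
  have hsS : s ∈ eigenvalues S := by
    rw [mem_eigenvalues_iff_vecMul]
    by_contra hno
    push Not at hno
    apply h0
    constructor
    · ext i j
      by_contra hij
      exact hno (X' i) (fun h => hij (congrFun h j)) (congrFun hX' i)
    · ext i j
      by_contra hij
      exact hno (Y' i) (fun h => hij (congrFun h j)) (congrFun hY' i)
  apply h0
  have hcol : ∀ j, Sum.elim (X'.col j) (Y'.col j) = 0 := fun j => by
    refine h s hsS _ (rosenbrock_mulVec_eq_zero_iff.2 ⟨?_, ?_⟩)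
    · rw [hX'] at h1
      have := congrArg (fun E => E.col j) h1
      exact this
    · rw [Matrix.map_zero _ (map_zero _), Matrix.zero_mulVec, add_zero]
      exact congrArg (fun E => E.col j) h2
  constructor
  · ext i j
    exact congrFun (hcol j) (Sum.inl i)
  · ext i j
    exact congrFun (hcol j) (Sum.inr i)

/-- For a square system the equations have as many unknowns as conditions, so solvability follows
from injectivity, checked after complexification. -/
theorem exists_regulator {A : Matrix α α ℝ} {B : Matrix α γ ℝ} {C : Matrix γ α ℝ}
    {S : Matrix δ δ ℝ}
    (h : ∀ s ∈ eigenvalues S, ∀ w, rosenbrock A B C (0 : Matrix γ γ ℝ) s *ᵥ w = 0 → w = 0)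
    (E : Matrix α δ ℝ) (G : Matrix γ δ ℝ) :
    ∃ (X : Matrix α δ ℝ) (Y : Matrix γ δ ℝ), X * S = A * X + B * Y + E ∧ C * X + G = 0 := by
  let Φ : (Matrix α δ ℝ × Matrix γ δ ℝ) →ₗ[ℝ] (Matrix α δ ℝ × Matrix γ δ ℝ) :=
    { toFun := fun Z => (Z.1 * S - A * Z.1 - B * Z.2, C * Z.1)
      map_add' := fun Z Z' => by
        simp only [Prod.fst_add, Prod.snd_add, Matrix.add_mul, Matrix.mul_add, Prod.mk_add_mk]
        congr 1
        abel
      map_smul' := fun c Z => by simp [smul_sub] }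
  have hinj : Function.Injective Φ := by
    refine (injective_iff_map_eq_zero Φ).2 ?_
    rintro ⟨X, Y⟩ hZ
    obtain ⟨h1, h2⟩ := Prod.mk_eq_zero.1 hZ
    simp only at h1 h2
    rw [sub_sub, sub_eq_zero] at h1
    obtain ⟨h3, h4⟩ := eq_zero_of_homogeneous_regulator h (X := cx(X)) (Y := cx(Y))
      (by rw [← Matrix.map_mul, h1, Matrix.map_add _ (map_add _), Matrix.map_mul, Matrix.map_mul])
      (by rw [← Matrix.map_mul, h2, Matrix.map_zero _ (map_zero _)])
    have h5 := Matrix.map_injective (algebraMap ℝ ℂ).injective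
      (h3.trans (Matrix.map_zero _ (map_zero _)).symm)
    have h6 := Matrix.map_injective (algebraMap ℝ ℂ).injective
      (h4.trans (Matrix.map_zero _ (map_zero _)).symm)
    exact Prod.mk_eq_zero.2 ⟨h5, h6⟩
  obtain ⟨⟨X, Y⟩, hXY⟩ := LinearMap.injective_iff_surjective.1 hinj (E, -G)
  have h1 : X * S - A * X - B * Y = E := congrArg Prod.fst hXY
  have h2 : C * X = -G := congrArg Prod.snd hXY
  exact ⟨X, Y, by rw [← h1]; abel, by rw [h2, neg_add_cancel]⟩

omit [Fintype δ] [DecidableEq δ] in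
/-- The transfer function matrix of the inverse of a system with unit feedthrough. -/
theorem transfer_mul_transfer_inverse [DecidableEq γ] (A : Matrix α α ℝ) (B : Matrix α γ ℝ)
    (C : Matrix γ α ℝ) :
    transfer A B C 1 * transfer (A - B * C) B (-C) 1 = 1 := by
  have hR : ((RatFunc.X : RatFunc ℝ) • (1 : Matrix α α (RatFunc ℝ)) - rc(A))⁻¹
      * ((RatFunc.X : RatFunc ℝ) • (1 : Matrix α α (RatFunc ℝ)) - rc(A)) = 1 :=
    Matrix.nonsing_inv_mul _ ((Matrix.isUnit_iff_isUnit_det _).1 (isUnit_X_sub A))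
  have hR' : ((RatFunc.X : RatFunc ℝ) • (1 : Matrix α α (RatFunc ℝ)) - rc(A - B * C))
      * ((RatFunc.X : RatFunc ℝ) • (1 : Matrix α α (RatFunc ℝ)) - rc(A - B * C))⁻¹ = 1 :=
    Matrix.mul_nonsing_inv _ ((Matrix.isUnit_iff_isUnit_det _).1 (isUnit_X_sub _))
  have hsub : (RatFunc.X : RatFunc ℝ) • (1 : Matrix α α (RatFunc ℝ)) - rc(A - B * C)
      = ((RatFunc.X : RatFunc ℝ) • (1 : Matrix α α (RatFunc ℝ)) - rc(A)) + rc(B) * rc(C) := by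
    rw [Matrix.map_sub _ (map_sub _), Matrix.map_mul]
    abel
  rw [transfer, transfer, Matrix.map_one _ (map_zero _) (map_one _),
    Matrix.map_neg _ (map_neg _)]
  set R := ((RatFunc.X : RatFunc ℝ) • (1 : Matrix α α (RatFunc ℝ)) - rc(A))⁻¹
  set R' := ((RatFunc.X : RatFunc ℝ) • (1 : Matrix α α (RatFunc ℝ)) - rc(A - B * C))⁻¹
  have h1 : R = R' + R * (rc(B) * rc(C)) * R' := by
    calc R = R * (((RatFunc.X : RatFunc ℝ) • (1 : Matrix α α (RatFunc ℝ)) - rc(A - B * C)) * R') := by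
          rw [hR', Matrix.mul_one]
      _ = _ := by
          rw [hsub, ← Matrix.mul_assoc, Matrix.mul_add, hR, Matrix.add_mul, Matrix.one_mul]
  have h2 : rc(C) * R * rc(B) = rc(C) * R' * rc(B)
      + rc(C) * R * rc(B) * (rc(C) * R' * rc(B)) := by
    conv_lhs => rw [h1]
    simp only [Matrix.mul_add, Matrix.add_mul, Matrix.mul_assoc]
  have h3 : rc(C) * R * rc(B) * (rc(C) * R' * rc(B)) = rc(C) * R * rc(B) - rc(C) * R' * rc(B) :=
    eq_sub_of_add_eq' h2.symm
  rw [Matrix.mul_add, Matrix.add_mul, Matrix.neg_mul, Matrix.neg_mul, Matrix.mul_neg, h3,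
    Matrix.mul_one, Matrix.one_mul]
  abel

omit [Fintype γ] [Fintype δ] [DecidableEq δ] in
theorem isProper_transfer (A : Matrix α α ℝ) (B : Matrix α δ ℝ) (C : Matrix γ α ℝ)
    (D : Matrix γ δ ℝ) : IsProper (transfer A B C D) := by
  rw [transfer_eq_add]
  refine IsProper.add ?_ (isProper_C D)
  have h1 := IsProper.smul X_inv_mem_properSubring (isProper_X_smul_transfer A B C)
  rwa [smul_smul, inv_mul_cancel₀ RatFunc.X_ne_zero, one_smul] at h1

theorem exists_notMem_eigenvalues (A : Matrix α α ℝ) : ∃ t : ℂ, 1 ≤ ‖t‖ ∧ t ∉ eigenvalues A := by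
  have hinf : (Set.range fun n : ℕ => ((n + 1 : ℕ) : ℂ)).Infinite :=
    Set.infinite_range_of_injective fun a b h => by simpa using h
  obtain ⟨_, ⟨n, rfl⟩, hn⟩ := (hinf.sdiff (finite_eigenvalues A)).nonempty
  refine ⟨_, ?_, hn⟩
  rw [Complex.norm_natCast]
  exact_mod_cast Nat.le_add_left 1 n

end Regulator

theorem eq_sumElim {ι ι' : Type*} (v : ι ⊕ ι' → ℂ) : ∃ a b, v = Sum.elim a b :=
  ⟨v ∘ Sum.inl, v ∘ Sum.inr, (Sum.elim_comp_inl_inr v).symm⟩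

/-! ### Pre-compensator II: the internal model of the disturbance -/

section SecondPreCompensator

variable {p : ℕ} {M : AgentModel p} {D : PreCompensators M}

theorem PreCompensators.Step1.rosenbrock_injective (hD : D.Step1) (hM : M.Admissible)
    {s : ℂ} (hs : 1 ≤ ‖s‖) (hsS : s ∈ eigenvalues M.S) :
    ∀ w, rosenbrock D.cascA D.cascB D.cascC 0 s *ᵥ w = 0 → w = 0 := by
  refine mulVec_injective_of_vecMul_injective
    (hD.invertible.2.injective_of_not_isInvariantZero fun h => ?_)
  rcases hD.new_zeros s h with h1 | h1
  · exact hM.zeros s hs h1 hsS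
  · exact absurd h1 (not_lt.2 hs)

/-- All eigenvalues of S have modulus at least 1, where zeros of the cascade are zeros of the agent
and so not eigenvalues of S: the regulator equations are solvable. The pair (Γ, S) is detectable
because a disturbance mode needing no input Γ w would be undetectable from the output of the agent.
-/
theorem PreCompensators.Step1.exists_second (hD : D.Step1) (hM : M.Admissible)
    (hS : ∀ s ∈ eigenvalues M.S, 1 ≤ ‖s‖) :
    ∃ (Pi : Matrix (Fin M.n ⊕ Fin D.nq) (Fin M.d) ℝ) (Gam : Matrix (Fin p) (Fin M.d) ℝ)
      (Bp : Matrix (Fin M.d) (Fin p) ℝ),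
      Pi * M.S = D.cascA * Pi + D.cascB * Gam + D.cascE ∧ D.cascC * Pi + M.G = 0 ∧
      IsSchur (M.S - Bp * Gam) := by
  obtain ⟨Pi, Gam, h1, h2⟩ := exists_regulator
    (fun s hs => hD.rosenbrock_injective hM (hS s hs) hs) D.cascE M.G
  have hdet : Detectable Gam M.S := by
    refine detectable_of_hautus fun s hs w hw hG => ?_
    obtain ⟨a, b, hab⟩ := eq_sumElim (cx(Pi) *ᵥ w)
    have h3 := congrArg (fun E => cx(E) *ᵥ w) h1
    have h4 := congrArg (fun E => cx(E) *ᵥ w) h2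
    beta_reduce at h3 h4
    rw [Matrix.map_mul, ← Matrix.mulVec_mulVec, hw, Matrix.mulVec_smul, hab,
      Matrix.map_add _ (map_add _), Matrix.map_add _ (map_add _), Matrix.map_mul, Matrix.map_mul,
      Matrix.add_mulVec, Matrix.add_mulVec, ← Matrix.mulVec_mulVec, ← Matrix.mulVec_mulVec, hG,
      Matrix.mulVec_zero, add_zero, hab, PreCompensators.cascA, PreCompensators.cascE,
      Matrix.fromBlocks_map, Matrix.fromBlocks_mulVec, cx_fromRows, Matrix.fromRows_mulVec,
      smul_sumElim, ← Sum.elim_add_add, Sum.elim_eq_iff, Sum.elim_comp_inl, Sum.elim_comp_inr,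
      Matrix.map_zero _ (map_zero _), Matrix.map_zero _ (map_zero _), Matrix.zero_mulVec,
      Matrix.zero_mulVec, zero_add, add_zero] at h3
    rw [Matrix.map_add _ (map_add _), Matrix.map_mul, Matrix.add_mulVec, ← Matrix.mulVec_mulVec,
      hab, PreCompensators.cascC, cx_fromCols, Matrix.fromCols_mulVec_sumElim,
      Matrix.map_zero _ (map_zero _), Matrix.map_zero _ (map_zero _), Matrix.zero_mulVec,
      Matrix.zero_mulVec, add_zero] at h4
    have hb := hD.schur.eq_zero_of_mulVec hs h3.2.symm
    -- The sign is due to the convention that the disturbance enters the detectability pair with -E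
    -- and -G.
    have h5 : Sum.elim (-a) w = 0 := by
      refine hM.detectable_output.hautus hs ?_ ?_
      · rw [Matrix.fromBlocks_map, Matrix.fromBlocks_mulVec, smul_sumElim, Sum.elim_comp_inl,
          Sum.elim_comp_inr, Matrix.map_zero _ (map_zero _), Matrix.zero_mulVec, zero_add, hw,
          Matrix.map_neg _ (map_neg _), Matrix.neg_mulVec, Matrix.mulVec_neg, smul_neg, h3.1, hb,
          Matrix.mulVec_zero, add_zero, neg_add]
      · rw [cx_fromCols, Matrix.fromCols_mulVec_sumElim, Matrix.map_neg _ (map_neg _),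
          Matrix.neg_mulVec, Matrix.mulVec_neg, ← neg_add, h4, neg_zero]
    rw [← Sum.elim_zero_zero, Sum.elim_eq_iff] at h5
    exact h5.2
  obtain ⟨L, hL⟩ := hdet
  refine ⟨Pi, Gam, -L, h1, h2, ?_⟩
  rwa [Matrix.neg_mul, sub_neg_eq_add]

/-- With unit feedthrough, zero directions of pre-compensator II are eigenvectors of S - B_p Γ, the
state matrix of its inverse. -/
theorem PreCompensators.step2_of_isSchur (hDp : D.Dp = 1)
    (h1 : D.Pi * M.S = D.cascA * D.Pi + D.cascB * D.Gam + D.cascE)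
    (h2 : D.cascC * D.Pi + M.G = 0) (h3 : IsSchur (M.S - D.Bp * D.Gam)) : D.Step2 := by
  have hinj : ∀ s : ℂ, 1 ≤ ‖s‖ → ∀ w, rosenbrock M.S D.Bp D.Gam D.Dp s *ᵥ w = 0 → w = 0 := by
    intro s hs w hw
    obtain ⟨x, u, rfl⟩ := eq_sumElim w
    rw [rosenbrock_mulVec_eq_zero_iff, hDp, Matrix.map_one _ (map_zero _) (map_one _),
      Matrix.one_mulVec, add_eq_zero_iff_neg_eq] at hw
    have hx : x = 0 := h3.eq_zero_of_mulVec hs (by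
      rw [hw.1, ← hw.2, Matrix.map_sub _ (map_sub _), Matrix.map_mul, Matrix.sub_mulVec,
        ← Matrix.mulVec_mulVec, Matrix.mulVec_neg, sub_eq_add_neg])
    rw [← hw.2, hx, Matrix.mulVec_zero, neg_zero, Sum.elim_zero_zero]
  refine ⟨h1, h2, ?_, fun s hs => ?_⟩
  · obtain ⟨t, ht, htS⟩ := exists_notMem_eigenvalues M.S
    exact invertible_of_rosenbrock_injective htS (hinj t ht)
  · by_contra hcon
    exact not_isInvariantZero_of_injective
      (vecMul_injective_of_mulVec_injective (hinj s (not_lt.1 hcon))) hs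

/-- For an undetectable mode (a, b), the vector a - Π b has zero compensator part, since A_q is
stable. Its agent part together with b is then an undetectable mode of the agent with its
disturbance. -/
theorem PreCompensators.Step1.detectable_full (hD : D.Step1) (hM : M.Admissible)
    (h1 : D.Pi * M.S = D.cascA * D.Pi + D.cascB * D.Gam + D.cascE) :
    Detectable D.fullCm D.fullA := by
  refine detectable_of_hautus fun s hs v hv hC => ?_
  obtain ⟨a, b, rfl⟩ := eq_sumElim v
  obtain ⟨c₁, c₂, hc⟩ := eq_sumElim (a - cx(D.Pi) *ᵥ b)
  rw [PreCompensators.fullA, Matrix.fromBlocks_map, Matrix.fromBlocks_mulVec, smul_sumElim,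
    Sum.elim_comp_inl, Sum.elim_comp_inr, Matrix.map_zero _ (map_zero _), Matrix.zero_mulVec,
    zero_add, Sum.elim_eq_iff] at hv
  rw [PreCompensators.fullCm, cx_fromCols, Matrix.fromCols_mulVec_sumElim,
    Matrix.map_neg _ (map_neg _), Matrix.neg_mulVec, ← sub_eq_add_neg, Matrix.map_mul,
    ← Matrix.mulVec_mulVec, ← Matrix.mulVec_sub, hc, PreCompensators.cascCm, cx_fromCols,
    Matrix.fromCols_mulVec_sumElim, Matrix.map_zero _ (map_zero _), Matrix.zero_mulVec,
    add_zero] at hC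
  have h3 := congrArg (fun E => cx(E) *ᵥ b) h1
  beta_reduce at h3
  rw [Matrix.map_mul, ← Matrix.mulVec_mulVec, hv.2, Matrix.mulVec_smul,
    Matrix.map_add _ (map_add _), Matrix.map_add _ (map_add _), Matrix.map_mul, Matrix.add_mulVec,
    Matrix.add_mulVec, ← Matrix.mulVec_mulVec] at h3
  have h4 : s • (a - cx(D.Pi) *ᵥ b) = cx(D.cascA) *ᵥ (a - cx(D.Pi) *ᵥ b) - cx(D.cascE) *ᵥ b := by
    rw [smul_sub, ← hv.1, h3, Matrix.mulVec_sub]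
    abel
  rw [hc, PreCompensators.cascA, PreCompensators.cascE, Matrix.fromBlocks_map,
    Matrix.fromBlocks_mulVec, cx_fromRows, Matrix.fromRows_mulVec, smul_sumElim, sub_eq_add_neg,
    ← Sum.elim_neg_neg, ← Sum.elim_add_add, Sum.elim_eq_iff, Sum.elim_comp_inl, Sum.elim_comp_inr,
    Matrix.map_zero _ (map_zero _), Matrix.map_zero _ (map_zero _), Matrix.zero_mulVec,
    Matrix.zero_mulVec, zero_add, neg_zero, add_zero] at h4
  have hc₂ := hD.schur.eq_zero_of_mulVec hs h4.2.symm
  rw [hc₂, Matrix.mulVec_zero, add_zero] at h4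
  have h5 : Sum.elim c₁ b = 0 := by
    refine hM.detectable_measurement.hautus hs ?_ ?_
    · rw [Matrix.fromBlocks_map, Matrix.fromBlocks_mulVec, smul_sumElim, Sum.elim_comp_inl,
        Sum.elim_comp_inr, Matrix.map_zero _ (map_zero _), Matrix.zero_mulVec, zero_add, hv.2,
        Matrix.map_neg _ (map_neg _), Matrix.neg_mulVec, h4.1]
    · rw [cx_fromCols, Matrix.fromCols_mulVec_sumElim, hC, Matrix.map_zero _ (map_zero _),
        Matrix.zero_mulVec, add_zero]
  rw [← Sum.elim_zero_zero, Sum.elim_eq_iff] at h5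
  rw [h5.1, h5.2, hc₂, Matrix.mulVec_zero, sub_zero, Sum.elim_zero_zero] at hc
  rw [hc, h5.2, Sum.elim_zero_zero]

end SecondPreCompensator

/-! ### Almost homogenization -/

theorem UniformRank.exists_mul_eq {α γ ι : Type*} [Fintype α] [DecidableEq α] [Fintype γ]
    [DecidableEq γ] {A : Matrix α α ℝ} {B : Matrix α γ ℝ} {C : Matrix γ α ℝ} {n : ℕ}
    (h : UniformRank A B C n) (Y : ℕ → Matrix γ ι ℝ) :
    ∃ Z : Matrix α ι ℝ, ∀ i < n, C * A ^ i * Z = Y i := by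
  choose z hz using fun j => h.surjective fun i => (Y i).col j
  refine ⟨Matrix.of fun a j => z j a, fun i hi => ?_⟩
  ext a j
  exact congrFun (hz j i hi) a

theorem submatrix_mulVec_comp {α β γ : Type*} [Fintype α] [Fintype β] (A : Matrix γ α ℝ)
    (e : β ≃ α) (x : β → ℝ) : A.submatrix id e *ᵥ x = A *ᵥ (x ∘ e.symm) := by
  rw [Matrix.submatrix_mulVec_equiv, Function.comp_id]

/-- A system of which some transfer function matrix is an `n`-fold delay up to a proper factor
on the right is almost homogenized to the target model by an observer-based pre-compensator. -/
theorem exists_homogenizer {p r n l : ℕ} {T : TargetModel p} {Ar : Matrix (Fin r) (Fin r) ℝ}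
    {Cr : Matrix (Fin p) (Fin r) ℝ} (hT : T.Remodels Ar Cr n) {α : Type*} [Fintype α]
    [DecidableEq α] (A : Matrix α α ℝ) (B : Matrix α (Fin p) ℝ) (C : Matrix (Fin p) α ℝ)
    (Cm : Matrix (Fin l) α ℝ) (hdet : Detectable Cm A) {Q : Matrix (Fin p) (Fin p) (RatFunc ℝ)}
    (hQ : IsProper Q) (hAQ : transfer A B C 0 * Q = ((RatFunc.X : RatFunc ℝ)⁻¹) ^ n • 1) :
    ∃ (nh : ℕ) (Ah : Matrix (Fin nh) (Fin nh) ℝ) (Bh : Matrix (Fin nh) (Fin l) ℝ)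
      (Eh : Matrix (Fin nh) (Fin p) ℝ) (Ch : Matrix (Fin p) (Fin nh) ℝ)
      (Dh : Matrix (Fin p) (Fin p) ℝ) (Fh : Matrix (Fin p) (Fin l) ℝ)
      (ns : ℕ) (As : Matrix (Fin ns) (Fin ns) ℝ) (Cs : Matrix (Fin p) (Fin ns) ℝ), IsSchur As ∧
      ∀ (xb : ℕ → α → ℝ) (xi : ℕ → Fin nh → ℝ) (v uc : ℕ → Fin p → ℝ),
        (∀ k, xb (k + 1) = A *ᵥ xb k + B *ᵥ v k) →
        (∀ k, xi (k + 1) = Ah *ᵥ xi k + Bh *ᵥ (Cm *ᵥ xb k) + Eh *ᵥ uc k) →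
        (∀ k, v k = Ch *ᵥ xi k + Dh *ᵥ uc k + Fh *ᵥ (Cm *ᵥ xb k)) →
        ∃ (xch : ℕ → Fin T.h → ℝ) (sig : ℕ → Fin ns → ℝ),
          (∀ k, xch (k + 1) = T.A *ᵥ xch k + T.B *ᵥ (uc k + Cs *ᵥ sig k)) ∧
          (∀ k, sig (k + 1) = As *ᵥ sig k) ∧ (∀ k, C *ᵥ xb k = T.C *ᵥ xch k) := by
  have hn := hT.uniformRank.1
  -- Truncation after n terms perturbs the n-fold delay by z⁻ⁿ T Q', which is of higher order since
  -- T is strictly proper. The system extended by the realization of F thus has uniform rank n and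
  -- leading Markov parameter I.
  obtain ⟨F, Q', hQ', hF⟩ := hQ.exists_truncation n
  obtain ⟨nκ, Aκ, Bκ, Cκ, Dκ, -, htr, -⟩ := exists_fir F
  set Ae := fromBlocks A (B * Cκ) 0 Aκ with hAe
  set Be := fromRows (B * Dκ) Bκ with hBe
  set Ce : Matrix (Fin p) (α ⊕ Fin nκ) ℝ := fromCols C 0 with hCe
  have hTe : transfer Ae Be Ce 0 = ((RatFunc.X : RatFunc ℝ)⁻¹) ^ n •
      (1 + (RatFunc.X : RatFunc ℝ)⁻¹ • -((RatFunc.X : RatFunc ℝ) • transfer A B C 0 * Q')) := by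
    have h1 : F.map atInv = Q - ((RatFunc.X : RatFunc ℝ)⁻¹) ^ n • Q' := by
      rw [hF, add_sub_cancel_right]
    rw [hAe, hBe, hCe, transfer_cascade', htr, h1, Matrix.mul_sub, hAQ, Matrix.mul_smul, smul_add,
      smul_neg, smul_neg, Matrix.smul_mul, smul_smul (RatFunc.X⁻¹),
      inv_mul_cancel₀ RatFunc.X_ne_zero, one_smul, sub_eq_add_neg]
  obtain ⟨hmk0, hmk1⟩ := markov_of_transfer hn (V := -((RatFunc.X : RatFunc ℝ) •
    transfer A B C 0 * Q')) (fun i j => by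
      rw [Matrix.neg_apply]
      exact properSubring.neg_mem (((isProper_X_smul_transfer A B C).mul hQ') i j)) hTe
  -- Z maps an extended state to the target state with the same unforced output samples 0, …, n - 1.
  obtain ⟨Z, hZ⟩ := hT.uniformRank.exists_mul_eq fun i => Ce * Ae ^ i
  obtain ⟨L, hL⟩ := hdet
  set Λ := T.C * T.A ^ (n - 1) * T.B with hΛ
  have hΛu : IsUnit Λ.det := (Matrix.isUnit_iff_isUnit_det _).1 hT.uniformRank.2.2
  -- The discrepancy between target and extended system in sample n; the input v' = Ξ x + Λ ǔ
  -- removes it.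
  set Ξ : Matrix (Fin p) (α ⊕ Fin nκ) ℝ := T.C * T.A ^ n * Z - Ce * Ae ^ n with hΞ
  let e : Fin (Fintype.card (α ⊕ Fin nκ)) ≃ α ⊕ Fin nκ := (Fintype.equivFin _).symm
  let es : Fin (Fintype.card α) ≃ α := (Fintype.equivFin _).symm
  set Le : Matrix (α ⊕ Fin nκ) (Fin l) ℝ := fromRows L 0 with hLe
  -- The compensator state consists of an observer state for the system and the state of the
  -- realization of F. Ξ is applied to the estimate, and the estimation error, with matrix A + L
  -- C^m, becomes σ.
  refine ⟨_, (Ae + Be * Ξ + Le * fromCols Cm 0).submatrix e e, (-Le).submatrix e id,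
    (Be * Λ).submatrix e id, (fromCols 0 Cκ + Dκ * Ξ).submatrix id e, Dκ * Λ, 0,
    _, (A + L * Cm).submatrix es es, (-(Λ⁻¹ * Ξ.toCols₁)).submatrix id es, hL.submatrix es, ?_⟩
  intro xb xi v uc hxb hxi hv
  let xh : ℕ → α → ℝ := fun k => (xi k ∘ e.symm) ∘ Sum.inl
  let κ : ℕ → Fin nκ → ℝ := fun k => (xi k ∘ e.symm) ∘ Sum.inr
  have hsplit : ∀ k, xi k ∘ e.symm = Sum.elim (xh k) (κ k) := fun k =>
    (Sum.elim_comp_inl_inr _).symm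
  let v' : ℕ → Fin p → ℝ := fun k => Ξ *ᵥ Sum.elim (xh k) (κ k) + Λ *ᵥ uc k
  have hv' : ∀ k, v k = Cκ *ᵥ κ k + Dκ *ᵥ v' k := fun k => by
    rw [hv, submatrix_mulVec_comp, hsplit, Matrix.zero_mulVec, add_zero, Matrix.add_mulVec,
      Matrix.fromCols_mulVec_sumElim, Matrix.zero_mulVec, zero_add, Matrix.mulVec_add,
      Matrix.mulVec_mulVec, Matrix.mulVec_mulVec, add_assoc]
  have hxi' : ∀ k, Sum.elim (xh (k + 1)) (κ (k + 1)) = Ae *ᵥ Sum.elim (xh k) (κ k)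
      + Be *ᵥ v' k + Le *ᵥ (Cm *ᵥ (xh k - xb k)) := fun k => by
    have h1 : xi (k + 1) ∘ e.symm = (Ae + Be * Ξ + Le * fromCols Cm 0) *ᵥ (xi k ∘ e.symm)
        + (-Le) *ᵥ (Cm *ᵥ xb k) + (Be * Λ) *ᵥ uc k := by
      rw [hxi k, Matrix.submatrix_mulVec_equiv]
      funext i
      have h2 : ∀ (E : Matrix (α ⊕ Fin nκ) (Fin l) ℝ) y,
          (E.submatrix e id *ᵥ y) (e.symm i) = (E *ᵥ y) i := fun E y => by
        simp [Matrix.mulVec, dotProduct]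
      have h3 : ∀ (E : Matrix (α ⊕ Fin nκ) (Fin p) ℝ) y,
          (E.submatrix e id *ᵥ y) (e.symm i) = (E *ᵥ y) i := fun E y => by
        simp [Matrix.mulVec, dotProduct]
      simp only [Function.comp_apply, Pi.add_apply, h2, h3, Equiv.apply_symm_apply]
    rw [← hsplit, h1, hsplit, Matrix.add_mulVec, Matrix.add_mulVec, ← Matrix.mulVec_mulVec,
      ← Matrix.mulVec_mulVec, ← Matrix.mulVec_mulVec, Matrix.fromCols_mulVec_sumElim,
      Matrix.zero_mulVec, add_zero, Matrix.neg_mulVec]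
    simp only [v', Matrix.mulVec_add, Matrix.mulVec_sub]
    abel
  have hAeBe : ∀ (a : α → ℝ) (b : Fin nκ → ℝ) (w : Fin p → ℝ),
      Ae *ᵥ Sum.elim a b + Be *ᵥ w
        = Sum.elim (A *ᵥ a + B *ᵥ (Cκ *ᵥ b + Dκ *ᵥ w)) (Aκ *ᵥ b + Bκ *ᵥ w) := fun a b w => by
    rw [hAe, hBe, Matrix.fromBlocks_mulVec, Matrix.fromRows_mulVec, Sum.elim_comp_inl,
      Sum.elim_comp_inr, Matrix.zero_mulVec, zero_add, ← Sum.elim_add_add, Matrix.mulVec_add,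
      Matrix.mulVec_mulVec, Matrix.mulVec_mulVec, add_assoc]
  have hstep : ∀ k, xh (k + 1) = A *ᵥ xh k + B *ᵥ v k + L *ᵥ (Cm *ᵥ (xh k - xb k)) ∧
      κ (k + 1) = Aκ *ᵥ κ k + Bκ *ᵥ v' k := fun k => by
    have h1 := hxi' k
    rw [hAeBe, hLe, Matrix.fromRows_mulVec, Matrix.zero_mulVec, ← Sum.elim_add_add, add_zero,
      Sum.elim_eq_iff, ← hv'] at h1
    exact h1
  let xe : ℕ → (α ⊕ Fin nκ) → ℝ := fun k => Sum.elim (xb k) (κ k)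
  have hxe : ∀ k, xe (k + 1) = Ae *ᵥ xe k + Be *ᵥ v' k := fun k => by
    rw [hAeBe, ← hv', ← hxb, ← (hstep k).2]
  refine ⟨fun k => Z *ᵥ xe k, fun k => (xb k - xh k) ∘ es, fun k => ?_, fun k => ?_, fun k => ?_⟩
  · have hσ : Λ *ᵥ ((-(Λ⁻¹ * Ξ.toCols₁)).submatrix id es *ᵥ ((xb k - xh k) ∘ es))
        = Ξ *ᵥ Sum.elim (xh k) (κ k) - Ξ *ᵥ xe k := by
      have h1 : Sum.elim (xh k) (κ k) - xe k = Sum.elim (-(xb k - xh k)) 0 := by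
        funext i
        cases i <;> simp [xe]
      have h2 : Ξ *ᵥ Sum.elim (-(xb k - xh k)) 0 = Ξ.toCols₁ *ᵥ (-(xb k - xh k)) := by
        conv_lhs => rw [← Matrix.fromCols_toCols Ξ]
        rw [Matrix.fromCols_mulVec_sumElim, Matrix.mulVec_zero, add_zero]
      rw [← Matrix.mulVec_sub, h1, h2, submatrix_mulVec_comp, Function.comp_assoc,
        Equiv.self_comp_symm, Function.comp_id, Matrix.mulVec_mulVec, Matrix.mul_neg,
        Matrix.mul_nonsing_inv_cancel_left _ _ hΛu, Matrix.neg_mulVec, Matrix.mulVec_neg]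
    -- Two target states agree if their first n Markov rows agree: rows below n - 1 only shift the
    -- samples, and in row n - 1 the input v' does its work.
    refine sub_eq_zero.1 (hT.eq_zero_of_markov fun i hi => ?_)
    beta_reduce
    have hl : ∀ x w, (T.C * T.A ^ i) *ᵥ (Z *ᵥ (Ae *ᵥ x + Be *ᵥ w))
        = (Ce * Ae ^ (i + 1)) *ᵥ x + (Ce * Ae ^ i * Be) *ᵥ w := fun x w => by
      rw [Matrix.mulVec_mulVec, hZ i hi, Matrix.mulVec_add, Matrix.mulVec_mulVec,
        Matrix.mulVec_mulVec, Matrix.mul_assoc, ← pow_succ]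
    have hr : ∀ x w, (T.C * T.A ^ i) *ᵥ (T.A *ᵥ (Z *ᵥ x) + T.B *ᵥ w)
        = (T.C * T.A ^ (i + 1) * Z) *ᵥ x + (T.C * T.A ^ i * T.B) *ᵥ w := fun x w => by
      rw [Matrix.mulVec_add, Matrix.mulVec_mulVec, Matrix.mulVec_mulVec, Matrix.mulVec_mulVec,
        pow_succ]
      simp only [Matrix.mul_assoc]
    rw [Matrix.mulVec_sub, sub_eq_zero, hxe, hl, hr]
    rcases Nat.lt_or_ge (i + 1) n with hin | hin
    · rw [hmk0 i hin, hT.uniformRank.2.1 i hin, hZ (i + 1) hin, Matrix.zero_mulVec,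
        Matrix.zero_mulVec]
    · obtain rfl : i = n - 1 := by omega
      have hi1 : n - 1 + 1 = n := by omega
      rw [hi1, hmk1, Matrix.one_mulVec, ← hΛ, Matrix.mulVec_add, hσ]
      simp only [v', hΞ, Matrix.sub_mulVec]
      abel
  · beta_reduce
    rw [Matrix.submatrix_mulVec_equiv, Function.comp_assoc, Equiv.self_comp_symm, Function.comp_id,
      hxb, (hstep k).1]
    congr 1
    rw [Matrix.add_mulVec, ← Matrix.mulVec_mulVec, Matrix.mulVec_sub, Matrix.mulVec_sub,
      Matrix.mulVec_sub, Matrix.mulVec_sub, Matrix.mulVec_sub]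
    abel
  · have h1 := hZ 0 hn
    rw [pow_zero, pow_zero, Matrix.mul_one, Matrix.mul_one] at h1
    rw [Matrix.mulVec_mulVec, h1, hCe, Matrix.fromCols_mulVec_sumElim, Matrix.zero_mulVec, add_zero]

/-- The inverse of pre-compensator II is proper, as its feedthrough is I. Multiplied by the Q of
pre-compensator I, it inverts the whole cascade up to the n-fold delay, as the homogenizer requires.
-/
theorem AgentModel.Admissible.exists_isDesign {p r n : ℕ} {T : TargetModel p}
    {Ar : Matrix (Fin r) (Fin r) ℝ} {Cr : Matrix (Fin p) (Fin r) ℝ} (hT : T.Remodels Ar Cr n)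
    {M : AgentModel p} (hM : M.Admissible) (hS : ∀ s ∈ eigenvalues M.S, 1 ≤ ‖s‖)
    (hn : n ∈ upperBounds (infiniteZeroOrders M.A M.B M.C)) :
    ∃ D : PreCompensators M, D.IsDesign T := by
  obtain ⟨D₁, hD₁, hQ₁⟩ := hM.exists_first
  obtain ⟨Q, hQ, hcQ⟩ := hQ₁ n hn
  obtain ⟨Pi, Gam, Bp, h1, h2, h3⟩ := hD₁.exists_second hM hS
  let D₂ : PreCompensators M := { D₁ with Pi := Pi, Gam := Gam, Bp := Bp, Dp := 1 }
  have hD₂ : D₂.Step1 := ⟨hD₁.schur, hD₁.invertible, hD₁.stabilizable, hD₁.detectable,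
    hD₁.detectable_measurement, hD₁.infinite_zeros, hD₁.keeps_zeros, hD₁.new_zeros⟩
  have hfull : transfer D₂.fullA D₂.fullB D₂.fullC 0
      * (transfer (M.S - Bp * Gam) Bp (-Gam) 1 * Q) = ((RatFunc.X : RatFunc ℝ)⁻¹) ^ n • 1 := by
    have h4 : transfer D₂.fullA D₂.fullB D₂.fullC 0
        = transfer D₁.cascA D₁.cascB D₁.cascC 0 * transfer M.S Bp Gam 1 :=
      transfer_cascade' D₁.cascA D₁.cascB D₁.cascC M.S Bp Gam 1
    rw [h4, Matrix.mul_assoc, ← Matrix.mul_assoc (transfer M.S Bp Gam 1),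
      transfer_mul_transfer_inverse, Matrix.one_mul, hcQ]
  obtain ⟨nh, Ah, Bh, Eh, Ch, Dh, Fh, h4⟩ := exists_homogenizer hT D₂.fullA D₂.fullB D₂.fullC
    D₂.fullCm (hD₂.detectable_full hM h1) ((isProper_transfer _ _ _ _).mul hQ) hfull
  let D₃ : PreCompensators M := { D₂ with
    nh := nh, Ah := Ah, Bh := Bh, Eh := Eh, Ch := Ch, Dh := Dh, Fh := Fh }
  exact ⟨D₃, ⟨hD₁.schur, hD₁.invertible, hD₁.stabilizable, hD₁.detectable,
    hD₁.detectable_measurement, hD₁.infinite_zeros, hD₁.keeps_zeros, hD₁.new_zeros⟩,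
    PreCompensators.step2_of_isSchur rfl h1 h2 h3, h4⟩

/-! ### Splitting off the decaying part of a disturbance -/

/-- The initial states from which an autonomous system decays. -/
def decayingSubmodule {α : Type*} [Fintype α] [DecidableEq α] (S : Matrix α α ℝ) :
    Submodule ℝ (α → ℝ) where
  carrier := {x | Tendsto (fun k => S ^ k *ᵥ x) atTop (𝓝 0)}
  add_mem' {x y} hx hy := by
    have := Tendsto.add (f := fun k => S ^ k *ᵥ x) (g := fun k => S ^ k *ᵥ y) hx hy
    rw [add_zero] at this
    exact this.congr fun k => (Matrix.mulVec_add _ _ _).symm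
  zero_mem' := tendsto_const_nhds.congr fun k => (Matrix.mulVec_zero _).symm
  smul_mem' c x hx := by
    have := Tendsto.const_smul (f := fun k => S ^ k *ᵥ x) hx c
    rw [smul_zero] at this
    exact this.congr fun k => (Matrix.mulVec_smul _ _ _).symm

theorem mem_decayingSubmodule {α : Type*} [Fintype α] [DecidableEq α] {S : Matrix α α ℝ}
    {x : α → ℝ} : x ∈ decayingSubmodule S ↔ Tendsto (fun k => S ^ k *ᵥ x) atTop (𝓝 0) := Iff.rfl

theorem mulVec_mem_decayingSubmodule {α : Type*} [Fintype α] [DecidableEq α] {S : Matrix α α ℝ}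
    {x : α → ℝ} (hx : x ∈ decayingSubmodule S) : S *ᵥ x ∈ decayingSubmodule S := by
  refine ((tendsto_add_atTop_iff_nat 1).2 (mem_decayingSubmodule.1 hx)).congr fun k => ?_
  rw [Matrix.mulVec_mulVec, ← pow_succ]

/-- A square matrix splits into a Schur stable block and a block without eigenvalues in the open
unit disc. -/
theorem exists_stable_splitting {d : ℕ} (S : Matrix (Fin d) (Fin d) ℝ) :
    ∃ (a b : ℕ) (P : Matrix (Fin d) (Fin a ⊕ Fin b) ℝ) (Q : Matrix (Fin a ⊕ Fin b) (Fin d) ℝ)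
      (S₁ : Matrix (Fin a) (Fin a) ℝ) (S₁₂ : Matrix (Fin a) (Fin b) ℝ)
      (S₂ : Matrix (Fin b) (Fin b) ℝ), P * Q = 1 ∧ Q * P = 1 ∧
      Q * S * P = fromBlocks S₁ S₁₂ 0 S₂ ∧ IsSchur S₁ ∧ ∀ s ∈ eigenvalues S₂, 1 ≤ ‖s‖ := by
  set V := decayingSubmodule S with hV
  let bV := Module.finBasis ℝ V
  let O : Matrix (Fin d) (Fin (Module.finrank ℝ V)) ℝ := Matrix.of fun i j => (bV j : Fin d → ℝ) i
  let S₁ : Matrix (Fin (Module.finrank ℝ V)) (Fin (Module.finrank ℝ V)) ℝ :=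
    Matrix.of fun i j => bV.repr ⟨S *ᵥ bV j, mulVec_mem_decayingSubmodule (bV j).2⟩ i
  have hOx : ∀ x, O *ᵥ x = ((∑ j, x j • bV j : V) : Fin d → ℝ) := fun x => by
    rw [Submodule.coe_sum]
    funext i
    simp [O, Matrix.mulVec, dotProduct, mul_comm]
  have hO : ∀ x, O *ᵥ x = 0 → x = 0 := fun x hx => by
    rw [hOx] at hx
    exact funext (Fintype.linearIndependent_iff.1 bV.linearIndependent _ (Subtype.ext hx))
  have hSO : S * O = O * S₁ := by
    refine Matrix.ext_of_mulVec_single fun j => ?_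
    rw [← Matrix.mulVec_mulVec, ← Matrix.mulVec_mulVec, hOx (S₁ *ᵥ _), Matrix.mulVec_single_one,
      Matrix.mulVec_single_one]
    exact (congrArg Subtype.val
      (bV.sum_repr ⟨S *ᵥ bV j, mulVec_mem_decayingSubmodule (bV j).2⟩)).symm
  obtain ⟨b, P, Q, hPQ, hQP, hP⟩ := exists_adapted_basis O hO
  have hblk := blockTriangular_of_adapted hSO hQP hP
  have hpow : ∀ k, S ^ k * O = O * S₁ ^ k := fun k => by
    induction k with
    | zero => rw [pow_zero, pow_zero, Matrix.one_mul, Matrix.mul_one]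
    | succ k ih => rw [pow_succ', Matrix.mul_assoc, ih, ← Matrix.mul_assoc, hSO, Matrix.mul_assoc,
        ← pow_succ']
  have hS₁ : IsSchur S₁ := by
    refine IsSchur.of_tendsto_pow (tendsto_pi_nhds.2 fun i => tendsto_pi_nhds.2 fun j => ?_)
    have h1 : ∀ k, (S₁ ^ k) i j = (Q *ᵥ (S ^ k *ᵥ (bV j : Fin d → ℝ))) (Sum.inl i) := fun k => by
      have h2 : (bV j : Fin d → ℝ) = O *ᵥ Pi.single j 1 := by
        rw [Matrix.mulVec_single_one]
        rfl
      have h4 : S ^ k *ᵥ (O *ᵥ Pi.single j 1) = O *ᵥ (S₁ ^ k *ᵥ Pi.single j 1) := by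
        rw [Matrix.mulVec_mulVec, hpow, Matrix.mulVec_mulVec]
      rw [h2, h4, ← hP, Matrix.mulVec_mulVec, hQP,
        Matrix.one_mulVec, Sum.elim_inl, Matrix.mulVec_single_one, Matrix.col_apply]
    have h3 := tendsto_mulVec_zero Q (mem_decayingSubmodule.1 (bV j).2)
    exact (tendsto_pi_nhds.1 h3 (Sum.inl i)).congr fun k => (h1 k).symm
  set S₁₂ := (Q * S * P).toBlocks₁₂
  set S₂ := (Q * S * P).toBlocks₂₂
  -- A decaying trajectory y of the quotient lifts to a decaying trajectory of S: the S₁ component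
  -- is stable and driven by y. The lift starts in the decaying subspace, so its quotient component
  -- y 0 is zero.
  have hzero : ∀ y : ℕ → Fin b → ℝ, (∀ k, y (k + 1) = S₂ *ᵥ y k) → Tendsto y atTop (𝓝 0) →
      y 0 = 0 := by
    intro y hy hy0
    let x : ℕ → Fin (Module.finrank ℝ V) → ℝ := fun k =>
      Nat.rec 0 (fun k a => S₁ *ᵥ a + S₁₂ *ᵥ y k) k
    have hx : Tendsto x atTop (𝓝 0) :=
      hS₁.tendsto_zero (d := fun k => S₁₂ *ᵥ y k) (fun k => rfl) (tendsto_mulVec_zero S₁₂ hy0)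
    have hw : ∀ k, P *ᵥ Sum.elim (x k) (y k) = S ^ k *ᵥ (P *ᵥ Sum.elim (x 0) (y 0)) := by
      intro k
      induction k with
      | zero => rw [pow_zero, Matrix.one_mulVec]
      | succ k ih =>
        have h1 : P * (Q * S * P) = S * P := by
          rw [Matrix.mul_assoc, ← Matrix.mul_assoc, hPQ, Matrix.one_mul]
        rw [pow_succ', ← Matrix.mulVec_mulVec, ← ih, Matrix.mulVec_mulVec, ← h1,
          ← Matrix.mulVec_mulVec, hblk, Matrix.fromBlocks_mulVec, Sum.elim_comp_inl,
          Sum.elim_comp_inr, Matrix.zero_mulVec, zero_add, ← hy]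
    have hmem : P *ᵥ Sum.elim (x 0) (y 0) ∈ V := by
      refine Tendsto.congr hw ?_
      refine tendsto_mulVec_zero P (tendsto_pi_nhds.2 fun i => ?_)
      rcases i with i | i
      · exact tendsto_pi_nhds.1 hx i
      · exact tendsto_pi_nhds.1 hy0 i
    have h2 := congrArg Subtype.val (bV.sum_repr ⟨_, hmem⟩)
    rw [← hOx, ← hP] at h2
    have h3 := congrArg (fun z => Q *ᵥ z) h2
    beta_reduce at h3
    rw [Matrix.mulVec_mulVec, Matrix.mulVec_mulVec, hQP, Matrix.one_mulVec, Matrix.one_mulVec,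
      Sum.elim_eq_iff] at h3
    exact h3.2.symm
  -- The real part of s ^ k v is a decaying real trajectory, so Re v = 0. Applied to i v below, the
  -- same argument gives Im v = 0.
  have hre : ∀ (s : ℂ) (v : Fin b → ℂ), ‖s‖ < 1 → cx(S₂) *ᵥ v = s • v → ∀ i, (v i).re = 0 := by
    intro s v hs hv i
    have h1 := hzero (fun k i => (s ^ k * v i).re) (fun k => ?_) ?_
    · have := congrFun h1 i
      rwa [pow_zero, one_mul] at this
    · have h2 : cx(S₂) *ᵥ (s ^ k • v) = s ^ (k + 1) • v := by
        rw [Matrix.mulVec_smul, hv, smul_smul, pow_succ]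
      funext i
      have h3 := congrArg Complex.re (congrFun h2 i)
      simp only [Matrix.mulVec, dotProduct, Matrix.map_apply, Pi.smul_apply, smul_eq_mul,
        Complex.re_sum] at h3 ⊢
      rw [← h3]
      refine Finset.sum_congr rfl fun j _ => ?_
      exact Complex.re_ofReal_mul _ _
    · refine tendsto_pi_nhds.2 fun i => ?_
      have h2 := (tendsto_pow_atTop_nhds_zero_of_norm_lt_one hs).mul_const (v i)
      rw [zero_mul] at h2
      exact (Complex.continuous_re.tendsto 0).comp h2
  refine ⟨_, b, P, Q, S₁, S₁₂, S₂, hPQ, hQP, hblk, hS₁, fun s hs => ?_⟩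
  by_contra hcon
  push Not at hcon
  obtain ⟨v, hv0, hv⟩ := mem_eigenvalues_iff_mulVec.1 hs
  apply hv0
  funext i
  refine Complex.ext (hre s v hcon hv i) ?_
  have h1 := hre s (Complex.I • v) hcon (by rw [Matrix.mulVec_smul, hv, smul_comm]) i
  rw [Pi.smul_apply, smul_eq_mul, Complex.I_mul_re] at h1
  exact neg_eq_zero.1 h1

/-! ### Augmenting the agent by a part of its disturbance -/

section Reindex

variable {α α' β γ δ : Type*} [Fintype α] [DecidableEq α] [Fintype α'] [DecidableEq α']
  [Fintype β] [Fintype γ] [Fintype δ] [DecidableEq δ]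

theorem Stabilizable.submatrix {A : Matrix α α ℝ} {B : Matrix α β ℝ} (h : Stabilizable A B)
    (e : α' ≃ α) : Stabilizable (A.submatrix e e) (B.submatrix e id) := by
  obtain ⟨F, hF⟩ := h
  refine ⟨F.submatrix id e, ?_⟩
  have h1 := hF.submatrix e
  rwa [Matrix.submatrix_add, Pi.add_apply, Pi.add_apply,
    Matrix.submatrix_mul _ _ _ id _ Function.bijective_id] at h1

theorem Detectable.submatrix {A : Matrix α α ℝ} {C : Matrix γ α ℝ} (h : Detectable C A)
    (e : α' ≃ α) : Detectable (C.submatrix id e) (A.submatrix e e) := by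
  obtain ⟨L, hL⟩ := h
  refine ⟨L.submatrix e id, ?_⟩
  have h1 := hL.submatrix e
  rwa [Matrix.submatrix_add, Pi.add_apply, Pi.add_apply,
    Matrix.submatrix_mul _ _ _ id _ Function.bijective_id] at h1

theorem Detectable.submatrix_fromBlocks {A : Matrix α α ℝ} {E : Matrix α δ ℝ} {S : Matrix δ δ ℝ}
    {C : Matrix γ α ℝ} {G : Matrix γ δ ℝ} (h : Detectable (fromCols C G) (fromBlocks A E 0 S))
    (e : α' ≃ α) : Detectable (fromCols (C.submatrix id e) G)
      (fromBlocks (A.submatrix e e) (E.submatrix e id) 0 S) := by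
  have h1 := h.submatrix (e.sumCongr (Equiv.refl δ))
  have h2 : (fromCols C G).submatrix id (e.sumCongr (Equiv.refl δ))
      = fromCols (C.submatrix id e) G := by
    ext i j
    cases j <;> rfl
  have h3 : (fromBlocks A E 0 S).submatrix (e.sumCongr (Equiv.refl δ)) (e.sumCongr (Equiv.refl δ))
      = fromBlocks (A.submatrix e e) (E.submatrix e id) 0 S := by
    ext i j
    cases i <;> cases j <;> rfl
  rwa [h2, h3] at h1

omit [Fintype γ] in
theorem isInvariantZero_submatrix {A : Matrix α α ℝ} {B : Matrix α β ℝ}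
    {C : Matrix γ α ℝ} {D : Matrix γ β ℝ} {s : ℂ} (e : α' ≃ α) :
    IsInvariantZero (A.submatrix e e) (B.submatrix e id) (C.submatrix id e) D s
      ↔ IsInvariantZero A B C D s := by
  have h1 : ∀ t, (rosenbrock (A.submatrix e e) (B.submatrix e id) (C.submatrix id e) D t).rank
      = (rosenbrock A B C D t).rank := fun t => by
    rw [← Matrix.rank_submatrix (rosenbrock A B C D t) (e.sumCongr (Equiv.refl γ))
      (e.sumCongr (Equiv.refl β))]
    congr 1
    ext i j
    rcases i with i | i <;> rcases j with j | j <;> simp [rosenbrock, Matrix.one_apply]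
  simp only [IsInvariantZero, h1]

omit [Fintype β] [Fintype γ] in
theorem transfer_fromBlocks_zero (A : Matrix α α ℝ) (B : Matrix α β ℝ) (C : Matrix γ α ℝ)
    (E : Matrix α δ ℝ) (S : Matrix δ δ ℝ) (G : Matrix γ δ ℝ) :
    transfer (fromBlocks A E 0 S) (fromRows B 0) (fromCols C G) 0 = transfer A B C 0 := by
  have h1 : (RatFunc.X : RatFunc ℝ) • (1 : Matrix (α ⊕ δ) (α ⊕ δ) (RatFunc ℝ))
      - rc(fromBlocks A E 0 S)
      = fromBlocks ((RatFunc.X : RatFunc ℝ) • 1 - rc(A)) (-rc(E)) 0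
        ((RatFunc.X : RatFunc ℝ) • 1 - rc(S)) := by
    rw [← Matrix.fromBlocks_one, Matrix.fromBlocks_smul, Matrix.fromBlocks_map,
      sub_eq_add_neg, Matrix.fromBlocks_neg, Matrix.fromBlocks_add]
    simp [sub_eq_add_neg]
  have h2 : rc(fromRows B (0 : Matrix δ β ℝ)) = fromRows rc(B) 0 := by
    ext i j
    cases i <;> simp
  have h3 : rc(fromCols C G) = fromCols rc(C) rc(G) := by
    ext i j
    cases j <;> rfl
  rw [transfer, h1, h2, h3, Matrix.inv_fromBlocks_zero₂₁_of_isUnit_iff _ _ _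
    (iff_of_true (isUnit_X_sub A) (isUnit_X_sub S)), Matrix.fromCols_mul_fromBlocks,
    Matrix.fromCols_mul_fromRows, Matrix.mul_zero, Matrix.mul_zero, add_zero, add_zero, transfer]

end Reindex

namespace AgentModel

variable {p : ℕ} (M : AgentModel p) {a b : ℕ} (P : Matrix (Fin M.d) (Fin a ⊕ Fin b) ℝ)
  (S₁ : Matrix (Fin a) (Fin a) ℝ) (S₁₂ : Matrix (Fin a) (Fin b) ℝ) (S₂ : Matrix (Fin b) (Fin b) ℝ)

/-- The agent model in which a part of the disturbance is regarded as a part of the state. -/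
def augment : AgentModel p where
  n := M.n + a
  m := M.m
  d := b
  l := M.l
  A := (fromBlocks M.A (M.E * P.toCols₁) 0 S₁).submatrix finSumFinEquiv.symm finSumFinEquiv.symm
  B := (fromRows M.B 0).submatrix finSumFinEquiv.symm id
  E := (fromRows (M.E * P.toCols₂) S₁₂).submatrix finSumFinEquiv.symm id
  C := (fromCols M.C (M.G * P.toCols₁)).submatrix id finSumFinEquiv.symm
  G := M.G * P.toCols₂
  Cm := (fromCols M.Cm 0).submatrix id finSumFinEquiv.symm
  S := S₂

variable {M P S₁ S₁₂ S₂}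

/-- The absorbed modes are not driven by the input and so do not appear in the transfer matrix. -/
theorem transfer_augment : transfer (M.augment P S₁ S₁₂ S₂).A (M.augment P S₁ S₁₂ S₂).B
    (M.augment P S₁ S₁₂ S₂).C 0 = transfer M.A M.B M.C 0 :=
  (transfer_submatrix finSumFinEquiv.symm _ _ _ _).trans (transfer_fromBlocks_zero _ _ _ _ _ _)

theorem infiniteZeroOrders_augment : infiniteZeroOrders (M.augment P S₁ S₁₂ S₂).A
    (M.augment P S₁ S₁₂ S₂).B (M.augment P S₁ S₁₂ S₂).C = infiniteZeroOrders M.A M.B M.C := by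
  simp only [infiniteZeroOrders, IsInfiniteZeroStructure, transfer_augment]
  rfl

/-- The augmented pair is the original one in the coordinates P. The disturbance kept outside enters
with a minus sign and the absorbed one with a plus sign, hence the vector P (c, -y). -/
theorem detectable_augment {Q : Matrix (Fin a ⊕ Fin b) (Fin M.d) ℝ} (hPQ : P * Q = 1)
    (hQP : Q * P = 1) (hS : Q * M.S * P = fromBlocks S₁ S₁₂ 0 S₂) {q : ℕ}
    {C : Matrix (Fin q) (Fin M.n) ℝ} {G : Matrix (Fin q) (Fin M.d) ℝ}
    (h : Detectable (fromCols C (-G)) (fromBlocks M.A (-M.E) 0 M.S)) :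
    Detectable (fromCols (fromCols C (G * P.toCols₁)) (-(G * P.toCols₂)))
      (fromBlocks (fromBlocks M.A (M.E * P.toCols₁) 0 S₁) (-fromRows (M.E * P.toCols₂) S₁₂)
        0 S₂) := by
  refine detectable_of_hautus fun s hs v hv hC => ?_
  obtain ⟨v', y, rfl⟩ := eq_sumElim v
  obtain ⟨x, c, rfl⟩ := eq_sumElim v'
  have hP : ∀ {ι : Type} (E : Matrix ι (Fin M.d) ℝ), cx(E * P.toCols₁) *ᵥ c
      - cx(E * P.toCols₂) *ᵥ y = cx(E) *ᵥ (cx(P) *ᵥ Sum.elim c (-y)) := fun E => by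
    have h1 : cx(P) = fromCols cx(P.toCols₁) cx(P.toCols₂) := by
      rw [← cx_fromCols, Matrix.fromCols_toCols]
    rw [h1, Matrix.fromCols_mulVec_sumElim, Matrix.mulVec_add, Matrix.mulVec_neg,
      Matrix.mulVec_neg, ← sub_eq_add_neg, Matrix.map_mul, Matrix.map_mul, ← Matrix.mulVec_mulVec,
      ← Matrix.mulVec_mulVec]
  rw [Matrix.fromBlocks_map, Matrix.fromBlocks_mulVec, Matrix.fromBlocks_map,
    Matrix.map_neg _ (map_neg _), cx_fromRows] at hv
  simp only [Sum.elim_comp_inl, Sum.elim_comp_inr, Matrix.fromBlocks_mulVec, Matrix.neg_mulVec,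
    Matrix.fromRows_mulVec, smul_sumElim, ← Sum.elim_neg_neg, ← Sum.elim_add_add, Sum.elim_eq_iff,
    Matrix.map_zero _ (map_zero _), Matrix.zero_mulVec, zero_add] at hv
  obtain ⟨⟨h1, h2⟩, h3⟩ := hv
  rw [cx_fromCols, cx_fromCols, Matrix.fromCols_mulVec_sumElim, Matrix.fromCols_mulVec_sumElim,
    Matrix.map_neg _ (map_neg _), Matrix.neg_mulVec, ← sub_eq_add_neg, add_sub_assoc, hP] at hC
  rw [← sub_eq_add_neg, add_sub_assoc, hP] at h1
  set w := cx(P) *ᵥ Sum.elim c (-y) with hw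
  have hSw : cx(M.S) *ᵥ w = s • w := by
    have h4 : cx(M.S) * cx(P) = cx(P) * fromBlocks cx(S₁) cx(S₁₂) 0 cx(S₂) := by
      have h5 : M.S * P = P * fromBlocks S₁ S₁₂ 0 S₂ := by
        rw [← hS, Matrix.mul_assoc Q, ← Matrix.mul_assoc P, hPQ, Matrix.one_mul]
      rw [← Matrix.map_mul, h5, Matrix.map_mul, Matrix.fromBlocks_map,
        Matrix.map_zero _ (map_zero _)]
    rw [hw, Matrix.mulVec_mulVec, h4, ← Matrix.mulVec_mulVec, ← Matrix.mulVec_smul,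
      Matrix.fromBlocks_mulVec, smul_sumElim, Sum.elim_comp_inl, Sum.elim_comp_inr,
      Matrix.zero_mulVec, zero_add, Matrix.mulVec_neg, Matrix.mulVec_neg, h2, h3, smul_neg]
  have h6 : Sum.elim x (-w) = 0 := by
    refine h.hautus hs ?_ ?_
    · rw [Matrix.fromBlocks_map, Matrix.fromBlocks_mulVec, smul_sumElim, Sum.elim_comp_inl,
        Sum.elim_comp_inr, Matrix.map_zero _ (map_zero _), Matrix.zero_mulVec, zero_add,
        Matrix.map_neg _ (map_neg _), Matrix.neg_mulVec, Matrix.mulVec_neg, neg_neg, h1,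
        Matrix.mulVec_neg, hSw, smul_neg]
    · rw [cx_fromCols, Matrix.fromCols_mulVec_sumElim, Matrix.map_neg _ (map_neg _),
        Matrix.neg_mulVec, Matrix.mulVec_neg, neg_neg, hC]
  rw [← Sum.elim_zero_zero, Sum.elim_eq_iff, neg_eq_zero] at h6
  have h7 : Sum.elim c (-y) = 0 := by
    have h8 := congrArg (fun z => cx(Q) *ᵥ z) h6.2
    beta_reduce at h8
    rwa [hw, Matrix.mulVec_mulVec, ← Matrix.map_mul, hQP, Matrix.map_one _ (map_zero _) (map_one _),
      Matrix.one_mulVec, Matrix.mulVec_zero] at h8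
  rw [← Sum.elim_zero_zero, Sum.elim_eq_iff, neg_eq_zero] at h7
  rw [h6.1, h7.1, h7.2, Sum.elim_zero_zero, Sum.elim_zero_zero]

/-- The absorbed modes are uncontrollable but Schur stable, so they affect neither stabilizability
nor zeros on or outside the unit circle. -/
theorem Admissible.augment {Q : Matrix (Fin a ⊕ Fin b) (Fin M.d) ℝ} (hM : M.Admissible)
    (hPQ : P * Q = 1) (hQP : Q * P = 1) (hS : Q * M.S * P = fromBlocks S₁ S₁₂ 0 S₂)
    (hS₁ : IsSchur S₁) : (M.augment P S₁ S₁₂ S₂).Admissible := by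
  have hstab : Stabilizable (fromBlocks M.A (M.E * P.toCols₁) 0 S₁)
      (fromRows M.B (0 : Matrix (Fin a) (Fin M.m) ℝ)) := by
    refine stabilizable_of_hautus fun s hs w hw hwB => ?_
    obtain ⟨w₁, w₂, rfl⟩ := eq_sumElim w
    rw [Matrix.fromBlocks_map, Matrix.vecMul_fromBlocks, smul_sumElim, Sum.elim_eq_iff,
      Sum.elim_comp_inl, Sum.elim_comp_inr, Matrix.map_zero _ (map_zero _), Matrix.vecMul_zero,
      add_zero] at hw
    rw [cx_fromRows, vecMul_fromRows_sumElim, Matrix.map_zero _ (map_zero _), Matrix.vecMul_zero,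
      add_zero] at hwB
    have h1 := hM.stabilizable.hautus hs hw.1 hwB
    have h2 := hw.2
    rw [h1, Matrix.zero_vecMul, zero_add] at h2
    rw [h1, hS₁.eq_zero_of_vecMul hs h2, Sum.elim_zero_zero]
  refine ⟨hstab.submatrix _, ?_, ?_, ?_, ?_⟩
  · exact (detectable_augment hPQ hQP hS hM.detectable_output).submatrix_fromBlocks _
  · obtain ⟨R, hR⟩ := hM.rightInvertible
    exact ⟨R, by rw [transfer_augment]; exact hR⟩
  · have h1 := detectable_augment (G := 0) hPQ hQP hS (by
      rw [neg_zero]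
      exact hM.detectable_measurement)
    rw [Matrix.zero_mul, Matrix.zero_mul, neg_zero] at h1
    exact h1.submatrix_fromBlocks _
  · intro s hs hz hsS
    have hz₁ : IsInvariantZero (fromBlocks M.A (M.E * P.toCols₁) 0 S₁)
        (fromRows M.B (0 : Matrix (Fin a) (Fin M.m) ℝ)) (fromCols M.C (M.G * P.toCols₁))
        (0 : Matrix (Fin p) (Fin M.m) ℝ) s := (isInvariantZero_submatrix finSumFinEquiv.symm).1 hz
    have hz' : IsInvariantZero M.A M.B M.C 0 s := by
      by_contra hcon
      refine not_isInvariantZero_of_injective (fun w hw => ?_) hz₁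
      obtain ⟨w', c, rfl⟩ := eq_sumElim w
      obtain ⟨w₁, w₂, rfl⟩ := eq_sumElim w'
      rw [rosenbrock_vecMul_eq_zero_iff, Matrix.fromBlocks_map, Matrix.vecMul_fromBlocks,
        smul_sumElim, cx_fromCols, Matrix.vecMul_fromCols, ← Sum.elim_add_add, Sum.elim_eq_iff,
        Sum.elim_comp_inl, Sum.elim_comp_inr, Matrix.map_zero _ (map_zero _),
        Matrix.map_zero _ (map_zero _), Matrix.vecMul_zero, Matrix.vecMul_zero, add_zero,
        cx_fromRows, vecMul_fromRows_sumElim, Matrix.map_zero _ (map_zero _), Matrix.vecMul_zero,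
        add_zero] at hw
      have h1 := hM.rightInvertible.injective_of_not_isInvariantZero hcon (Sum.elim w₁ c) (by
        rw [rosenbrock_vecMul_eq_zero_iff, Matrix.map_zero _ (map_zero _), Matrix.vecMul_zero]
        exact ⟨hw.1.1, hw.2⟩)
      rw [← Sum.elim_zero_zero, Sum.elim_eq_iff] at h1
      have h2 := hw.1.2
      rw [h1.1, h1.2, Matrix.zero_vecMul, Matrix.zero_vecMul, zero_add, add_zero] at h2
      rw [h1.1, h1.2, hS₁.eq_zero_of_vecMul hs h2, Sum.elim_zero_zero, Sum.elim_zero_zero]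
    refine hM.zeros s hs hz' ?_
    have hsS₂ : s ∈ eigenvalues S₂ := hsS
    obtain ⟨v, hv0, hv⟩ := mem_eigenvalues_iff_vecMul.1 hsS₂
    -- S₂ is a quotient of S, so its left eigenvectors pull back through Q.
    refine mem_eigenvalues_iff_vecMul.2 ⟨Sum.elim 0 v ᵥ* cx(Q), fun h0 => hv0 ?_, ?_⟩
    · have h1 := congrArg (fun z => z ᵥ* cx(P)) h0
      beta_reduce at h1
      rw [Matrix.vecMul_vecMul, ← Matrix.map_mul, hQP, Matrix.map_one _ (map_zero _) (map_one _),
        Matrix.vecMul_one, Matrix.zero_vecMul, ← Sum.elim_zero_zero, Sum.elim_eq_iff] at h1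
      exact h1.2
    · have h1 : Q * M.S = fromBlocks S₁ S₁₂ 0 S₂ * Q := by
        rw [← hS, Matrix.mul_assoc, hPQ, Matrix.mul_one]
      rw [Matrix.vecMul_vecMul, ← Matrix.map_mul, h1, Matrix.map_mul, ← Matrix.vecMul_vecMul,
        Matrix.fromBlocks_map, Matrix.vecMul_fromBlocks, Sum.elim_comp_inl, Sum.elim_comp_inr,
        Matrix.zero_vecMul, Matrix.zero_vecMul, Matrix.map_zero _ (map_zero _), Matrix.vecMul_zero,
        zero_add, zero_add, ← Matrix.smul_vecMul, smul_sumElim, smul_zero]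
      congr 2

/-- A trajectory of the agent is a trajectory of the augmented agent. -/
theorem Dynamics.augment {Q : Matrix (Fin a ⊕ Fin b) (Fin M.d) ℝ} (hPQ : P * Q = 1)
    (hS : Q * M.S * P = fromBlocks S₁ S₁₂ 0 S₂) {x : ℕ → Fin M.n → ℝ} {w : ℕ → Fin M.d → ℝ}
    {u : ℕ → Fin M.m → ℝ} (h : M.Dynamics x w u) :
    ∃ (x' : ℕ → Fin (M.augment P S₁ S₁₂ S₂).n → ℝ) (w' : ℕ → Fin (M.augment P S₁ S₁₂ S₂).d → ℝ),
      (M.augment P S₁ S₁₂ S₂).Dynamics x' w' u ∧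
      (M.augment P S₁ S₁₂ S₂).output x' w' = M.output x w ∧
      (M.augment P S₁ S₁₂ S₂).measurement x' = M.measurement x := by
  let w₁ : ℕ → Fin a → ℝ := fun k => (Q *ᵥ w k) ∘ Sum.inl
  let w₂ : ℕ → Fin b → ℝ := fun k => (Q *ᵥ w k) ∘ Sum.inr
  have hw : ∀ k, Q *ᵥ w k = Sum.elim (w₁ k) (w₂ k) := fun k => (Sum.elim_comp_inl_inr _).symm
  have hP : ∀ {ι : Type} (E : Matrix ι (Fin M.d) ℝ) k, E *ᵥ w k
      = (E * P.toCols₁) *ᵥ w₁ k + (E * P.toCols₂) *ᵥ w₂ k := fun E k => by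
    have h1 : w k = P *ᵥ (Q *ᵥ w k) := by rw [Matrix.mulVec_mulVec, hPQ, Matrix.one_mulVec]
    conv_lhs => rw [h1, hw, ← Matrix.fromCols_toCols P, Matrix.fromCols_mulVec_sumElim,
      Matrix.mulVec_add, Matrix.mulVec_mulVec, Matrix.mulVec_mulVec]
  have hstep : ∀ k, w₁ (k + 1) = S₁ *ᵥ w₁ k + S₁₂ *ᵥ w₂ k ∧ w₂ (k + 1) = S₂ *ᵥ w₂ k := fun k => by
    have h1 : Q * M.S = fromBlocks S₁ S₁₂ 0 S₂ * Q := by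
      rw [← hS, Matrix.mul_assoc, hPQ, Matrix.mul_one]
    have h2 := hw (k + 1)
    rw [h.disturbance, Matrix.mulVec_mulVec, h1, ← Matrix.mulVec_mulVec, hw,
      Matrix.fromBlocks_mulVec, Sum.elim_comp_inl, Sum.elim_comp_inr, Matrix.zero_mulVec, zero_add,
      Sum.elim_eq_iff] at h2
    exact ⟨h2.1.symm, h2.2.symm⟩
  let e : Fin (M.n + a) ≃ Fin M.n ⊕ Fin a := finSumFinEquiv.symm
  have hrow : ∀ {q : ℕ} (E : Matrix (Fin M.n ⊕ Fin a) (Fin q) ℝ) (y : Fin q → ℝ),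
      E.submatrix e id *ᵥ y = (E *ᵥ y) ∘ e := fun E y => rfl
  have hcol : ∀ {q : ℕ} (E : Matrix (Fin q) (Fin M.n ⊕ Fin a) ℝ) (y : Fin M.n ⊕ Fin a → ℝ),
      E.submatrix id e *ᵥ (y ∘ e) = E *ᵥ y := fun E y => by
    rw [submatrix_mulVec_comp, Function.comp_assoc, Equiv.self_comp_symm, Function.comp_id]
  refine ⟨fun k => Sum.elim (x k) (w₁ k) ∘ e, w₂, ⟨fun k => ?_, fun k => (hstep k).2⟩,
    funext fun k => ?_, funext fun k => ?_⟩
  · change Sum.elim (x (k + 1)) (w₁ (k + 1)) ∘ e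
      = (fromBlocks M.A (M.E * P.toCols₁) 0 S₁).submatrix e e *ᵥ (Sum.elim (x k) (w₁ k) ∘ e)
        + (fromRows M.B 0).submatrix e id *ᵥ u k
        + (fromRows (M.E * P.toCols₂) S₁₂).submatrix e id *ᵥ w₂ k
    rw [hrow, hrow, Matrix.submatrix_mulVec_equiv, Function.comp_assoc, Equiv.self_comp_symm,
      Function.comp_id, Matrix.fromBlocks_mulVec, Matrix.fromRows_mulVec, Matrix.fromRows_mulVec,
      Sum.elim_comp_inl, Sum.elim_comp_inr, Matrix.zero_mulVec, Matrix.zero_mulVec, zero_add,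
      h.state, (hstep k).1, hP M.E k]
    have h1 : ∀ f g h : Fin M.n ⊕ Fin a → ℝ, f ∘ e + g ∘ e + h ∘ e = (f + g + h) ∘ e :=
      fun _ _ _ => rfl
    rw [h1, ← Sum.elim_add_add, ← Sum.elim_add_add, add_zero]
    congr 2
    abel
  · change (fromCols M.C (M.G * P.toCols₁)).submatrix id e *ᵥ (Sum.elim (x k) (w₁ k) ∘ e)
      + (M.G * P.toCols₂) *ᵥ w₂ k = M.C *ᵥ x k + M.G *ᵥ w k
    rw [hcol, Matrix.fromCols_mulVec_sumElim, hP M.G k, add_assoc]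
  · change (fromCols M.Cm 0).submatrix id e *ᵥ (Sum.elim (x k) (w₁ k) ∘ e) = M.Cm *ᵥ x k
    rw [hcol, Matrix.fromCols_mulVec_sumElim, Matrix.zero_mulVec, add_zero]

end AgentModel

/-! ### The explicit protocol as a protocol -/

namespace PreCompensators

variable {p : ℕ} {M : AgentModel p} (D : PreCompensators M) (T : TargetModel p)

/-- The states `(q, pp, ξ, x̂, χ)` of the explicit protocol. -/
abbrev ProtocolState : Type :=
  (Fin D.nq → ℝ) × (Fin M.d → ℝ) × (Fin D.nh → ℝ) × (Fin T.h → ℝ) × (Fin T.h → ℝ)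

variable {T} (H : Matrix (Fin T.h) (Fin p) ℝ) (K : Matrix (Fin p) (Fin T.h) ℝ)

/-- The signal `v` as a linear function of the protocol state and the measurement. -/
def vMap : (D.ProtocolState T × (Fin M.l → ℝ)) →ₗ[ℝ] (Fin p → ℝ) where
  toFun s := D.v s.2 s.1.2.1 s.1.2.2.1 (-(K *ᵥ s.1.2.2.2.2))
  map_add' s t := by
    simp only [v, zbar, Prod.fst_add, Prod.snd_add, Matrix.mulVec_add, Matrix.mulVec_sub,
      Matrix.mulVec_neg]
    abel
  map_smul' c s := by
    simp only [v, zbar, Prod.smul_fst, Prod.smul_snd, Matrix.mulVec_smul, Matrix.mulVec_sub,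
      Matrix.mulVec_neg, RingHom.id_apply, smul_add, smul_sub, smul_neg]

/-- The signal `uq` as a linear function of the protocol state and the measurement. -/
def uqMap : (D.ProtocolState T × (Fin M.l → ℝ)) →ₗ[ℝ] (Fin p → ℝ) where
  toFun s := D.uq s.2 s.1.2.1 s.1.2.2.1 (-(K *ᵥ s.1.2.2.2.2))
  map_add' s t := by
    have h : D.uq (s + t).2 (s + t).1.2.1 (s + t).1.2.2.1 (-(K *ᵥ (s + t).1.2.2.2.2))
      = D.Gam *ᵥ (s + t).1.2.1 + D.Dp *ᵥ D.vMap K (s + t) := rfl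
    rw [h, map_add, Matrix.mulVec_add, Prod.fst_add, Prod.snd_add, Prod.fst_add, Matrix.mulVec_add]
    exact add_add_add_comm _ _ _ _
  map_smul' c s := by
    have h : D.uq (c • s).2 (c • s).1.2.1 (c • s).1.2.2.1 (-(K *ᵥ (c • s).1.2.2.2.2))
      = D.Gam *ᵥ (c • s).1.2.1 + D.Dp *ᵥ D.vMap K (c • s) := rfl
    rw [h, map_smul, Matrix.mulVec_smul, Prod.smul_fst, Prod.smul_snd, Prod.smul_fst,
      Matrix.mulVec_smul]
    exact (smul_add _ _ _).symm

/-- The state update of the explicit protocol, without the information from the network. -/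
def stepMap : (D.ProtocolState T × (Fin M.l → ℝ)) →ₗ[ℝ] D.ProtocolState T where
  toFun s := (D.Aq *ᵥ s.1.1 + D.Bq *ᵥ D.uqMap K s, M.S *ᵥ s.1.2.1 + D.Bp *ᵥ D.vMap K s,
    D.Ah *ᵥ s.1.2.2.1 + D.Bh *ᵥ D.zbar s.2 s.1.2.1 + D.Eh *ᵥ (-(K *ᵥ s.1.2.2.2.2)),
    T.A *ᵥ s.1.2.2.2.1 - H *ᵥ (T.C *ᵥ s.1.2.2.2.1),
    T.A *ᵥ s.1.2.2.2.2 + T.B *ᵥ (-(K *ᵥ s.1.2.2.2.2)) + T.A *ᵥ s.1.2.2.2.1)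
  map_add' s t := by
    simp only [map_add, zbar, Prod.fst_add, Prod.snd_add, Matrix.mulVec_add, Matrix.mulVec_sub,
      Matrix.mulVec_neg, Prod.mk_add_mk, Prod.mk.injEq]
    refine ⟨?_, ?_, ?_, ?_, ?_⟩ <;> abel
  map_smul' c s := by
    simp only [map_smul, zbar, Prod.smul_fst, Prod.smul_snd, Matrix.mulVec_smul, Matrix.mulVec_sub,
      Matrix.mulVec_neg, Prod.smul_mk, RingHom.id_apply, smul_add, smul_sub,
      smul_neg]

/-- The part of the state update that is multiplied by the local gain. -/
def gainMap : D.ProtocolState T →ₗ[ℝ] D.ProtocolState T where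
  toFun s := (0, 0, 0, -((T.B * K) *ᵥ s.2.2.2.2), -(T.A *ᵥ s.2.2.2.2))
  map_add' s t := by
    simp only [Prod.snd_add, Matrix.mulVec_add, Prod.mk_add_mk, neg_add, add_zero]
  map_smul' c s := by
    simp only [Prod.smul_snd, Matrix.mulVec_smul, Prod.smul_mk, RingHom.id_apply, smul_neg,
      smul_zero]

/-- The injection of the relative output information. -/
def zetaTildeMap : (Fin p → ℝ) →ₗ[ℝ] D.ProtocolState T where
  toFun z := (0, 0, 0, H *ᵥ z, 0)
  map_add' s t := by simp [Matrix.mulVec_add]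
  map_smul' c s := by simp [Matrix.mulVec_smul]

/-- The injection of the exchanged protocol information. -/
def zetaHatMap : (Fin T.h → ℝ) →ₗ[ℝ] D.ProtocolState T where
  toFun z := (0, 0, 0, -((T.B * K) *ᵥ z), -(T.A *ᵥ z))
  map_add' s t := by
    simp only [Matrix.mulVec_add, Prod.mk_add_mk, neg_add, add_zero]
  map_smul' c s := by
    simp only [Matrix.mulVec_smul, Prod.smul_mk, RingHom.id_apply, smul_neg, smul_zero]

/-- The control input as a linear function of the protocol state and the measurement. -/
def controlMap : (D.ProtocolState T × (Fin M.l → ℝ)) →ₗ[ℝ] (Fin M.m → ℝ) where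
  toFun s := D.Cq *ᵥ s.1.1 + D.Dq *ᵥ D.uqMap K s
  map_add' s t := by
    rw [map_add, Prod.fst_add, Prod.fst_add, Matrix.mulVec_add, Matrix.mulVec_add]
    exact add_add_add_comm _ _ _ _
  map_smul' c s := by
    rw [map_smul, Prod.smul_fst, Prod.smul_fst, Matrix.mulVec_smul, Matrix.mulVec_smul]
    exact (smul_add _ _ _).symm

/-- The exchanged part of the protocol state. -/
def exchangeMap : D.ProtocolState T →ₗ[ℝ] (Fin T.h → ℝ) where
  toFun s := s.2.2.2.2
  map_add' _ _ := rfl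
  map_smul' _ _ := rfl

variable (T) in
/-- Coordinates on the states of the explicit protocol. -/
def protocolCoords :
    D.ProtocolState T ≃ₗ[ℝ] (Fin (Module.finrank ℝ (D.ProtocolState T)) → ℝ) :=
  (Module.finBasis ℝ (D.ProtocolState T)).equivFun

/-- The combination of the three pre-compensators with the observer-based protocol. -/
def protocol : Protocol M T.h where
  nc := Module.finrank ℝ (D.ProtocolState T)
  Ac := LinearMap.toMatrix' ((D.protocolCoords T).toLinearMap ∘ₗ D.stepMap H K ∘ₗ
    LinearMap.inl ℝ _ _ ∘ₗ (D.protocolCoords T).symm.toLinearMap)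
  Lc := LinearMap.toMatrix' ((D.protocolCoords T).toLinearMap ∘ₗ D.gainMap K ∘ₗ
    (D.protocolCoords T).symm.toLinearMap)
  Bc := LinearMap.toMatrix' ((D.protocolCoords T).toLinearMap ∘ₗ D.zetaTildeMap H)
  Cc := LinearMap.toMatrix' ((D.protocolCoords T).toLinearMap ∘ₗ D.zetaHatMap K)
  Dc := LinearMap.toMatrix' ((D.protocolCoords T).toLinearMap ∘ₗ D.stepMap H K ∘ₗ
    LinearMap.inr ℝ _ _)
  Ec := LinearMap.toMatrix' (D.controlMap K ∘ₗ LinearMap.inl ℝ _ _ ∘ₗ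
    (D.protocolCoords T).symm.toLinearMap)
  -- The input depends on the network only through the state, by ǔ = -K χ, so there is no
  -- feedthrough from ζ̃ and ζ̂.
  Fc := 0
  Gc := 0
  Hc := LinearMap.toMatrix' (D.controlMap K ∘ₗ LinearMap.inr ℝ _ _)
  Mc := LinearMap.toMatrix' (D.exchangeMap ∘ₗ (D.protocolCoords T).symm.toLinearMap)

theorem protocol_Mc_mulVec (xc : Fin (D.protocol H K).nc → ℝ) :
    (D.protocol H K).Mc *ᵥ xc = ((D.protocolCoords T).symm xc).2.2.2.2 :=
  LinearMap.toMatrix'_mulVec _ _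

theorem protocol_control (xc : Fin (D.protocol H K).nc → ℝ) (ζ : Fin p → ℝ) (ζ' : Fin T.h → ℝ)
    (z : Fin M.l → ℝ) :
    (D.protocol H K).Ec *ᵥ xc + (D.protocol H K).Fc *ᵥ ζ + (D.protocol H K).Gc *ᵥ ζ'
      + (D.protocol H K).Hc *ᵥ z = D.controlMap K ((D.protocolCoords T).symm xc, z) := by
  have h1 : (D.protocol H K).Ec *ᵥ xc = D.controlMap K ((D.protocolCoords T).symm xc, 0) :=
    LinearMap.toMatrix'_mulVec _ _
  have h2 : (D.protocol H K).Hc *ᵥ z = D.controlMap K ((0 : D.ProtocolState T), z) :=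
    LinearMap.toMatrix'_mulVec _ _
  have h3 : (D.protocol H K).Fc *ᵥ ζ = 0 := Matrix.zero_mulVec _
  have h4 : (D.protocol H K).Gc *ᵥ ζ' = 0 := Matrix.zero_mulVec _
  rw [h1, h2, h3, h4, add_zero, add_zero, ← map_add, Prod.mk_add_mk, add_zero, zero_add]

theorem protocol_step (g : ℝ) (xc : Fin (D.protocol H K).nc → ℝ) (ζ : Fin p → ℝ)
    (ζ' : Fin T.h → ℝ) (z : Fin M.l → ℝ) :
    (D.protocolCoords T).symm (((D.protocol H K).Ac + g • (D.protocol H K).Lc) *ᵥ xc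
      + (D.protocol H K).Bc *ᵥ ζ + (D.protocol H K).Cc *ᵥ ζ' + (D.protocol H K).Dc *ᵥ z)
      = D.stepMap H K ((D.protocolCoords T).symm xc, z)
        + g • D.gainMap K ((D.protocolCoords T).symm xc) + D.zetaTildeMap H ζ
        + D.zetaHatMap K ζ' := by
  have h1 : (D.protocol H K).Ac *ᵥ xc
      = D.protocolCoords T (D.stepMap H K ((D.protocolCoords T).symm xc, 0)) :=
    LinearMap.toMatrix'_mulVec _ _
  have h2 : (D.protocol H K).Dc *ᵥ z
      = D.protocolCoords T (D.stepMap H K ((0 : D.ProtocolState T), z)) :=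
    LinearMap.toMatrix'_mulVec _ _
  have h3 : (D.protocol H K).Lc *ᵥ xc
      = D.protocolCoords T (D.gainMap K ((D.protocolCoords T).symm xc)) :=
    LinearMap.toMatrix'_mulVec _ _
  have h4 : (D.protocol H K).Bc *ᵥ ζ = D.protocolCoords T (D.zetaTildeMap H ζ) :=
    LinearMap.toMatrix'_mulVec _ _
  have h5 : (D.protocol H K).Cc *ᵥ ζ' = D.protocolCoords T (D.zetaHatMap K ζ') :=
    LinearMap.toMatrix'_mulVec _ _
  have h6 : D.stepMap H K ((D.protocolCoords T).symm xc, z)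
      = D.stepMap H K ((D.protocolCoords T).symm xc, 0)
        + D.stepMap H K ((0 : D.ProtocolState T), z) := by
    rw [← map_add, Prod.mk_add_mk, add_zero, zero_add]
  have key : ∀ a b c d e : D.ProtocolState T, (D.protocolCoords T).symm (D.protocolCoords T a
      + g • D.protocolCoords T b + D.protocolCoords T c + D.protocolCoords T d
      + D.protocolCoords T e) = a + g • b + c + d + e := fun a b c d e => by
    simp only [map_add, map_smul, LinearEquiv.symm_apply_apply]
  rw [Matrix.add_mulVec, Matrix.smul_mulVec, h1, h2, h3, h4, h5, h6]
  refine (key _ _ _ _ _).trans ?_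
  abel

end PreCompensators

/-- A closed loop with the explicit protocols. -/
theorem IsClosedLoop.isExplicitClosedLoop {p r N : ℕ} {Ar : Matrix (Fin r) (Fin r) ℝ}
    {Cr : Matrix (Fin p) (Fin r) ℝ} {M : Fin N → AgentModel p} {T : TargetModel p}
    {H : Matrix (Fin T.h) (Fin p) ℝ} {K : Matrix (Fin p) (Fin T.h) ℝ}
    {D : ∀ i, PreCompensators (M i)} {G : Network N} {xr : ℕ → Fin r → ℝ}
    {x : ∀ i, ℕ → Fin (M i).n → ℝ} {w : ∀ i, ℕ → Fin (M i).d → ℝ} {u : ∀ i, ℕ → Fin (M i).m → ℝ}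
    {xc : ∀ i, ℕ → Fin ((D i).protocol H K).nc → ℝ}
    (h : IsClosedLoop Ar Cr M (fun i => (D i).protocol H K) G xr x w u xc) :
    IsExplicitClosedLoop Ar Cr M T H K D G xr x w u
      (fun i k => (((D i).protocolCoords T).symm (xc i k)).1)
      (fun i k => (((D i).protocolCoords T).symm (xc i k)).2.1)
      (fun i k => (((D i).protocolCoords T).symm (xc i k)).2.2.1)
      (fun i k => (((D i).protocolCoords T).symm (xc i k)).2.2.2.1)
      (fun i k => (((D i).protocolCoords T).symm (xc i k)).2.2.2.2) := by
  have hMc : (fun j t => ((D j).protocol H K).Mc *ᵥ xc j t)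
      = fun i k => (((D i).protocolCoords T).symm (xc i k)).2.2.2.2 := by
    funext i k
    exact (D i).protocol_Mc_mulVec H K _
  have hstep : ∀ i k, ((D i).protocolCoords T).symm (xc i (k + 1)) = _ := fun i k =>
    (congrArg ((D i).protocolCoords T).symm (h.protocol i k)).trans
      ((D i).protocol_step H K (G.gain i) (xc i k) _ _ _)
  rw [hMc] at hstep
  refine ⟨h.reference, h.agent, fun i k => ?_, fun i k => ?_, fun i k => ?_, fun i k => ?_,
    fun i k => ?_, fun i k => ?_⟩
  · refine (congrArg (fun s => s.1) (hstep i k)).trans ?_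
    simp [PreCompensators.stepMap, PreCompensators.gainMap, PreCompensators.zetaTildeMap,
      PreCompensators.zetaHatMap, PreCompensators.uqMap]
  · refine (congrArg (fun s => s.2.1) (hstep i k)).trans ?_
    simp [PreCompensators.stepMap, PreCompensators.gainMap, PreCompensators.zetaTildeMap,
      PreCompensators.zetaHatMap, PreCompensators.vMap]
  · refine (congrArg (fun s => s.2.2.1) (hstep i k)).trans ?_
    simp [PreCompensators.stepMap, PreCompensators.gainMap, PreCompensators.zetaTildeMap,
      PreCompensators.zetaHatMap]
  · refine (congrArg (fun s => s.2.2.2.1) (hstep i k)).trans ?_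
    simp only [PreCompensators.stepMap, PreCompensators.gainMap, PreCompensators.zetaTildeMap,
      PreCompensators.zetaHatMap, LinearMap.coe_mk, AddHom.coe_mk, Prod.snd_add, Prod.fst_add,
      Prod.smul_snd, Prod.smul_fst, Matrix.mulVec_sub, smul_neg]
    abel
  · refine (congrArg (fun s => s.2.2.2.2) (hstep i k)).trans ?_
    simp only [PreCompensators.stepMap, PreCompensators.gainMap, PreCompensators.zetaTildeMap,
      PreCompensators.zetaHatMap, LinearMap.coe_mk, AddHom.coe_mk, Prod.snd_add,
      Prod.smul_snd, Matrix.mulVec_sub, smul_neg, Matrix.mulVec_smul]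
    abel
  · exact (h.control i k).trans ((D i).protocol_control H K _ _ _ _)

/-- Synchronization is solvable when it is for the models with augmented states. -/
theorem ScalableRegulatedSynchronizationSolvable.of_augment {p r : ℕ} {J : Type*}
    {Ar : Matrix (Fin r) (Fin r) ℝ} {Cr : Matrix (Fin p) (Fin r) ℝ} {M : J → AgentModel p}
    {a b : J → ℕ} {P : ∀ j, Matrix (Fin (M j).d) (Fin (a j) ⊕ Fin (b j)) ℝ}
    {Q : ∀ j, Matrix (Fin (a j) ⊕ Fin (b j)) (Fin (M j).d) ℝ}
    {S₁ : ∀ j, Matrix (Fin (a j)) (Fin (a j)) ℝ} {S₁₂ : ∀ j, Matrix (Fin (a j)) (Fin (b j)) ℝ}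
    {S₂ : ∀ j, Matrix (Fin (b j)) (Fin (b j)) ℝ} (hPQ : ∀ j, P j * Q j = 1)
    (hS : ∀ j, Q j * (M j).S * P j = fromBlocks (S₁ j) (S₁₂ j) 0 (S₂ j))
    (h : ScalableRegulatedSynchronizationSolvable Ar Cr
      fun j => (M j).augment (P j) (S₁ j) (S₁₂ j) (S₂ j)) :
    ScalableRegulatedSynchronizationSolvable Ar Cr M := by
  obtain ⟨s, C, hC⟩ := h
  -- Augmentation leaves the inputs and measurements of the agent unchanged, so the protocol
  -- matrices for the augmented model serve the original one; trajectories are lifted by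
  -- `AgentModel.Dynamics.augment`.
  refine ⟨s, fun j => ⟨(C j).nc, (C j).Ac, (C j).Lc, (C j).Bc, (C j).Cc, (C j).Dc, (C j).Ec,
    (C j).Fc, (C j).Gc, (C j).Hc, (C j).Mc⟩, ?_⟩
  intro N G hG g xr x w u xc hcl i
  choose x' w' hdyn hout hmeas using fun i =>
    (hcl.agent i).augment (S₁ := S₁ (g i)) (S₁₂ := S₁₂ (g i)) (S₂ := S₂ (g i)) (hPQ (g i))
      (hS (g i))
  have h1 := hC N G hG g xr x' w' u xc ⟨hcl.reference, hdyn, fun i k => ?_, fun i k => ?_⟩ i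
  · rw [hout] at h1
    exact h1
  · simp only [hout, hmeas]
    exact hcl.protocol i k
  · simp only [hout, hmeas]
    exact hcl.control i k

end MAS

end

/-! ### The main theorem -/

theorem theorem2 {p r : ℕ} {J : Type*}
    (Ar : Matrix (Fin r) (Fin r) ℝ) (Cr : Matrix (Fin p) (Fin r) ℝ)
    (hAr : ∀ s ∈ MAS.eigenvalues Ar, ‖s‖ = 1)
    (hobs : MAS.Observable Cr Ar)
    (M : J → MAS.AgentModel p)
    (hM : ∀ j, (M j).Admissible)
    (hbdd : BddAbove (⋃ j, MAS.infiniteZeroOrders (M j).A (M j).B (M j).C)) :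
    MAS.ScalableRegulatedSynchronizationSolvable Ar Cr M ∧
    ∀ nq : ℕ, 1 ≤ nq → MAS.observabilityIndex Cr Ar ≤ nq →
      nq ∈ upperBounds (⋃ j, MAS.infiniteZeroOrders (M j).A (M j).B (M j).C) →
      (∃ T : MAS.TargetModel p, T.Remodels Ar Cr nq) ∧
      ∀ T : MAS.TargetModel p, T.Remodels Ar Cr nq →
        (∃ H K, T.IsGainPair H K) ∧
        (∀ j, (∀ s ∈ MAS.eigenvalues (M j).S, 1 ≤ ‖s‖) →
          ∃ D : MAS.PreCompensators (M j), D.IsDesign T) ∧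
        ∀ H K, T.IsGainPair H K →
          ∀ (N : ℕ) (G : MAS.Network N), G.Rooted → ∀ (g : Fin N → J)
            (D : ∀ i, MAS.PreCompensators (M (g i))), (∀ i, (D i).IsDesign T) →
            ∀ (xr : ℕ → Fin r → ℝ)
              (x : ∀ i, ℕ → Fin (M (g i)).n → ℝ) (w : ∀ i, ℕ → Fin (M (g i)).d → ℝ)
              (u : ∀ i, ℕ → Fin (M (g i)).m → ℝ)
              (q : ∀ i, ℕ → Fin (D i).nq → ℝ) (pp : ∀ i, ℕ → Fin (M (g i)).d → ℝ)
              (xi : ∀ i, ℕ → Fin (D i).nh → ℝ) (xhat chi : Fin N → ℕ → Fin T.h → ℝ),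
              MAS.IsExplicitClosedLoop Ar Cr (fun i => M (g i)) T H K D G
                xr x w u q pp xi xhat chi →
              ∀ i, Tendsto (fun k => (M (g i)).output (x i) (w i) k - Cr *ᵥ xr k) atTop (𝓝 0) := by
  refine ⟨?_, fun nq hnq hidx hub => ⟨?_, fun T hT => ⟨hT.exists_gainPair, fun j hS => ?_, ?_⟩⟩⟩
  · obtain ⟨b₀, hb₀⟩ := hbdd
    -- One n_q for the whole family exists because the infinite zero orders are bounded; this fixes
    -- a common target model, and so the dimension of the exchanged variable.
    let nq := max 1 (max (MAS.observabilityIndex Cr Ar) b₀)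
    obtain ⟨T, hT⟩ := MAS.exists_targetModel (nq := nq) (le_max_left _ _) fun x hx =>
      MAS.eq_zero_of_observabilityIndex_le hobs ((le_max_left _ _).trans (le_max_right _ _)) hx
    obtain ⟨H, K, hHK⟩ := hT.exists_gainPair
    -- The design requires a generator without eigenvalues in the open unit disc, so the decaying
    -- modes of each S_j are first absorbed into the agent.
    choose a b P Q S₁ S₁₂ S₂ hPQ hQP hS hS₁ hS₂ using fun j => MAS.exists_stable_splitting (M j).S
    have hM' := fun j => (hM j).augment (hPQ j) (hQP j) (hS j) (hS₁ j)
    choose D hD using fun j => (hM' j).exists_isDesign hT (hS₂ j) fun c hc => by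
      rw [MAS.AgentModel.infiniteZeroOrders_augment] at hc
      exact (hb₀ (Set.mem_iUnion.2 ⟨j, hc⟩)).trans ((le_max_right _ _).trans (le_max_right _ _))
    refine MAS.ScalableRegulatedSynchronizationSolvable.of_augment hPQ hS
      ⟨T.h, fun j => (D j).protocol H K, ?_⟩
    intro N G hG g xr x w u xc hcl i
    exact MAS.explicit_protocol_synchronizes hAr hT.charpoly hT.outputs hHK G hG
      (fun i => D (g i)) (fun i => (hD (g i)).step2) (fun i => (hD (g i)).step4)
      hcl.isExplicitClosedLoop i
  · exact MAS.exists_targetModel hnq fun x hx => MAS.eq_zero_of_observabilityIndex_le hobs hidx hx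
  · exact (hM j).exists_isDesign hT hS fun c hc => hub (Set.mem_iUnion.2 ⟨j, hc⟩)
  · intro H K hHK N G hG g D hD xr x w u q pp xi xhat chi hcl i
    exact MAS.explicit_protocol_synchronizes hAr hT.charpoly hT.outputs hHK G hG D
      (fun i => (hD i).step2) (fun i => (hD i).step4) hcl i
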